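/- Let $G=\exp(\mathfrak g)$ be a Carnot group: $\mathfrak g=\mathfrak g_1\oplus\dots\oplus\mathfrak g_s$ is a finite-dimensional real Lie algebra with $\mathfrak g_{i+1}=[\mathfrak g_1,\mathfrak g_i]$ for $1\le i<s$ and $[\mathfrak g_1,\mathfrak g_s]=\{0\}$, and $\exp:\mathfrak g\to G$ is a bijection that carries the Baker--Campbell--Hausdorff product of $\mathfrak g$ to the product of $G$. Assume that its homogeneous dimension $Q=\sum_i i\dim\mathfrak g_i$ satisfies $Q>2$. Fix a basis $\{E_i\}$ of $\mathfrak g$ adapted to the decomposition (each $E_i$ lies in some $\mathfrak g_k$), declare it orthonormal, and equip $G$ with the coordinates induced by this basis via $\exp$, with the corresponding topology, notion of $C^k$ functions and Lebesgue measure $dq$. Write $0$ for the identity of $G$. For the $E_i$ in $\mathfrak g_1$, say $E_1,\dots,E_{N_1}$, let $$\tilde X_i f(p)=\tfrac{d}{dt} f(p\exp(tE_i))|_{t=0},\qquad \mathcal L f=\sum_{i=1}^{N_1}\tilde X_i\tilde X_i f,\qquad \nabla_0 f=\sum_{i=1}^{N_1}(\tilde X_i f)\tilde X_i,\qquad |\nabla_0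 f|^2=\sum_{i=1}^{N_1}(\tilde X_i f)^2 .$$ Let $\Gamma$ be a fundamental solution of $\mathcal L$: $\Gamma\in C^\infty(G\setminus\{0\})$, $\Gamma\in L^1_{loc}(G)$, $\Gamma(q)\to0$ as $q\to\infty$, and $\int_G\Gamma\,\mathcal L\phi\,dq=\phi(0)$ for all $\phi\in C_0^\infty(G)$. Let $\mathcal N$ be the pseudonorm that it defines, $\mathcal N(p)=(-\Gamma(p))^{1/(2-Q)}$ for $p\ne0$ and $\mathcal N(0)=0$, and let $B(p,r)=\{q\in G:\mathcal N(p^{-1}q)\le r\}$. Let $\Omega\subset G$ be a domain and let $u$ be $\mathcal L$-harmonic in $\Omega$, that is, $u\in C^2(\Omega)$ and $\mathcal Lu=0$ in $\Omega$. Then for every $p\in G$ and $r>0$ with $B(p,r)\Subset\Omega$, $$u(p)=\frac{\int_{B(p,r)}u(q)\,|\nabla_0\mathcal N(p^{-1}q)|^2\,dq}{\int_{B(p,r)}|\nabla_0\mathcal N(p^{-1}q)|^2\,dq}=\frac{\int_{B(0,r)}u(pq)\,|\nabla_0\mathcal N(q)|^2\,dq}{\int_{B(0,r)}|\nabla_0\mathcal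 N(q)|^2\,dq},$$ where all the integrals converge absolutely and the denominators are positive. -/

import Mathlib

open MeasureTheory Filter Topology
open scoped ContDiff

/-- The right-nested Lie bracket `⁅x₁, ⁅x₂, … ⁅xₘ₋₁, xₘ⁆ … ⁆⁆` of a word `x₁ x₂ … xₘ`. -/
def nestedBracket {𝔤 : Type*} [LieRing 𝔤] : List 𝔤 → 𝔤
  | [] => 0
  | [x] => x
  | x :: y :: l => ⁅x, nestedBracket (y :: l)⁆

/-- The Baker-Campbell-Hausdorff series `log (exp X exp Y)` of a Lie algebra that is nilpotent of
step `s`, in Dynkin's form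
`∑ₙ (-1)ⁿ⁻¹ / n ∑ [X^r₁ Y^t₁ ⋯ X^rₙ Y^tₙ] / ((∑ᵢ (rᵢ + tᵢ)) ∏ᵢ rᵢ! tᵢ!)`,
the inner sum being over all `(rᵢ, tᵢ)` with `rᵢ + tᵢ > 0`. All terms with `n > s`, some `rᵢ > s` or
some `tᵢ > s` are brackets of more than `s` letters, hence zero, and are left out. -/
noncomputable def bch {𝔤 : Type*} [LieRing 𝔤] [LieAlgebra ℝ 𝔤] (s : ℕ) (X Y : 𝔤) : 𝔤 :=
  ∑ n ∈ Finset.Icc 1 s, ((-1 : ℝ) ^ (n - 1) / (n : ℝ)) •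
    ∑ a ∈ Fintype.piFinset (fun _ : Fin n =>
        (Finset.range (s + 1) ×ˢ Finset.range (s + 1)).filter (fun e : ℕ × ℕ => 0 < e.1 + e.2)),
      (((∑ i, ((a i).1 + (a i).2) : ℕ) : ℝ) *
          ∏ i, (((a i).1.factorial : ℝ) * ((a i).2.factorial : ℝ)))⁻¹ •
        nestedBracket (List.ofFn (fun i =>
          List.replicate (a i).1 X ++ List.replicate (a i).2 Y)).flatten

/-- A stratification `𝔤 = 𝔤₁ ⊕ ⋯ ⊕ 𝔤ₛ` of a real Lie algebra: `𝔤ᵢ₊₁ = [𝔤₁, 𝔤ᵢ]` and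
`[𝔤₁, 𝔤ₛ] = 0`. Here `layer i` is `𝔤ᵢ` for `1 ≤ i ≤ s` and is zero for all other `i`. -/
structure Stratification (𝔤 : Type*) [LieRing 𝔤] [LieAlgebra ℝ 𝔤] where
  /-- the step `s` -/
  step : ℕ
  /-- the layers `𝔤ᵢ` -/
  layer : ℕ → Submodule ℝ 𝔤
  layer_zero : layer 0 = ⊥
  layer_of_step_lt : ∀ i, step < i → layer i = ⊥
  isInternal : DirectSum.IsInternal layer
  layer_succ : ∀ i, 1 ≤ i →
    layer (i + 1) = Submodule.span ℝ {z | ∃ x ∈ layer 1, ∃ y ∈ layer i, z = ⁅x, y⁆}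

/-- The homogeneous (Hausdorff) dimension `Q = ∑ᵢ i dim 𝔤ᵢ`. -/
noncomputable def Stratification.homDim {𝔤 : Type*} [LieRing 𝔤] [LieAlgebra ℝ 𝔤]
    (S : Stratification 𝔤) : ℕ :=
  ∑ i ∈ Finset.range (S.step + 1), i * Module.finrank ℝ (S.layer i)

/-- A Carnot(-Carathéodory) group `G = exp 𝔤`: the exponential map of `G` is a bijection from a
finite-dimensional stratified Lie algebra `𝔤` to `G`, under which the product of `G` is the
Baker-Campbell-Hausdorff product. It comes with a basis of `𝔤` adapted to the stratification; the
scalar product of `𝔤` is the one for which this basis is orthonormal. The topology of `G` is that of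
the global coordinates given by the basis and the exponential map. -/
structure CarnotGroup (G 𝔤 ι : Type*) [Group G] [TopologicalSpace G] [LieRing 𝔤] [LieAlgebra ℝ 𝔤]
    [Fintype ι] extends Stratification 𝔤 where
  /-- the exponential map -/
  exp : 𝔤 ≃ G
  exp_mul_exp : ∀ X Y : 𝔤, exp X * exp Y = exp (bch step X Y)
  /-- the orthonormal adapted basis -/
  basis : Module.Basis ι ℝ 𝔤
  /-- the layer to which a basis vector belongs -/
  weight : ι → ℕ
  basis_mem : ∀ i, basis i ∈ layer (weight i)
  isHomeomorph_exp : IsHomeomorph (fun x : ι → ℝ => exp (∑ i, x i • basis i))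

namespace CarnotGroup

variable {G 𝔤 ι : Type*} [Group G] [TopologicalSpace G] [LieRing 𝔤] [LieAlgebra ℝ 𝔤] [Fintype ι]

/-- The global exponential coordinates `x ↦ exp (∑ᵢ xᵢ Eᵢ)` of `G`. -/
noncomputable def coord (C : CarnotGroup G 𝔤 ι) (x : ι → ℝ) : G :=
  C.exp (∑ i, x i • C.basis i)

/-- The function `f` is of class `Cⁿ` on the open set `Ω`. -/
def IsCn (C : CarnotGroup G 𝔤 ι) (n : ℕ∞) (f : G → ℝ) (Ω : Set G) : Prop :=
  ContDiffOn ℝ n (fun x => f (C.coord x)) (C.coord ⁻¹' Ω)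

/-- The Lebesgue measure `dq` on `G`. -/
noncomputable def lebesgue [MeasurableSpace G] (C : CarnotGroup G 𝔤 ι) : Measure G :=
  Measure.map C.coord volume

/-- The left invariant vector field `X̃ᵢ f (p) = d/dt f (p exp (t Eᵢ))` at `t = 0`. -/
noncomputable def vectorField (C : CarnotGroup G 𝔤 ι) (i : ι) (f : G → ℝ) (p : G) : ℝ :=
  deriv (fun t : ℝ => f (p * C.exp (t • C.basis i))) 0

/-- The sub-Laplacian `𝓛 f = ∑ᵢ X̃ᵢ X̃ᵢ f`, the sum being over the basis of the first layer. -/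
noncomputable def subLaplacian (C : CarnotGroup G 𝔤 ι) (f : G → ℝ) (p : G) : ℝ :=
  ∑ i with C.weight i = 1, C.vectorField i (C.vectorField i f) p

/-- The horizontal gradient `∇₀ f = ∑ᵢ (X̃ᵢ f) X̃ᵢ`, the sum being over the basis of the first layer,
written in the orthonormal frame of the `X̃ᵢ`. -/
noncomputable def horizontalGradient (C : CarnotGroup G 𝔤 ι) (f : G → ℝ) (p : G) :
    EuclideanSpace ℝ {i : ι // C.weight i = 1} :=
  WithLp.toLp 2 fun i => C.vectorField i f p

/-- The function `u` is `𝓛`-harmonic on the open set `Ω`. -/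
def IsHarmonicOn (C : CarnotGroup G 𝔤 ι) (u : G → ℝ) (Ω : Set G) : Prop :=
  C.IsCn 2 u Ω ∧ ∀ p ∈ Ω, C.subLaplacian u p = 0

/-- `Γ` is a fundamental solution of `𝓛`, that is, `𝓛 Γ` is the Dirac measure at the identity. The
value of `Γ` at the identity plays no role. -/
structure IsFundamentalSolution [MeasurableSpace G] (C : CarnotGroup G 𝔤 ι) (Γ : G → ℝ) :
    Prop where
  smooth : C.IsCn (⊤ : ℕ∞) Γ {1}ᶜ
  locallyIntegrable : LocallyIntegrable Γ C.lebesgue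
  tendsto_zero : Tendsto Γ (cocompact G) (𝓝 0)
  integral_eq : ∀ φ : G → ℝ, C.IsCn (⊤ : ℕ∞) φ Set.univ → HasCompactSupport φ →
    ∫ q, Γ q * C.subLaplacian φ q ∂C.lebesgue = φ 1

open Classical in
/-- The pseudonorm `𝓝 = (-Γ)^(1 / (2 - Q))`, `𝓝 = 0` at the identity, defined by `Γ`. -/
noncomputable def gauge (C : CarnotGroup G 𝔤 ι) (Γ : G → ℝ) (p : G) : ℝ :=
  if p = 1 then 0 else (-Γ p) ^ (1 / (2 - (C.homDim : ℝ)))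

end CarnotGroup

/-- The ball `B(p, r) = {q : N(p⁻¹ q) ≤ r}` of the pseudodistance induced by `N`. -/
def pseudoBall {G : Type*} [Group G] (N : G → ℝ) (p : G) (r : ℝ) : Set G :=
  {q | N (p⁻¹ * q) ≤ r}

/-! ### Word brackets and the terms of the Baker-Campbell-Hausdorff series. -/

section NestedBracket

variable {𝔤 : Type*} [LieRing 𝔤]

/-! Off the identity `𝓛 Γ = 0`, so `𝓛 (F ∘ Γ) = F''(Γ) |∇₀Γ|²` for every `C²` function `F` of one
real variable. If `F` vanishes on `[-a, ∞)` and is constant near `-∞`, then `F ∘ Γ` is `C²` with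
compact support, because `Γ → 0` at infinity and `Γ → -∞` at the identity. Green's identity against
a function `w` that is harmonic on `{Γ ≤ -a}` gives `∫ w k(Γ) |∇₀Γ|² = 0` for `k = F''`, that is,
for every admissible `k` of mean zero (`integral_level_eq_zero`). Hence `k ↦ ∫ w k(Γ) |∇₀Γ|²` is a
multiple of `∫ k`. For `w = 1` the factor is `1`, by testing the defining property of `Γ` on `F ∘ Γ`
(`integral_level_one`); in general it is `w 1`, by moving the mass of `k` towards `-∞`, where the
level sets shrink to the identity (`integral_level`).

The ball of radius `r` at the identity is `{Γ ≤ -a}` with `a = r^(2-Q)`, and `|∇₀N|² = κ(Γ) |∇₀Γ|²`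
with `κ(t) = β² (-t)^(2β-2)`, `β = 1/(2-Q) < 0`. Since `κ` is integrable at `-∞`, one may let `k`
tend to `κ` times the indicator of `(-∞, -a]` (`setIntegral_sublevel`). The choices `w = 1` and `w =
u(p ·)` produce the same factor `∫ κ`, which cancels in the quotient; left translation carries the
ball at the identity to the ball at `p`.

The properties of `Γ` come from a weak maximum principle. Applied to `φ * Γ`, which solves `𝓛 (φ *
Γ) = φ` and vanishes at infinity, it yields `Γ ≤ 0` and uniqueness. Uniqueness and scaling make `Γ`
homogeneous of degree `2 - Q`. If `Γ` vanished at a point other than the identity, a whole dilation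
orbit would lie in the ball, against its relative compactness; so `Γ < 0`, and homogeneity gives `Γ
→ -∞` at the identity.

All that is needed of the Baker-Campbell-Hausdorff series is that it equals `X + Y` plus a
combination of brackets of at least two letters (`bch_sub_mem_wordSpan`). So products are
polynomial, lines are one-parameter subgroups, dilations are automorphisms, and translations are
unipotent and preserve Lebesgue measure. Right invariance of the measure is what makes integration
by parts work. -/

theorem nestedBracket_cons (x : 𝔤) {l : List 𝔤} (hl : l ≠ []) :
    nestedBracket (x :: l) = ⁅x, nestedBracket l⁆ := by
  cases l with
  | nil => exact absurd rfl hl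
  | cons y l => rfl

theorem map_nestedBracket {𝔥 : Type*} [LieRing 𝔥] (f : 𝔤 → 𝔥) (h0 : f 0 = 0)
    (hf : ∀ x y, f ⁅x, y⁆ = ⁅f x, f y⁆) (l : List 𝔤) :
    f (nestedBracket l) = nestedBracket (l.map f) := by
  induction l with
  | nil => exact h0
  | cons x l ih =>
    by_cases hl : l = []
    · subst hl; rfl
    · rw [nestedBracket_cons x hl, hf, ih, List.map_cons, nestedBracket_cons _ (by simpa using hl)]

/-- The nested bracket of a word in the two letters `X` (for `true`) and `Y` (for `false`). -/
def wordBracket (w : List Bool) (X Y : 𝔤) : 𝔤 :=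
  nestedBracket (w.map fun b => cond b X Y)

theorem wordBracket_cons (b : Bool) {w : List Bool} (hw : w ≠ []) (X Y : 𝔤) :
    wordBracket (b :: w) X Y = ⁅cond b X Y, wordBracket w X Y⁆ := by
  rw [wordBracket, List.map_cons, nestedBracket_cons _ (by simpa using hw)]
  rfl

/-- The word `X^r₁ Y^t₁ ⋯ X^rₙ Y^tₙ`. -/
def bchWord {n : ℕ} (a : Fin n → ℕ × ℕ) : List Bool :=
  (List.ofFn fun i => List.replicate (a i).1 true ++ List.replicate (a i).2 false).flatten

theorem length_bchWord {n : ℕ} (a : Fin n → ℕ × ℕ) :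
    (bchWord a).length = ∑ i, ((a i).1 + (a i).2) := by
  simp [bchWord, List.length_flatten, List.map_ofFn, List.sum_ofFn]

theorem wordBracket_bchWord {n : ℕ} (a : Fin n → ℕ × ℕ) (X Y : 𝔤) :
    wordBracket (bchWord a) X Y = nestedBracket (List.ofFn (fun i =>
          List.replicate (a i).1 X ++ List.replicate (a i).2 Y)).flatten := by
  rw [wordBracket, bchWord, List.map_flatten, List.map_ofFn]
  congr 3
  funext i
  simp

variable [LieAlgebra ℝ 𝔤]

/-- The first conjunct is the induction invariant: the tail of the word is already a multiple of
`Z`, so one more bracket kills it. -/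
theorem exists_wordBracket_smul (w : List Bool) (Z : 𝔤) (s t : ℝ) :
    (∃ c : ℝ, wordBracket w (s • Z) (t • Z) = c • Z) ∧
      (2 ≤ w.length → wordBracket w (s • Z) (t • Z) = 0) := by
  induction w with
  | nil => exact ⟨⟨0, by simp [wordBracket, nestedBracket]⟩, by simp⟩
  | cons b w ih =>
    by_cases hw : w = []
    · subst hw
      refine ⟨⟨cond b s t, ?_⟩, by simp⟩
      cases b <;> simp [wordBracket, nestedBracket]
    · obtain ⟨⟨c, hc⟩, -⟩ := ih
      have : wordBracket (b :: w) (s • Z) (t • Z) = 0 := by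
        rw [wordBracket_cons b hw, hc]
        cases b <;> simp
      exact ⟨⟨0, by simp [this]⟩, fun _ => this⟩

/-- The linear span of the maps `(X, Y) ↦ wordBracket w X Y` for words of at least two letters. -/
def wordSpan (𝔤 : Type*) [LieRing 𝔤] [LieAlgebra ℝ 𝔤] : Submodule ℝ (𝔤 → 𝔤 → 𝔤) :=
  Submodule.span ℝ {f | ∃ w : List Bool, 2 ≤ w.length ∧ f = wordBracket w}

/-- Each of the `n` blocks of a word is nonempty, so the terms with `n ≥ 2` have at least two
letters. For `n = 1` the only one-letter words are `X` and `Y`, both with coefficient `1`. The other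
coefficients never matter. -/
theorem bch_sub_mem_wordSpan (s : ℕ) (hs : 1 ≤ s) :
    (fun X Y : 𝔤 => bch s X Y - X - Y) ∈ wordSpan 𝔤 := by
  have hmem : ∀ {n : ℕ} (a : Fin n → ℕ × ℕ), 2 ≤ ∑ i, ((a i).1 + (a i).2) →
      (wordBracket (bchWord a) : 𝔤 → 𝔤 → 𝔤) ∈ wordSpan 𝔤 := fun a ha =>
    Submodule.subset_span ⟨_, by rwa [length_bchWord], rfl⟩
  set D : Finset (ℕ × ℕ) := (Finset.range (s + 1) ×ˢ Finset.range (s + 1)).filter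
    (fun e : ℕ × ℕ => 0 < e.1 + e.2) with hD
  let co : ∀ {n : ℕ}, (Fin n → ℕ × ℕ) → ℝ := fun a =>
    (((∑ i, ((a i).1 + (a i).2) : ℕ) : ℝ) *
          ∏ i, (((a i).1.factorial : ℝ) * ((a i).2.factorial : ℝ)))⁻¹
  let T : ℕ → 𝔤 → 𝔤 → 𝔤 := fun n => ((-1 : ℝ) ^ (n - 1) / (n : ℝ)) •
    ∑ a ∈ Fintype.piFinset (fun _ : Fin n => D), co a • wordBracket (bchWord a)
  have hbch : (bch s : 𝔤 → 𝔤 → 𝔤) = ∑ n ∈ Finset.Icc 1 s, T n := by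
    funext X Y
    simp only [bch, T, co, Finset.sum_apply, Pi.smul_apply, wordBracket_bchWord, hD]
  have h2 : ∀ n ∈ Finset.Icc 2 s, T n ∈ wordSpan 𝔤 := by
    intro n hn
    refine Submodule.smul_mem _ _ (Submodule.sum_mem _ fun a ha => Submodule.smul_mem _ _
      (hmem a ?_))
    have h1 : ∑ i : Fin n, 1 ≤ ∑ i, ((a i).1 + (a i).2) := by
      refine Finset.sum_le_sum fun i _ => ?_
      have := Fintype.mem_piFinset.1 ha i
      simp only [hD, Finset.mem_filter] at this
      omega
    have := (Finset.mem_Icc.1 hn).1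
    simp at h1
    omega
  have h1 : T 1 - (fun X Y => X + Y) ∈ wordSpan 𝔤 := by
    let g : ℕ × ℕ → 𝔤 → 𝔤 → 𝔤 := fun e =>
      co (fun _ : Fin 1 => e) • wordBracket (bchWord fun _ : Fin 1 => e)
    have hT : T 1 = ∑ e ∈ D, g e := by
      simp only [T]
      rw [show ((-1 : ℝ) ^ (1 - 1) / ((1 : ℕ) : ℝ)) = 1 by norm_num, one_smul]
      refine Finset.sum_nbij' (fun a => a 0) (fun e _ => e) ?_ ?_ ?_ ?_ ?_
      · intro a ha; exact Fintype.mem_piFinset.1 ha 0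
      · intro e he; exact Fintype.mem_piFinset.2 fun _ => he
      · intro a _; funext i; rw [Subsingleton.elim i 0]
      · intro e _; rfl
      · intro a _
        have : a = fun _ => a 0 := by funext i; rw [Subsingleton.elim i 0]
        conv_lhs => rw [this]
    have e1 : ((1, 0) : ℕ × ℕ) ∈ D := by simp [hD]; omega
    have e2 : ((0, 1) : ℕ × ℕ) ∈ D.erase (1, 0) := by simp [hD]; omega
    have hX : g (1, 0) = fun X Y => X := by
      funext X Y
      simp [g, co, bchWord, wordBracket, nestedBracket]
    have hY : g (0, 1) = fun X Y => Y := by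
      funext X Y
      simp [g, co, bchWord, wordBracket, nestedBracket]
    rw [hT, ← Finset.add_sum_erase _ _ e1, ← Finset.add_sum_erase _ _ e2, hX, hY]
    have : ((fun X Y => X) + ((fun X Y => Y) + ∑ e ∈ (D.erase (1, 0)).erase (0, 1), g e)
        - fun X Y => X + Y) = ∑ e ∈ (D.erase (1, 0)).erase (0, 1), g e := by
      funext X Y
      simp only [Pi.sub_apply, Pi.add_apply]
      abel
    rw [this]
    refine Submodule.sum_mem _ fun e he => Submodule.smul_mem _ _ (hmem _ ?_)
    simp only [hD, Finset.mem_erase, Finset.mem_filter, ne_eq] at he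
    obtain ⟨h01, h10, -, hpos⟩ := he
    simp only [Finset.univ_unique, Finset.sum_const, Finset.card_singleton, one_smul]
    rcases e with ⟨e, f⟩
    simp only [Prod.mk.injEq] at h01 h10 hpos ⊢
    omega
  have hI : Finset.Icc 1 s = insert 1 (Finset.Icc 2 s) := by
    ext n; simp; omega
  have : (fun X Y : 𝔤 => bch s X Y - X - Y) =
      (T 1 - fun X Y => X + Y) + ∑ n ∈ Finset.Icc 2 s, T n := by
    rw [hbch, hI, Finset.sum_insert (by simp)]
    funext X Y
    simp only [Pi.sub_apply, Pi.add_apply]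
    abel
  rw [this]
  exact Submodule.add_mem _ h1 (Submodule.sum_mem _ h2)

end NestedBracket

/-! ### The grading of the Lie algebra. -/

namespace Stratification

variable {𝔤 : Type*} [LieRing 𝔤] [LieAlgebra ℝ 𝔤] (S : Stratification 𝔤)

/-- The axioms control brackets with the first layer only; the Jacobi identity `⁅⁅a, b⁆, y⁆ = ⁅a,
⁅b, y⁆⁆ - ⁅b, ⁅a, y⁆⁆` reduces the rest to these by induction on `i`. -/
theorem lie_mem {i j : ℕ} {x y : 𝔤} (hx : x ∈ S.layer i) (hy : y ∈ S.layer j) :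
    ⁅x, y⁆ ∈ S.layer (i + j) := by
  have h1 : ∀ {j : ℕ} {x y : 𝔤}, x ∈ S.layer 1 → y ∈ S.layer j → ⁅x, y⁆ ∈ S.layer (j + 1) := by
    intro j x y hx hy
    rcases Nat.eq_zero_or_pos j with rfl | hj
    · rw [S.layer_zero, Submodule.mem_bot] at hy
      simp [hy]
    · rw [S.layer_succ j hj]
      exact Submodule.subset_span ⟨x, hx, y, hy, rfl⟩
  induction i generalizing j x y with
  | zero =>
    rw [S.layer_zero, Submodule.mem_bot] at hx
    simp [hx]
  | succ i ih =>
    rcases Nat.eq_zero_or_pos i with rfl | hi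
    · have := h1 hx hy
      rwa [add_comm, zero_add]
    · rw [S.layer_succ i hi] at hx
      induction hx using Submodule.span_induction with
      | mem x hx =>
        obtain ⟨a, ha, b, hb, rfl⟩ := hx
        rw [lie_lie]
        have e1 := h1 ha (ih hb hy)
        have e2 := ih hb (h1 ha hy)
        refine Submodule.sub_mem _ ?_ ?_
        · rwa [show i + 1 + j = i + j + 1 by ring]
        · rwa [show i + 1 + j = i + (j + 1) by ring]
      | zero => simp
      | add x x' _ _ h h' => rw [add_lie]; exact Submodule.add_mem _ h h'
      | smul c x _ h => rw [smul_lie]; exact Submodule.smul_mem _ _ h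

/-- Directness of the sum enters here. Comparison with this map shows that `lieDilation`, defined on
the basis, is a scalar on each whole layer. -/
theorem exists_smul_pow (l : ℝ) :
    ∃ D : 𝔤 →ₗ[ℝ] 𝔤, ∀ k, ∀ x ∈ S.layer k, D x = l ^ k • x := by
  classical
  let e := LinearEquiv.ofBijective (DirectSum.coeLinearMap S.layer) S.isInternal
  refine ⟨(DirectSum.toModule ℝ ℕ 𝔤 fun k => l ^ k • (S.layer k).subtype) ∘ₗ e.symm.toLinearMap,
    fun k x hx => ?_⟩
  have : e.symm x = DirectSum.lof ℝ ℕ (fun k => S.layer k) k ⟨x, hx⟩ := by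
    rw [LinearEquiv.symm_apply_eq]
    exact (DirectSum.coeLinearMap_lof S.layer k ⟨x, hx⟩).symm
  simp [this]

end Stratification

/-! ### Dilations, the weight filtration and the tail of the Baker-Campbell-Hausdorff product. -/

namespace CarnotGroup

variable {G 𝔤 ι : Type*} [Group G] [TopologicalSpace G] [LieRing 𝔤] [LieAlgebra ℝ 𝔤] [Fintype ι]
  (C : CarnotGroup G 𝔤 ι)

theorem weight_pos (i : ι) : 0 < C.weight i := by
  by_contra h
  have := C.basis_mem i
  rw [Nat.eq_zero_of_not_pos h, C.layer_zero, Submodule.mem_bot] at this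
  exact C.basis.ne_zero i this

theorem weight_le_step (i : ι) : C.weight i ≤ C.step := by
  by_contra h
  have := C.basis_mem i
  rw [C.layer_of_step_lt _ (not_le.1 h), Submodule.mem_bot] at this
  exact C.basis.ne_zero i this

/-- The dilation of the Lie algebra by `l`, which is multiplication by `l ^ k` on the `k`-th
layer. -/
noncomputable def lieDilation (l : ℝ) : 𝔤 →ₗ[ℝ] 𝔤 :=
  C.basis.constr ℝ fun i => l ^ C.weight i • C.basis i

theorem lieDilation_basis (l : ℝ) (i : ι) :
    C.lieDilation l (C.basis i) = l ^ C.weight i • C.basis i :=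
  C.basis.constr_basis ℝ _ i

theorem lieDilation_of_mem (l : ℝ) {k : ℕ} {x : 𝔤} (hx : x ∈ C.layer k) :
    C.lieDilation l x = l ^ k • x := by
  obtain ⟨D, hD⟩ := C.exists_smul_pow l
  have : C.lieDilation l = D := C.basis.ext fun i => by
    rw [lieDilation_basis, hD _ _ (C.basis_mem i)]
  rw [this, hD k x hx]

theorem repr_lieDilation (l : ℝ) (x : 𝔤) (j : ι) :
    C.basis.repr (C.lieDilation l x) j = l ^ C.weight j * C.basis.repr x j := by
  classical
  have : (C.basis.coord j) ∘ₗ C.lieDilation l = l ^ C.weight j • C.basis.coord j :=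
    C.basis.ext fun i => by
      by_cases h : i = j
      · subst h; simp [lieDilation_basis]
      · simp [lieDilation_basis, h]
  simpa using LinearMap.congr_fun this x

/-- The dilation by `2` is diagonal in the basis and has the distinct eigenvalues `2 ^ k` on the
layers. -/
theorem repr_eq_zero_of_mem {k : ℕ} {x : 𝔤} (hx : x ∈ C.layer k) {j : ι} (hj : C.weight j ≠ k) :
    C.basis.repr x j = 0 := by
  have h1 := C.repr_lieDilation 2 x j
  rw [C.lieDilation_of_mem 2 hx] at h1
  have h2 : ((2 : ℝ) ^ k - 2 ^ C.weight j) * C.basis.repr x j = 0 := by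
    rw [map_smul, Finsupp.smul_apply, smul_eq_mul] at h1
    rw [sub_mul, h1, sub_self]
  refine (mul_eq_zero.1 h2).resolve_left fun h => hj ?_
  exact (pow_right_injective₀ (a := (2 : ℝ)) (by norm_num) (by norm_num) (sub_eq_zero.1 h)).symm

theorem lieDilation_lie (l : ℝ) (x y : 𝔤) :
    C.lieDilation l ⁅x, y⁆ = ⁅C.lieDilation l x, C.lieDilation l y⁆ := by
  have hx : x ∈ Submodule.span ℝ (Set.range C.basis) := by simp [C.basis.span_eq]
  have hy : y ∈ Submodule.span ℝ (Set.range C.basis) := by simp [C.basis.span_eq]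
  induction hx using Submodule.span_induction with
  | zero => simp
  | add a b _ _ ha hb => simp only [add_lie, map_add, ha, hb]
  | smul c a _ ha => simp only [smul_lie, map_smul, ha]
  | mem a ha =>
    obtain ⟨i, rfl⟩ := ha
    induction hy using Submodule.span_induction with
    | zero => simp
    | add a b _ _ ha hb => simp only [lie_add, map_add, ha, hb]
    | smul c a _ ha => simp only [lie_smul, map_smul, ha]
    | mem b hb =>
      obtain ⟨j, rfl⟩ := hb
      rw [C.lieDilation_of_mem l (C.lie_mem (C.basis_mem i) (C.basis_mem j)), lieDilation_basis,
        lieDilation_basis, smul_lie, lie_smul, smul_smul, pow_add]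

/-- The elements of the Lie algebra whose coordinates of weight less than `k` vanish. -/
def filtration (k : ℕ) : Submodule ℝ 𝔤 where
  carrier := {x | ∀ j, C.weight j < k → C.basis.repr x j = 0}
  add_mem' {x y} hx hy j hj := by simp [hx j hj, hy j hj]
  zero_mem' j _ := by simp
  smul_mem' c x hx j hj := by simp [hx j hj]

theorem mem_filtration_one (x : 𝔤) : x ∈ C.filtration 1 := fun j hj =>
  absurd hj (by have := C.weight_pos j; omega)

theorem filtration_anti {k l : ℕ} (h : k ≤ l) : C.filtration l ≤ C.filtration k :=
  fun _ hx j hj => hx j (hj.trans_le h)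

theorem lie_mem_filtration {a b : ℕ} {x y : 𝔤} (hx : x ∈ C.filtration a)
    (hy : y ∈ C.filtration b) : ⁅x, y⁆ ∈ C.filtration (a + b) := by
  rw [← C.basis.sum_repr x, ← C.basis.sum_repr y, _root_.sum_lie]
  refine Submodule.sum_mem _ fun i _ => ?_
  rw [_root_.lie_sum]
  refine Submodule.sum_mem _ fun l _ => ?_
  by_cases hi : C.weight i < a
  · simp [hx i hi]
  by_cases hl : C.weight l < b
  · simp [hy l hl]
  rw [smul_lie, lie_smul]
  refine Submodule.smul_mem _ _ (Submodule.smul_mem _ _ fun j hj => ?_)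
  exact C.repr_eq_zero_of_mem (C.lie_mem (C.basis_mem i) (C.basis_mem l)) (by omega)

/-- Telescoping: the difference of two brackets is a sum of brackets in which one entry is a
difference. Every vector has weight at least one, so each bracket raises the filtration degree. The
first conjunct feeds the induction. -/
theorem wordBracket_sub_mem {k : ℕ} {X X' Y Y' : 𝔤} (hX : X - X' ∈ C.filtration k)
    (hY : Y - Y' ∈ C.filtration k) (w : List Bool) :
    wordBracket w X Y - wordBracket w X' Y' ∈ C.filtration k ∧
    (2 ≤ w.length → wordBracket w X Y - wordBracket w X' Y' ∈ C.filtration (k + 1)) := by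
  induction w with
  | nil => exact ⟨by simp [wordBracket, nestedBracket], by simp⟩
  | cons b w ih =>
    by_cases hw : w = []
    · subst hw
      refine ⟨?_, by simp⟩
      cases b <;> simpa [wordBracket, nestedBracket]
    · have hb : cond b X Y - cond b X' Y' ∈ C.filtration k := by cases b <;> simpa
      have : wordBracket (b :: w) X Y - wordBracket (b :: w) X' Y' ∈ C.filtration (k + 1) := by
        rw [wordBracket_cons b hw, wordBracket_cons b hw]
        have : ⁅cond b X Y, wordBracket w X Y⁆ - ⁅cond b X' Y', wordBracket w X' Y'⁆ =
            ⁅cond b X Y - cond b X' Y', wordBracket w X Y⁆ +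
              ⁅cond b X' Y', wordBracket w X Y - wordBracket w X' Y'⁆ := by
          rw [sub_lie, lie_sub]; abel
        rw [this]
        refine Submodule.add_mem _ (C.lie_mem_filtration hb (C.mem_filtration_one _)) ?_
        rw [add_comm]
        exact C.lie_mem_filtration (C.mem_filtration_one _) ih.1
      exact ⟨C.filtration_anti (Nat.le_succ k) this, fun _ => this⟩

/-- The terms of degree at least two of the Baker-Campbell-Hausdorff product. -/
noncomputable def bchTail (X Y : 𝔤) : 𝔤 := bch C.step X Y - X - Y

theorem bch_eq (X Y : 𝔤) : bch C.step X Y = X + Y + C.bchTail X Y := by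
  rw [bchTail]; abel

theorem bchTail_mem : C.bchTail ∈ wordSpan 𝔤 := by
  rcases Nat.eq_zero_or_pos C.step with h | h
  · have : IsEmpty ι := ⟨fun i => by
      have := C.weight_pos i; have := C.weight_le_step i; omega⟩
    have : Subsingleton 𝔤 := C.basis.repr.toEquiv.subsingleton
    rw [Subsingleton.elim C.bchTail 0]
    exact Submodule.zero_mem _
  · exact bch_sub_mem_wordSpan C.step h

/-- This is the source of the invariance of Lebesgue measure: in exponential coordinates a
translation is the identity plus a constant and weight-raising terms. -/
theorem bchTail_sub_mem {k : ℕ} {X X' Y Y' : 𝔤} (hX : X - X' ∈ C.filtration k)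
    (hY : Y - Y' ∈ C.filtration k) : C.bchTail X Y - C.bchTail X' Y' ∈ C.filtration (k + 1) := by
  have h := C.bchTail_mem
  generalize C.bchTail = f at h
  induction h using Submodule.span_induction with
  | mem f hf =>
    obtain ⟨w, hw, rfl⟩ := hf
    exact (C.wordBracket_sub_mem hX hY w).2 hw
  | zero => simp
  | add f g _ _ hf hg =>
    simp only [Pi.add_apply]
    rw [add_sub_add_comm]
    exact Submodule.add_mem _ hf hg
  | smul c f _ hf =>
    simp only [Pi.smul_apply]
    rw [← smul_sub]
    exact Submodule.smul_mem _ _ hf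

theorem bchTail_smul (s t : ℝ) (Z : 𝔤) : C.bchTail (s • Z) (t • Z) = 0 := by
  have h := C.bchTail_mem
  generalize C.bchTail = f at h
  induction h using Submodule.span_induction with
  | mem f hf =>
    obtain ⟨w, hw, rfl⟩ := hf
    exact (exists_wordBracket_smul w Z s t).2 hw
  | zero => simp
  | add f g _ _ hf hg => simp [hf, hg]
  | smul c f _ hf => simp [hf]

theorem lieDilation_bchTail (l : ℝ) (X Y : 𝔤) :
    C.lieDilation l (C.bchTail X Y) = C.bchTail (C.lieDilation l X) (C.lieDilation l Y) := by
  have h := C.bchTail_mem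
  generalize C.bchTail = f at h
  induction h using Submodule.span_induction with
  | mem f hf =>
    obtain ⟨w, hw, rfl⟩ := hf
    rw [wordBracket, map_nestedBracket _ (map_zero _) (C.lieDilation_lie l), List.map_map,
      wordBracket]
    congr 2
    funext b
    cases b <;> rfl
  | zero => simp
  | add f g _ _ hf hg => simp [hf, hg]
  | smul c f _ hf => simp [hf]

theorem contDiff_repr_lie {E : Type*} [NormedAddCommGroup E] [NormedSpace ℝ E] {n : WithTop ℕ∞}
    {f g : E → 𝔤} (hf : ∀ j, ContDiff ℝ n fun e => C.basis.repr (f e) j)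
    (hg : ∀ j, ContDiff ℝ n fun e => C.basis.repr (g e) j) (j : ι) :
    ContDiff ℝ n fun e => C.basis.repr ⁅f e, g e⁆ j := by
  have : (fun e => C.basis.repr ⁅f e, g e⁆ j) = fun e => ∑ i, ∑ l,
      C.basis.repr (f e) i * (C.basis.repr (g e) l * C.basis.repr ⁅C.basis i, C.basis l⁆ j) := by
    funext e
    conv_lhs => rw [← C.basis.sum_repr (f e), ← C.basis.sum_repr (g e)]
    simp only [_root_.sum_lie, _root_.lie_sum, map_sum, Finsupp.finsetSum_apply, smul_lie, lie_smul,
      map_smul, Finsupp.smul_apply, smul_eq_mul, Finset.mul_sum]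
    rw [Finset.sum_comm]
    exact Finset.sum_congr rfl fun i _ => Finset.sum_congr rfl fun l _ => by ring
  rw [this]
  exact ContDiff.sum fun i _ => ContDiff.sum fun l _ =>
    (hf i).mul ((hg l).mul contDiff_const)

theorem contDiff_repr_bchTail {E : Type*} [NormedAddCommGroup E] [NormedSpace ℝ E]
    {n : WithTop ℕ∞} {X Y : E → 𝔤} (hX : ∀ j, ContDiff ℝ n fun e => C.basis.repr (X e) j)
    (hY : ∀ j, ContDiff ℝ n fun e => C.basis.repr (Y e) j) (j : ι) :
    ContDiff ℝ n fun e => C.basis.repr (C.bchTail (X e) (Y e)) j := by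
  have h := C.bchTail_mem
  generalize C.bchTail = f at h
  induction h using Submodule.span_induction with
  | mem f hf =>
    obtain ⟨w, -, rfl⟩ := hf
    induction w generalizing j with
    | nil => simpa [wordBracket, nestedBracket] using contDiff_const
    | cons b w ih =>
      have hb : ∀ j, ContDiff ℝ n fun e => C.basis.repr (cond b (X e) (Y e)) j := by
        cases b <;> simpa
      by_cases hw : w = []
      · subst hw
        simpa [wordBracket, nestedBracket] using hb j
      · simp only [wordBracket_cons b hw]
        exact C.contDiff_repr_lie hb ih j
  | zero => simpa using contDiff_const
  | add f g _ _ hf hg => simpa using hf.add hg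
  | smul c f _ hf => simpa using contDiff_const.mul hf

/-- In this form `Q` is the exponent in the determinant of a dilation. -/
theorem sum_weight : ∑ i, C.weight i = C.homDim := by
  classical
  have hl : ∀ k, Module.finrank ℝ (C.layer k) = (Finset.univ.filter fun i => C.weight i = k).card := by
    intro k
    have hs : C.layer k = Submodule.span ℝ
        (Set.range fun i : {i // C.weight i = k} => C.basis i) := by
      refine le_antisymm (fun x hx => ?_) (Submodule.span_le.2 ?_)
      · rw [← C.basis.sum_repr x]
        refine Submodule.sum_mem _ fun i _ => ?_
        by_cases h : C.weight i = k
        · exact Submodule.smul_mem _ _ (Submodule.subset_span ⟨⟨i, h⟩, rfl⟩)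
        · simp [C.repr_eq_zero_of_mem hx h]
      · rintro _ ⟨⟨i, rfl⟩, rfl⟩
        exact C.basis_mem i
    rw [hs, ← Fintype.card_subtype]
    exact finrank_span_eq_card (C.basis.linearIndependent.comp _ Subtype.val_injective)
  rw [Stratification.homDim]
  simp only [hl]
  rw [← Finset.sum_fiberwise_of_maps_to (s := Finset.univ) (t := Finset.range (C.step + 1))
    (g := C.weight) (fun i _ => Finset.mem_range.2 (Nat.lt_succ_of_le (C.weight_le_step i)))]
  refine Finset.sum_congr rfl fun k _ => ?_
  rw [Finset.sum_congr rfl (fun i hi => (Finset.mem_filter.1 hi).2), Finset.sum_const, smul_eq_mul,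
    mul_comm]

/-- The first layer generates, so all layers vanish with it. The horizontal coordinate so obtained
drives the maximum principle. -/
theorem exists_weight_eq_one (h : 0 < C.homDim) : ∃ i, C.weight i = 1 := by
  by_contra! h1
  have hl : C.layer 1 = ⊥ := by
    rw [eq_bot_iff]
    intro x hx
    rw [Submodule.mem_bot, ← C.basis.repr.map_eq_zero_iff]
    ext j
    exact C.repr_eq_zero_of_mem hx (h1 j)
  have hall : ∀ k, C.layer k = ⊥ := by
    intro k
    rcases Nat.eq_zero_or_pos k with rfl | hk
    · exact C.layer_zero
    rcases Nat.eq_or_lt_of_le hk with rfl | hk'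
    · exact hl
    obtain ⟨m, rfl⟩ := Nat.exists_eq_add_of_lt hk'
    rw [show 1 + m + 1 = (m + 1) + 1 by ring, C.layer_succ _ (by omega)]
    rw [Submodule.span_eq_bot]
    rintro _ ⟨x, hx, y, -, rfl⟩
    rw [hl, Submodule.mem_bot] at hx
    simp [hx]
  refine h.ne' (Finset.sum_eq_zero fun k _ => ?_)
  rw [hall k, finrank_bot, mul_zero]

end CarnotGroup

/-! ### Exponential coordinates, topology and Haar measure of the group. -/

/-- A bijection of `ℝ^ι` that is the identity up to terms that raise the weight preserves the
Lebesgue measure. -/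
theorem measurePreserving_of_weight_raising {ι : Type*} [Fintype ι] (w : ι → ℕ)
    {f : (ι → ℝ) → (ι → ℝ)} (hf : Differentiable ℝ f) (hbij : Function.Bijective f)
    (h : ∀ (x v : ι → ℝ) (k : ℕ), (∀ j, w j < k → v j = 0) →
      ∀ j, w j < k + 1 → f (x + v) j = f x j + v j) :
    MeasurePreserving f volume volume := by
  classical
  -- Ordered by weight, the Jacobian matrix is block triangular with identity blocks on the
  -- diagonal.
  have hdet : ∀ x, (fderiv ℝ f x).det = 1 := by
    intro x
    have hL : ∀ (v : ι → ℝ) (k : ℕ), (∀ j, w j < k → v j = 0) →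
        ∀ j, w j < k + 1 → fderiv ℝ f x v j = v j := by
      intro v k hv j hj
      have h1 : HasDerivAt (fun t : ℝ => f (x + t • v)) (fderiv ℝ f x v) 0 := by
        have h0 : HasFDerivAt f (fderiv ℝ f x) (x + (0 : ℝ) • v) := by
          simpa using (hf x).hasFDerivAt
        have h2 : HasDerivAt (fun t : ℝ => x + t • v) v 0 := by
          simpa using ((hasDerivAt_id (0 : ℝ)).smul_const v).const_add x
        exact h0.comp_hasDerivAt (0 : ℝ) h2
      have h2 := (hasDerivAt_pi.1 h1) j
      have h3 : (fun t : ℝ => f (x + t • v) j) = fun t : ℝ => f x j + t * v j := by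
        funext t
        rw [h x (t • v) k (fun i hi => by simp [hv i hi]) j hj]
        rfl
      rw [h3] at h2
      have h4 : HasDerivAt (fun t : ℝ => f x j + t * v j) (v j) 0 := by
        simpa using ((hasDerivAt_id (0 : ℝ)).mul_const (v j)).const_add (f x j)
      exact h2.unique h4
    set M := LinearMap.toMatrix' (fderiv ℝ f x : (ι → ℝ) →ₗ[ℝ] (ι → ℝ)) with hM
    have hMd : (fderiv ℝ f x).det = M.det := by
      rw [hM, LinearMap.det_toMatrix']
    have hMe : ∀ i j, w j < w i + 1 → M j i = if j = i then 1 else 0 := by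
      intro i j hij
      rw [hM, LinearMap.toMatrix'_apply]
      have := hL (Pi.single i 1) (w i) (fun l hl => by
        rw [Pi.single_eq_of_ne]; rintro rfl; exact lt_irrefl _ hl) j hij
      simpa [Pi.single_apply, eq_comm] using this
    have hB : M.BlockTriangular (fun i => OrderDual.toDual (w i)) := by
      intro i j hij
      have hij : w i < w j := hij
      rw [hMe j i (by omega), if_neg]
      rintro rfl
      exact lt_irrefl _ hij
    rw [hMd, hB.det]
    refine Finset.prod_eq_one fun a _ => ?_
    have : M.toSquareBlock (fun i => OrderDual.toDual (w i)) a = 1 := by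
      ext i j
      have hw : w i = w j := OrderDual.toDual.injective (i.2.trans j.2.symm)
      rw [Matrix.toSquareBlock_def, Matrix.of_apply, hMe _ _ (by omega), Matrix.one_apply]
      simp only [Subtype.ext_iff]
    rw [this, Matrix.det_one]
  refine ⟨hf.continuous.measurable, Measure.ext fun s hs => ?_⟩
  rw [Measure.map_apply hf.continuous.measurable hs]
  have := lintegral_abs_det_fderiv_eq_addHaar_image volume (hf.continuous.measurable hs)
    (fun x _ => (hf x).hasFDerivAt.hasFDerivWithinAt) (hbij.1.injOn)
  rw [Set.image_preimage_eq _ hbij.2] at this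
  rw [← this]
  simp [hdet]

namespace CarnotGroup

variable {G 𝔤 ι : Type*} [Group G] [TopologicalSpace G] [LieRing 𝔤] [LieAlgebra ℝ 𝔤] [Fintype ι]
  (C : CarnotGroup G 𝔤 ι)

/-- The exponential coordinates as a homeomorphism. -/
noncomputable def homeo : (ι → ℝ) ≃ₜ G := C.isHomeomorph_exp.homeomorph _

/-- The exponential coordinates of a point. -/
noncomputable def toCoord : G → ι → ℝ := C.homeo.symm

@[simp] theorem toCoord_coord (x : ι → ℝ) : C.toCoord (C.coord x) = x :=
  C.homeo.symm_apply_apply x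

@[simp] theorem coord_toCoord (p : G) : C.coord (C.toCoord p) = p :=
  C.homeo.apply_symm_apply p

theorem continuous_coord : Continuous C.coord := C.homeo.continuous

theorem continuous_toCoord : Continuous C.toCoord := C.homeo.symm.continuous

theorem coord_eq (x : ι → ℝ) : C.coord x = C.exp (C.basis.equivFun.symm x) := by
  rw [coord, C.basis.equivFun_symm_apply]

theorem toCoord_exp (X : 𝔤) : C.toCoord (C.exp X) = C.basis.repr X := by
  have : C.coord (C.basis.equivFun X) = C.exp X := by
    rw [coord_eq, LinearEquiv.symm_apply_apply]
  rw [← this, toCoord_coord]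
  rfl

theorem toCoord_apply (p : G) (j : ι) : C.toCoord p j = C.basis.repr (C.exp.symm p) j := by
  conv_lhs => rw [← C.exp.apply_symm_apply p, toCoord_exp]

/-- `exp 0` is an idempotent of a group. -/
theorem exp_zero : C.exp 0 = 1 := by
  have h := C.exp_mul_exp 0 0
  have h2 := C.bchTail_smul 0 0 0
  rw [C.bch_eq] at h
  simp only [smul_zero] at h2
  rw [h2] at h
  simpa using h

theorem exp_smul_mul_exp_smul (s t : ℝ) (X : 𝔤) :
    C.exp (s • X) * C.exp (t • X) = C.exp ((s + t) • X) := by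
  rw [C.exp_mul_exp, C.bch_eq, C.bchTail_smul, add_zero, add_smul]

theorem exp_neg (X : 𝔤) : C.exp (-X) = (C.exp X)⁻¹ := by
  rw [eq_comm, inv_eq_iff_mul_eq_one]
  have := C.exp_smul_mul_exp_smul 1 (-1) X
  simpa [C.exp_zero] using this

theorem toCoord_one : C.toCoord 1 = 0 := by
  rw [← C.exp_zero, toCoord_exp]; simp

theorem toCoord_inv (p : G) : C.toCoord p⁻¹ = -C.toCoord p := by
  obtain ⟨X, rfl⟩ := C.exp.surjective p
  rw [← exp_neg, toCoord_exp, toCoord_exp]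
  simp

theorem toCoord_mul (p q : G) (j : ι) : C.toCoord (p * q) j =
    C.toCoord p j + C.toCoord q j + C.basis.repr (C.bchTail (C.exp.symm p) (C.exp.symm q)) j := by
  obtain ⟨X, rfl⟩ := C.exp.surjective p
  obtain ⟨Y, rfl⟩ := C.exp.surjective q
  rw [C.exp_mul_exp, C.bch_eq, toCoord_exp, toCoord_exp, toCoord_exp]
  simp

/-- The coordinates of weight one are additive. -/
theorem toCoord_mul_of_weight_eq_one (p q : G) {j : ι} (hj : C.weight j = 1) :
    C.toCoord (p * q) j = C.toCoord p j + C.toCoord q j := by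
  have h := C.bchTail_sub_mem (k := 1) (X := C.exp.symm p) (X' := (0 : ℝ) • 0)
    (Y := C.exp.symm q) (Y' := (0 : ℝ) • 0) (C.mem_filtration_one _) (C.mem_filtration_one _)
  rw [C.bchTail_smul, sub_zero] at h
  rw [toCoord_mul, h j (by omega), add_zero]

theorem toCoord_exp_smul_basis (t : ℝ) (i j : ι) :
    C.toCoord (C.exp (t • C.basis i)) j = t * Finsupp.single i (1 : ℝ) j := by
  rw [toCoord_exp, map_smul, C.basis.repr_self]
  rfl

section Smooth

variable {E : Type*} [NormedAddCommGroup E] [NormedSpace ℝ E] {n : WithTop ℕ∞}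

theorem contDiff_toCoord_mul {f g : E → G} (hf : ContDiff ℝ n fun e => C.toCoord (f e))
    (hg : ContDiff ℝ n fun e => C.toCoord (g e)) :
    ContDiff ℝ n fun e => C.toCoord (f e * g e) := by
  rw [contDiff_pi] at *
  intro j
  simp only [toCoord_mul]
  refine ((hf j).add (hg j)).add (C.contDiff_repr_bchTail ?_ ?_ j)
  · simpa only [toCoord_apply] using hf
  · simpa only [toCoord_apply] using hg

theorem contDiff_toCoord_inv {f : E → G} (hf : ContDiff ℝ n fun e => C.toCoord (f e)) :
    ContDiff ℝ n fun e => C.toCoord (f e)⁻¹ := by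
  simp only [toCoord_inv]
  exact hf.neg

theorem contDiff_toCoord_coord {f : E → ι → ℝ} (hf : ContDiff ℝ n f) :
    ContDiff ℝ n fun e => C.toCoord (C.coord (f e)) := by
  simpa using hf

theorem contDiff_toCoord_exp_smul {f : E → ℝ} (hf : ContDiff ℝ n f) (i : ι) :
    ContDiff ℝ n fun e => C.toCoord (C.exp (f e • C.basis i)) := by
  rw [contDiff_pi]
  intro j
  simp only [toCoord_exp_smul_basis]
  exact hf.mul contDiff_const

end Smooth

theorem continuous_iff_toCoord {α : Type*} [TopologicalSpace α] {f : α → G} :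
    Continuous f ↔ Continuous fun a => C.toCoord (f a) :=
  C.homeo.symm.comp_continuous_iff.symm

theorem isTopologicalGroup (C : CarnotGroup G 𝔤 ι) : IsTopologicalGroup G where
  continuous_mul := by
    rw [← (C.homeo.prodCongr C.homeo).comp_continuous_iff', C.continuous_iff_toCoord]
    exact (C.contDiff_toCoord_mul (n := 0) (E := (ι → ℝ) × (ι → ℝ))
      (C.contDiff_toCoord_coord contDiff_fst) (C.contDiff_toCoord_coord contDiff_snd)).continuous
  continuous_inv := by
    rw [C.continuous_iff_toCoord]
    simp only [toCoord_inv]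
    exact C.continuous_toCoord.neg

theorem t2Space (C : CarnotGroup G 𝔤 ι) : T2Space G := C.homeo.symm.isEmbedding.t2Space

theorem locallyCompactSpace (C : CarnotGroup G 𝔤 ι) : LocallyCompactSpace G :=
  C.homeo.symm.isClosedEmbedding.locallyCompactSpace

theorem secondCountableTopology (C : CarnotGroup G 𝔤 ι) : SecondCountableTopology G :=
  C.homeo.symm.isEmbedding.secondCountableTopology

/-- The dilation of the group by `l`. -/
noncomputable def dilation (l : ℝ) (p : G) : G := C.exp (C.lieDilation l (C.exp.symm p))

theorem toCoord_dilation (l : ℝ) (p : G) (j : ι) :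
    C.toCoord (C.dilation l p) j = l ^ C.weight j * C.toCoord p j := by
  rw [dilation, toCoord_exp, repr_lieDilation, toCoord_apply]

theorem toCoord_injective : Function.Injective C.toCoord := C.homeo.symm.injective

theorem dilation_mul (l : ℝ) (p q : G) :
    C.dilation l (p * q) = C.dilation l p * C.dilation l q := by
  obtain ⟨X, rfl⟩ := C.exp.surjective p
  obtain ⟨Y, rfl⟩ := C.exp.surjective q
  simp only [dilation, C.exp_mul_exp, C.bch_eq, Equiv.symm_apply_apply, map_add,
    lieDilation_bchTail]

theorem dilation_dilation (l m : ℝ) (p : G) :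
    C.dilation l (C.dilation m p) = C.dilation (l * m) p := by
  apply C.toCoord_injective
  ext j
  simp only [toCoord_dilation, mul_pow, mul_assoc]

theorem dilation_one_left (p : G) : C.dilation 1 p = p := by
  apply C.toCoord_injective
  ext j
  simp [toCoord_dilation]

theorem dilation_one (l : ℝ) : C.dilation l 1 = 1 := by
  apply C.toCoord_injective
  ext j
  simp [toCoord_dilation, toCoord_one]

/-- The dilation by `l ≠ 0` as a homeomorphism. -/
noncomputable def dilationHomeo (l : ℝ) (hl : l ≠ 0) : G ≃ₜ G where
  toFun := C.dilation l
  invFun := C.dilation l⁻¹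
  left_inv p := by rw [dilation_dilation, inv_mul_cancel₀ hl, dilation_one_left]
  right_inv p := by rw [dilation_dilation, mul_inv_cancel₀ hl, dilation_one_left]
  continuous_toFun := by
    rw [C.continuous_iff_toCoord, continuous_pi_iff]
    intro j
    simp only [toCoord_dilation]
    exact continuous_const.mul ((continuous_apply j).comp C.continuous_toCoord)
  continuous_invFun := by
    rw [C.continuous_iff_toCoord, continuous_pi_iff]
    intro j
    simp only [toCoord_dilation]
    exact continuous_const.mul ((continuous_apply j).comp C.continuous_toCoord)

theorem dilation_exp_smul_basis (l t : ℝ) {i : ι} (hi : C.weight i = 1) :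
    C.dilation l (C.exp (t • C.basis i)) = C.exp ((l * t) • C.basis i) := by
  rw [dilation, Equiv.symm_apply_apply, map_smul, lieDilation_basis, hi, pow_one, smul_smul,
    mul_comm]

section Measure

variable [MeasurableSpace G] [BorelSpace G]

theorem measurableEmbedding_coord : MeasurableEmbedding C.coord := C.homeo.measurableEmbedding

theorem integral_lebesgue (f : G → ℝ) : ∫ q, f q ∂C.lebesgue = ∫ x, f (C.coord x) := by
  rw [lebesgue, C.measurableEmbedding_coord.integral_map]

theorem measurePreserving_conj {T : G → G}
    (hT : MeasurePreserving (fun x => C.toCoord (T (C.coord x))) volume volume) :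
    MeasurePreserving T C.lebesgue C.lebesgue := by
  have hc : MeasurePreserving C.coord volume C.lebesgue :=
    C.continuous_coord.measurable.measurePreserving _
  have hc' : MeasurePreserving C.toCoord C.lebesgue volume := by
    have := hc.symm C.homeo.toMeasurableEquiv
    exact this
  have := hc.comp (hT.comp hc')
  convert this using 1
  funext p
  simp

/-- By `bchTail_sub_mem`, moving a point by a vector of weight at least `k` alters the tail only in
weight at least `k + 1`, which is the hypothesis of `measurePreserving_of_weight_raising`. -/
theorem isMulRightInvariant : C.lebesgue.IsMulRightInvariant where
  map_mul_right_eq_self q := by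
    refine (C.measurePreserving_conj (T := fun p => p * q) ?_).map_eq
    refine measurePreserving_of_weight_raising C.weight
      ((C.contDiff_toCoord_mul (n := 1) (C.contDiff_toCoord_coord contDiff_id)
        contDiff_const).differentiable (by norm_num)) ?_ ?_
    · exact C.homeo.symm.bijective.comp ((Equiv.mulRight q).bijective.comp C.homeo.bijective)
    · intro x v k hv j hj
      have := C.bchTail_sub_mem (k := k) (X := C.basis.equivFun.symm (x + v))
        (X' := C.basis.equivFun.symm x) (Y := C.exp.symm q) (Y' := C.exp.symm q)
        (by rw [map_add, add_sub_cancel_left]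
            intro j hj
            rw [← C.basis.equivFun_apply, LinearEquiv.apply_symm_apply]
            exact hv j hj) (by simp) j hj
      simp only [toCoord_mul, toCoord_coord, Pi.add_apply]
      rw [coord_eq, coord_eq, Equiv.symm_apply_apply, Equiv.symm_apply_apply]
      simp only [map_sub, Finsupp.sub_apply] at this
      linarith

theorem isMulLeftInvariant : C.lebesgue.IsMulLeftInvariant where
  map_mul_left_eq_self q := by
    refine (C.measurePreserving_conj (T := fun p => q * p) ?_).map_eq
    refine measurePreserving_of_weight_raising C.weight
      ((C.contDiff_toCoord_mul (n := 1) contDiff_const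
        (C.contDiff_toCoord_coord contDiff_id)).differentiable (by norm_num)) ?_ ?_
    · exact C.homeo.symm.bijective.comp ((Equiv.mulLeft q).bijective.comp C.homeo.bijective)
    · intro x v k hv j hj
      have := C.bchTail_sub_mem (k := k) (Y := C.basis.equivFun.symm (x + v))
        (Y' := C.basis.equivFun.symm x) (X := C.exp.symm q) (X' := C.exp.symm q) (by simp)
        (by rw [map_add, add_sub_cancel_left]
            intro j hj
            rw [← C.basis.equivFun_apply, LinearEquiv.apply_symm_apply]
            exact hv j hj) j hj
      simp only [toCoord_mul, toCoord_coord, Pi.add_apply]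
      rw [coord_eq, coord_eq, Equiv.symm_apply_apply, Equiv.symm_apply_apply]
      simp only [map_sub, Finsupp.sub_apply] at this
      linarith

theorem isInvInvariant : C.lebesgue.IsInvInvariant where
  inv_eq_self := by
    refine (C.measurePreserving_conj (T := fun p => p⁻¹) ?_).map_eq
    simp only [toCoord_inv, toCoord_coord]
    exact Measure.measurePreserving_neg volume

theorem isFiniteMeasureOnCompacts : IsFiniteMeasureOnCompacts C.lebesgue where
  lt_top_of_isCompact K hK := by
    rw [lebesgue, C.measurableEmbedding_coord.map_apply]
    exact (C.homeo.isCompact_preimage.2 hK).measure_lt_top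

theorem isOpenPosMeasure : C.lebesgue.IsOpenPosMeasure where
  open_pos U hU hne := by
    rw [lebesgue, C.measurableEmbedding_coord.map_apply]
    refine ((hU.preimage C.continuous_coord).measure_pos volume ?_).ne'
    exact hne.preimage C.homeo.surjective

theorem lebesgue_singleton [Nonempty ι] (p : G) : C.lebesgue {p} = 0 := by
  rw [lebesgue, C.measurableEmbedding_coord.map_apply]
  exact (Set.subsingleton_singleton.preimage C.homeo.injective).measure_zero volume

theorem isHaarMeasure : C.lebesgue.IsHaarMeasure :=
  { C.isFiniteMeasureOnCompacts, C.isMulLeftInvariant, C.isOpenPosMeasure with }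

theorem lebesgue_eq_smul_map_dilation {l : ℝ} (hl : 0 < l) :
    C.lebesgue = ENNReal.ofReal (l ^ C.homDim) • C.lebesgue.map (C.dilation l) := by
  classical
  have hd : (Matrix.diagonal fun i => l ^ C.weight i).det = l ^ C.homDim := by
    rw [Matrix.det_diagonal, Finset.prod_pow_eq_pow_sum, C.sum_weight]
  have h := Real.smul_map_diagonal_volume_pi (D := fun i => l ^ C.weight i)
    (by rw [hd]; positivity)
  rw [hd, abs_of_pos (by positivity)] at h
  have hfun : C.coord ∘ Matrix.toLin' (Matrix.diagonal fun i => l ^ C.weight i) =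
      C.dilation l ∘ C.coord := by
    funext x
    apply C.toCoord_injective
    ext j
    simp [toCoord_dilation, Matrix.mulVec_diagonal]
  have hm : Measurable (Matrix.toLin' (Matrix.diagonal fun i : ι => l ^ C.weight i)) := by
    have : (Matrix.toLin' (Matrix.diagonal fun i : ι => l ^ C.weight i) : (ι → ℝ) → ι → ℝ) =
        C.toCoord ∘ C.dilation l ∘ C.coord := by
      rw [← hfun]
      funext x
      simp
    rw [this]
    exact (C.continuous_toCoord.comp
      ((C.dilationHomeo l hl.ne').continuous.comp C.continuous_coord)).measurable
  have hdm : Measurable (C.dilation l) := (C.dilationHomeo l hl.ne').continuous.measurable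
  rw [lebesgue, Measure.map_map hdm C.continuous_coord.measurable, ← hfun,
    ← Measure.map_map C.continuous_coord.measurable hm, ← Measure.map_smul, h]

theorem integral_comp_dilation {l : ℝ} (hl : 0 < l) (f : G → ℝ) :
    ∫ q, f q ∂C.lebesgue = l ^ C.homDim * ∫ q, f (C.dilation l q) ∂C.lebesgue := by
  conv_lhs => rw [C.lebesgue_eq_smul_map_dilation hl]
  rw [integral_smul_measure, ENNReal.toReal_ofReal (by positivity), smul_eq_mul]
  exact congrArg _ ((C.dilationHomeo l hl.ne').measurableEmbedding.integral_map f)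

end Measure

end CarnotGroup

/-! ### Calculus of left invariant vector fields. -/

namespace CarnotGroup

variable {G 𝔤 ι : Type*} [Group G] [TopologicalSpace G] [LieRing 𝔤] [LieAlgebra ℝ 𝔤] [Fintype ι]
  (C : CarnotGroup G 𝔤 ι)

/-- The function `f` is of class `Cⁿ` near `p`. -/
def SmoothAt (n : WithTop ℕ∞) (f : G → ℝ) (p : G) : Prop :=
  ContDiffAt ℝ n (fun x => f (C.coord x)) (C.toCoord p)

variable {C} {n : WithTop ℕ∞} {f g : G → ℝ} {p : G}

theorem IsCn.smoothAt {n : ℕ∞} {Ω : Set G} (h : C.IsCn n f Ω) (hΩ : IsOpen Ω) (hp : p ∈ Ω) :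
    C.SmoothAt n f p :=
  h.contDiffAt ((hΩ.preimage C.continuous_coord).mem_nhds (by simpa using hp))

theorem isCn_univ_of_smoothAt {n : ℕ∞} (h : ∀ p, C.SmoothAt n f p) : C.IsCn n f Set.univ :=
  fun x _ => by simpa [SmoothAt] using (h (C.coord x)).contDiffWithinAt

theorem SmoothAt.comp_contDiffAt {E : Type*} [NormedAddCommGroup E] [NormedSpace ℝ E] {φ : E → G}
    {e : E} (hf : C.SmoothAt n f (φ e)) (hφ : ContDiffAt ℝ n (fun e => C.toCoord (φ e)) e) :
    ContDiffAt ℝ n (fun e => f (φ e)) e := by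
  have := ContDiffAt.comp e (g := fun x => f (C.coord x)) (f := fun e => C.toCoord (φ e)) hf hφ
  simpa [Function.comp_def] using this

theorem SmoothAt.comp_map {T : G → G} (hf : C.SmoothAt n f (T p))
    (hT : ContDiff ℝ n fun x => C.toCoord (T (C.coord x))) :
    C.SmoothAt n (fun q => f (T q)) p := by
  have h : C.SmoothAt n f (T (C.coord (C.toCoord p))) := by simpa using hf
  exact h.comp_contDiffAt (φ := fun x => T (C.coord x)) hT.contDiffAt

theorem SmoothAt.comp_mul_left {q : G} (hf : C.SmoothAt n f (q * p)) :
    C.SmoothAt n (fun p => f (q * p)) p :=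
  hf.comp_map (C.contDiff_toCoord_mul contDiff_const (C.contDiff_toCoord_coord contDiff_id))

theorem SmoothAt.comp_dilation {l : ℝ} (hf : C.SmoothAt n f (C.dilation l p)) :
    C.SmoothAt n (fun p => f (C.dilation l p)) p := by
  refine hf.comp_map (contDiff_pi.2 fun j => ?_)
  simp only [toCoord_dilation, toCoord_coord]
  exact contDiff_const.mul (contDiff_apply ℝ ℝ j)

theorem SmoothAt.of_le {m : WithTop ℕ∞} (hf : C.SmoothAt n f p) (h : m ≤ n) : C.SmoothAt m f p :=
  ContDiffAt.of_le hf h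

theorem SmoothAt.of_top (hf : C.SmoothAt ((⊤ : ℕ∞) : WithTop ℕ∞) f p) (m : ℕ∞) :
    C.SmoothAt m f p := hf.of_le (by exact_mod_cast le_top)

theorem smoothAt_const (c : ℝ) : C.SmoothAt n (fun _ => c) p := contDiffAt_const

theorem SmoothAt.sub (hf : C.SmoothAt n f p) (hg : C.SmoothAt n g p) :
    C.SmoothAt n (fun q => f q - g q) p := ContDiffAt.sub hf hg

theorem SmoothAt.mul (hf : C.SmoothAt n f p) (hg : C.SmoothAt n g p) :
    C.SmoothAt n (fun q => f q * g q) p := ContDiffAt.mul hf hg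

theorem SmoothAt.congr (hf : C.SmoothAt n f p) (h : g =ᶠ[𝓝 p] f) : C.SmoothAt n g p := by
  refine ContDiffAt.congr_of_eventuallyEq hf ?_
  have : Tendsto C.coord (𝓝 (C.toCoord p)) (𝓝 p) := by
    simpa using C.continuous_coord.tendsto (C.toCoord p)
  exact this.eventually h

theorem SmoothAt.mul_of_tsupport (hf : ∀ p, C.SmoothAt n f p)
    (hg : ∀ p ∈ tsupport f, C.SmoothAt n g p) (p : G) : C.SmoothAt n (fun q => f q * g q) p := by
  by_cases hp : p ∈ tsupport f
  · exact (hf p).mul (hg p hp)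
  · refine (smoothAt_const (0 : ℝ)).congr ?_
    filter_upwards [notMem_tsupport_iff_eventuallyEq.1 hp] with x hx
    simp [hx]

theorem SmoothAt.comp {F : ℝ → ℝ} (hF : ContDiffAt ℝ n F (f p)) (hf : C.SmoothAt n f p) :
    C.SmoothAt n (fun q => F (f q)) p := by
  refine ContDiffAt.comp (C.toCoord p) (g := F) (f := fun x => f (C.coord x)) ?_ hf
  simpa using hF

theorem SmoothAt.continuousAt (hf : C.SmoothAt n f p) : ContinuousAt f p := by
  have h1 : ContinuousAt (fun x => f (C.coord x)) (C.toCoord p) := ContDiffAt.continuousAt hf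
  have := ContinuousAt.comp (f := C.toCoord) (x := p) h1 C.continuous_toCoord.continuousAt
  simpa [Function.comp_def] using this

theorem smoothAt_toCoord (j : ι) : C.SmoothAt n (fun q => C.toCoord q j) p := by
  simp only [SmoothAt, toCoord_coord]
  exact (contDiff_apply ℝ ℝ j).contDiffAt

theorem exp_smul_add (s t : ℝ) (X : 𝔤) (p : G) :
    p * C.exp ((s + t) • X) = p * C.exp (s • X) * C.exp (t • X) := by
  rw [mul_assoc, exp_smul_mul_exp_smul]

theorem contDiff_toCoord_mul_exp (p : G) (i : ι) :
    ContDiff ℝ n fun t : ℝ => C.toCoord (p * C.exp (t • C.basis i)) :=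
  C.contDiff_toCoord_mul contDiff_const (C.contDiff_toCoord_exp_smul contDiff_id i)

theorem continuous_mul_exp (p : G) (i : ι) :
    Continuous fun t : ℝ => p * C.exp (t • C.basis i) :=
  C.continuous_iff_toCoord.2 (contDiff_toCoord_mul_exp (n := 0) p i).continuous

theorem tendsto_mul_exp (p : G) (i : ι) :
    Tendsto (fun t : ℝ => p * C.exp (t • C.basis i)) (𝓝 0) (𝓝 p) := by
  simpa [exp_zero] using (continuous_mul_exp (C := C) p i).tendsto 0

theorem SmoothAt.hasDerivAt_vectorField (hf : C.SmoothAt 1 f p) (i : ι) :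
    HasDerivAt (fun t : ℝ => f (p * C.exp (t • C.basis i))) (C.vectorField i f p) 0 := by
  have h : C.SmoothAt 1 f (p * C.exp ((0 : ℝ) • C.basis i)) := by simpa [exp_zero] using hf
  exact ((h.comp_contDiffAt (φ := fun t : ℝ => p * C.exp (t • C.basis i))
    (contDiff_toCoord_mul_exp p i).contDiffAt).differentiableAt (by norm_num)).hasDerivAt

theorem SmoothAt.hasDerivAt_curve {i : ι} {t : ℝ}
    (hf : C.SmoothAt 1 f (p * C.exp (t • C.basis i))) :
    HasDerivAt (fun t : ℝ => f (p * C.exp (t • C.basis i)))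
      (C.vectorField i f (p * C.exp (t • C.basis i))) t := by
  have h := hf.hasDerivAt_vectorField i
  have h2 : HasDerivAt (fun s : ℝ => s - t) 1 t := (hasDerivAt_id t).sub_const t
  have h3 := HasDerivAt.comp t (h₂ := fun s => f (p * C.exp (t • C.basis i) * C.exp (s • C.basis i)))
    (h := fun s => s - t) (by simpa using h) h2
  rw [mul_one] at h3
  refine h3.congr_of_eventuallyEq (Eventually.of_forall fun s => ?_)
  simp only [Function.comp]
  rw [← exp_smul_add, add_sub_cancel]

theorem vectorField_congr (h : f =ᶠ[𝓝 p] g) (i : ι) : C.vectorField i f p = C.vectorField i g p :=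
  Filter.EventuallyEq.deriv_eq ((tendsto_mul_exp p i).eventually h)

theorem vectorField_eventuallyEq (h : f =ᶠ[𝓝 p] g) (i : ι) :
    C.vectorField i f =ᶠ[𝓝 p] C.vectorField i g :=
  h.eventuallyEq_nhds.mono fun _ hq => vectorField_congr hq i

theorem subLaplacian_congr (h : f =ᶠ[𝓝 p] g) : C.subLaplacian f p = C.subLaplacian g p :=
  Finset.sum_congr rfl fun i _ => vectorField_congr (vectorField_eventuallyEq h i) i

/-- `X̃ᵢ f` is the partial derivative in `t`, at `t = 0`, of the jointly smooth function `(x, t) ↦ f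
(x exp (t Eᵢ))`. -/
theorem SmoothAt.vectorField {m : WithTop ℕ∞} (hf : C.SmoothAt n f p) (hm : m + 1 ≤ n) (i : ι) :
    C.SmoothAt m (C.vectorField i f) p := by
  have h1 : ContDiffAt ℝ n (Function.uncurry fun (x : ι → ℝ) (t : ℝ) =>
      f (C.coord x * C.exp (t • C.basis i))) (C.toCoord p, 0) := by
    have h : C.SmoothAt n f (C.coord (C.toCoord p, (0 : ℝ)).1 *
      C.exp ((C.toCoord p, (0 : ℝ)).2 • C.basis i)) := by simpa [exp_zero] using hf
    exact h.comp_contDiffAt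
      (φ := fun z : (ι → ℝ) × ℝ => C.coord z.1 * C.exp (z.2 • C.basis i))
      (C.contDiff_toCoord_mul (C.contDiff_toCoord_coord contDiff_fst)
        (C.contDiff_toCoord_exp_smul contDiff_snd i)).contDiffAt
  have h2 := (ContDiffAt.fderiv (g := fun _ => (0 : ℝ)) h1 contDiffAt_const hm).clm_apply
    (contDiffAt_const (c := (1 : ℝ)))
  simp only [fderiv_apply_one_eq_deriv] at h2
  exact h2

theorem vectorField_const (i : ι) (c : ℝ) : C.vectorField i (fun _ => c) p = 0 := by
  simp [vectorField]

theorem vectorField_add (hf : C.SmoothAt 1 f p) (hg : C.SmoothAt 1 g p) (i : ι) :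
    C.vectorField i (fun q => f q + g q) p = C.vectorField i f p + C.vectorField i g p :=
  ((hf.hasDerivAt_vectorField i).add (hg.hasDerivAt_vectorField i)).deriv

theorem vectorField_sub (hf : C.SmoothAt 1 f p) (hg : C.SmoothAt 1 g p) (i : ι) :
    C.vectorField i (fun q => f q - g q) p = C.vectorField i f p - C.vectorField i g p :=
  ((hf.hasDerivAt_vectorField i).sub (hg.hasDerivAt_vectorField i)).deriv

theorem vectorField_const_mul (c : ℝ) (i : ι) :
    C.vectorField i (fun q => c * f q) p = c * C.vectorField i f p :=
  deriv_const_mul_field c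

theorem vectorField_mul (hf : C.SmoothAt 1 f p) (hg : C.SmoothAt 1 g p) (i : ι) :
    C.vectorField i (fun q => f q * g q) p =
      C.vectorField i f p * g p + f p * C.vectorField i g p := by
  have := ((hf.hasDerivAt_vectorField i).mul (hg.hasDerivAt_vectorField i)).deriv
  simp only [zero_smul, exp_zero, mul_one] at this
  exact this

theorem vectorField_comp {F : ℝ → ℝ} {F' : ℝ} (hF : HasDerivAt F F' (f p))
    (hf : C.SmoothAt 1 f p) (i : ι) :
    C.vectorField i (fun q => F (f q)) p = F' * C.vectorField i f p := by
  refine (HasDerivAt.comp (0 : ℝ) (h₂ := F) (h := fun t : ℝ => f (p * C.exp (t • C.basis i)))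
    ?_ (hf.hasDerivAt_vectorField i)).deriv
  simpa [exp_zero] using hF

theorem vectorField_comp_mul_left (q : G) (i : ι) :
    C.vectorField i (fun p => f (q * p)) = fun p => C.vectorField i f (q * p) := by
  funext p
  simp only [vectorField, mul_assoc]

theorem subLaplacian_comp_mul_left (q : G) :
    C.subLaplacian (fun p => f (q * p)) p = C.subLaplacian f (q * p) := by
  simp only [subLaplacian, vectorField_comp_mul_left]

/-- A dilation is an automorphism that maps `exp (t Eᵢ)` to `exp (l t Eᵢ)` for `Eᵢ` in the first
layer; this is why `𝓛` is homogeneous of degree two. -/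
theorem vectorField_comp_dilation (l : ℝ) {i : ι} (hi : C.weight i = 1) :
    C.vectorField i (fun p => f (C.dilation l p)) =
      fun p => l * C.vectorField i f (C.dilation l p) := by
  funext p
  have := deriv_comp_mul_left l (fun t : ℝ => f (C.dilation l p * C.exp (t • C.basis i))) 0
  rw [mul_zero, smul_eq_mul] at this
  rw [vectorField, vectorField, ← this]
  simp only [dilation_mul, C.dilation_exp_smul_basis l _ hi]

theorem subLaplacian_comp_dilation (l : ℝ) :
    C.subLaplacian (fun p => f (C.dilation l p)) p =
      l ^ 2 * C.subLaplacian f (C.dilation l p) := by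
  rw [subLaplacian, subLaplacian, Finset.mul_sum]
  refine Finset.sum_congr rfl fun i hi => ?_
  have hi : C.weight i = 1 := (Finset.mem_filter.1 hi).2
  rw [vectorField_comp_dilation l hi, vectorField_const_mul, vectorField_comp_dilation l hi]
  ring

theorem SmoothAt.eventually {n : ℕ∞} (hf : C.SmoothAt n f p) (hn : n ≠ ⊤) :
    ∀ᶠ q in 𝓝 p, C.SmoothAt n f q := by
  have := ContDiffAt.eventually hf (by simpa using hn)
  simpa [SmoothAt] using C.continuous_toCoord.continuousAt.eventually this

theorem subLaplacian_add (hf : C.SmoothAt 2 f p) (hg : C.SmoothAt 2 g p) :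
    C.subLaplacian (fun q => f q + g q) p = C.subLaplacian f p + C.subLaplacian g p := by
  rw [subLaplacian, subLaplacian, subLaplacian, ← Finset.sum_add_distrib]
  refine Finset.sum_congr rfl fun i _ => ?_
  rw [← vectorField_add (hf.vectorField (by norm_num) i) (hg.vectorField (by norm_num) i)]
  refine vectorField_congr ?_ i
  filter_upwards [SmoothAt.eventually (n := 2) hf (by decide),
    SmoothAt.eventually (n := 2) hg (by decide)] with q h1 h2
  exact vectorField_add (h1.of_le (by norm_num)) (h2.of_le (by norm_num)) i

theorem subLaplacian_const_mul (c : ℝ) :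
    C.subLaplacian (fun q => c * f q) p = c * C.subLaplacian f p := by
  rw [subLaplacian, subLaplacian, Finset.mul_sum]
  refine Finset.sum_congr rfl fun i _ => ?_
  rw [← vectorField_const_mul]
  congr 1
  funext q
  exact vectorField_const_mul c i

theorem subLaplacian_sub (hf : C.SmoothAt 2 f p) (hg : C.SmoothAt 2 g p) :
    C.subLaplacian (fun q => f q - g q) p = C.subLaplacian f p - C.subLaplacian g p := by
  have h : C.SmoothAt 2 (fun q => (-1) * g q) p := (smoothAt_const _).mul hg
  have := subLaplacian_add hf h
  rw [subLaplacian_const_mul] at this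
  simp only [neg_mul, one_mul] at this
  simpa [sub_eq_add_neg] using this

theorem subLaplacian_const (c : ℝ) : C.subLaplacian (fun _ => c) p = 0 := by
  refine Finset.sum_eq_zero fun i _ => ?_
  have : C.vectorField i (fun _ => c) = fun _ => 0 := by
    funext q; exact vectorField_const i c
  rw [this, vectorField_const]

variable (C) in
/-- The squared length of the horizontal gradient. -/
noncomputable def gradSq (f : G → ℝ) (p : G) : ℝ := ∑ i with C.weight i = 1, C.vectorField i f p ^ 2

theorem norm_horizontalGradient_sq : ‖C.horizontalGradient f p‖ ^ 2 = C.gradSq f p := by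
  rw [EuclideanSpace.norm_sq_eq, gradSq, ← Finset.sum_subtype_eq_sum_filter]
  simp only [horizontalGradient, Real.norm_eq_abs, sq_abs, Finset.subtype_univ]

theorem gradSq_nonneg : 0 ≤ C.gradSq f p := Finset.sum_nonneg fun _ _ => sq_nonneg _

theorem gradSq_congr (h : f =ᶠ[𝓝 p] g) : C.gradSq f p = C.gradSq g p :=
  Finset.sum_congr rfl fun i _ => by rw [vectorField_congr h i]

theorem gradSq_comp {F : ℝ → ℝ} {F' : ℝ} (hF : HasDerivAt F F' (f p)) (hf : C.SmoothAt 1 f p) :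
    C.gradSq (fun q => F (f q)) p = F' ^ 2 * C.gradSq f p := by
  rw [gradSq, gradSq, Finset.mul_sum]
  refine Finset.sum_congr rfl fun i _ => ?_
  rw [vectorField_comp hF hf, mul_pow]

theorem SmoothAt.continuousAt_gradSq (hf : C.SmoothAt 1 f p) : ContinuousAt (C.gradSq f) p := by
  have : ∀ i, ContinuousAt (fun q => C.vectorField i f q ^ 2) p := fun i =>
    (hf.vectorField (m := 0) (by norm_num) i).continuousAt.pow 2
  exact tendsto_finsetSum _ fun i _ => this i

theorem subLaplacian_comp {F F' F'' : ℝ → ℝ} (hF : ∀ᶠ t in 𝓝 (f p), HasDerivAt F (F' t) t)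
    (hF' : HasDerivAt F' (F'' (f p)) (f p)) (hFs : ContDiffAt ℝ 1 F' (f p))
    (hf : C.SmoothAt 2 f p) :
    C.subLaplacian (fun q => F (f q)) p =
      F'' (f p) * C.gradSq f p + F' (f p) * C.subLaplacian f p := by
  rw [subLaplacian, subLaplacian, gradSq, Finset.mul_sum, Finset.mul_sum, ← Finset.sum_add_distrib]
  refine Finset.sum_congr rfl fun i _ => ?_
  have h1 : C.vectorField i (fun q => F (f q)) =ᶠ[𝓝 p] fun q => F' (f q) * C.vectorField i f q := by
    filter_upwards [SmoothAt.eventually (n := 2) hf (by decide),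
      hf.continuousAt.eventually hF] with q hq hFq
    exact vectorField_comp hFq (hq.of_le (by norm_num)) i
  rw [vectorField_congr h1, vectorField_mul ((hf.of_le (by norm_num)).comp hFs)
    (hf.vectorField (by norm_num) i), vectorField_comp hF' (hf.of_le (by norm_num))]
  ring

theorem vectorField_curve (i : ι) (p : G) (t : ℝ) :
    C.vectorField i f (p * C.exp (t • C.basis i)) =
      deriv (fun t : ℝ => f (p * C.exp (t • C.basis i))) t := by
  have := deriv_comp_add_const (fun s : ℝ => f (p * C.exp (s • C.basis i))) t 0
  rw [zero_add] at this
  rw [vectorField, ← this]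
  congr 1
  funext s
  rw [add_comm, exp_smul_add]

/-- The quantity is the second derivative of `f` along `t ↦ p exp (t Eᵢ)`. Were it positive, `0`
would also be a local minimum, so the restriction would be locally constant, with second derivative
zero. -/
theorem vectorField_vectorField_nonpos_of_isLocalMax (h : IsLocalMax f p)
    (hc : ContinuousAt f p) (i : ι) : C.vectorField i (C.vectorField i f) p ≤ 0 := by
  set γ : ℝ → ℝ := fun t => f (p * C.exp (t • C.basis i)) with hγ
  have hγ0 : γ 0 = f p := by simp [hγ, exp_zero]
  have h2 : C.vectorField i (C.vectorField i f) p = deriv (deriv γ) 0 := by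
    rw [vectorField]
    congr 1
    funext t
    exact vectorField_curve i p t
  rw [h2]
  by_contra! hpos
  have hmax : IsLocalMax γ 0 := by
    have := (tendsto_mul_exp (C := C) p i).eventually h
    filter_upwards [this] with t ht
    rwa [hγ0]
  have hcont : ContinuousAt γ 0 := by
    refine ContinuousAt.comp (g := f) ?_ (continuous_mul_exp p i).continuousAt
    simpa [exp_zero] using hc
  have hmin := isLocalMin_of_deriv_deriv_pos hpos hmax.deriv_eq_zero hcont
  have hev : γ =ᶠ[𝓝 0] fun _ => γ 0 := by
    filter_upwards [hmax, hmin] with t h1 h2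
    exact le_antisymm h1 h2
  rw [hev.deriv.deriv_eq] at hpos
  simp at hpos

theorem subLaplacian_nonpos_of_isLocalMax (h : IsLocalMax f p) (hc : ContinuousAt f p) :
    C.subLaplacian f p ≤ 0 :=
  Finset.sum_nonpos fun i _ => vectorField_vectorField_nonpos_of_isLocalMax h hc i

theorem support_vectorField_subset (i : ι) :
    Function.support (C.vectorField i f) ⊆ tsupport f := by
  intro p hp
  by_contra h
  rw [notMem_tsupport_iff_eventuallyEq] at h
  exact hp ((vectorField_congr h i).trans (vectorField_const i 0))

theorem tsupport_vectorField_subset (i : ι) : tsupport (C.vectorField i f) ⊆ tsupport f :=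
  closure_minimal (support_vectorField_subset i) (isClosed_tsupport f)

theorem support_subLaplacian_subset : Function.support (C.subLaplacian f) ⊆ tsupport f := by
  intro p hp
  by_contra h
  rw [notMem_tsupport_iff_eventuallyEq] at h
  exact hp ((subLaplacian_congr h).trans (subLaplacian_const 0))

/-! ### Integration by parts. -/

section Integral

variable [MeasurableSpace G] [BorelSpace G] [IsTopologicalGroup G] [C.lebesgue.IsHaarMeasure]
  [C.lebesgue.IsMulRightInvariant]

/-- The flow of a left invariant field is right translation by `exp (t Eᵢ)`, which preserves the
measure. So `∫ f (q exp (t Eᵢ)) dq` is constant in `t`, and its derivative at `0` is computed under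
the integral. -/
theorem integral_vectorField_eq_zero (hf : ∀ p, C.SmoothAt 1 f p) (hs : HasCompactSupport f)
    (i : ι) : ∫ q, C.vectorField i f q ∂C.lebesgue = 0 := by
  have hfc : Continuous f := continuous_iff_continuousAt.2 fun p => (hf p).continuousAt
  have hXc : Continuous (C.vectorField i f) := continuous_iff_continuousAt.2 fun p =>
    ((hf p).vectorField (m := 0) (by norm_num) i).continuousAt
  have hXs : HasCompactSupport (C.vectorField i f) :=
    hs.of_isClosed_subset (isClosed_tsupport _) (tsupport_vectorField_subset i)
  obtain ⟨M, hM⟩ := hXc.bounded_above_of_compact_support hXs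
  have hexp : Continuous fun t : ℝ => C.exp (t • C.basis i) := by
    simpa using continuous_mul_exp (C := C) 1 i
  -- `K` contains every point that the flow brings into the support of `f` at some time in `[-1,
  -- 1]`, so the constant bound is needed on `K` only.
  let K : Set G := (fun z : G × ℝ => z.1 * (C.exp (z.2 • C.basis i))⁻¹) ''
    (tsupport f ×ˢ Set.Icc (-1 : ℝ) 1)
  have hK : IsCompact K := (IsCompact.prod hs isCompact_Icc).image
    (continuous_fst.mul (hexp.comp continuous_snd).inv)
  have hcs : T2Space G := C.t2Space
  have key := hasDerivAt_integral_of_dominated_loc_of_deriv_le (μ := C.lebesgue)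
    (F := fun (t : ℝ) q => f (q * C.exp (t • C.basis i)))
    (F' := fun (t : ℝ) q => C.vectorField i f (q * C.exp (t • C.basis i)))
    (x₀ := 0) (s := Set.Icc (-1) 1) (bound := K.indicator fun _ => M)
    (Icc_mem_nhds (by norm_num) (by norm_num))
    (Eventually.of_forall fun t =>
      ((hfc.comp (continuous_mul_const _)).measurable.aestronglyMeasurable))
    (by simpa [exp_zero] using hfc.integrable_of_hasCompactSupport hs)
    ((hXc.comp (continuous_mul_const _)).measurable.aestronglyMeasurable)
    (Eventually.of_forall fun q t ht => by
      by_cases hq : q ∈ K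
      · rw [Set.indicator_of_mem hq]; exact hM _
      · rw [Set.indicator_of_notMem hq, norm_le_zero_iff]
        by_contra h
        exact hq ⟨(q * C.exp (t • C.basis i), t), ⟨support_vectorField_subset i h, ht⟩, by simp⟩)
    ((integrable_indicator_iff hK.measurableSet).2
      (integrableOn_const hK.measure_lt_top.ne))
    (Eventually.of_forall fun q t _ => (hf _).hasDerivAt_curve)
  have h1 : (fun t : ℝ => ∫ q, f (q * C.exp (t • C.basis i)) ∂C.lebesgue) =
      fun _ => ∫ q, f q ∂C.lebesgue := by
    funext t
    exact integral_mul_right_eq_self f _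
  rw [h1] at key
  have := key.2.unique (hasDerivAt_const (0 : ℝ) _)
  simpa [exp_zero] using this

/-- Green's identity for the sub-Laplacian. -/
theorem integral_mul_subLaplacian_comm (hf : ∀ p, C.SmoothAt 2 f p)
    (hg : ∀ p ∈ tsupport f, C.SmoothAt 2 g p) (hs : HasCompactSupport f) :
    ∫ q, f q * C.subLaplacian g q ∂C.lebesgue = ∫ q, C.subLaplacian f q * g q ∂C.lebesgue := by
  have hXf : ∀ i p, C.SmoothAt 1 (C.vectorField i f) p := fun i p =>
    (hf p).vectorField (by norm_num) i
  have hXg : ∀ i, ∀ p ∈ tsupport f, C.SmoothAt 1 (C.vectorField i g) p := fun i p hp =>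
    (hg p hp).vectorField (by norm_num) i
  have hsX : ∀ i, tsupport (C.vectorField i f) ⊆ tsupport f := tsupport_vectorField_subset
  have hsXX : ∀ i, tsupport (C.vectorField i (C.vectorField i f)) ⊆ tsupport f := fun i =>
    (tsupport_vectorField_subset i).trans (hsX i)
  have hcs : ∀ {h : G → ℝ}, tsupport h ⊆ tsupport f → HasCompactSupport h := fun hh =>
    hs.of_isClosed_subset (isClosed_tsupport _) hh
  have hcont : ∀ {h : G → ℝ}, (∀ p, C.SmoothAt 0 h p) → Continuous h := fun hh =>
    continuous_iff_continuousAt.2 fun p => (hh p).continuousAt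
  have hI1 : ∀ i, Integrable (fun q => f q * C.vectorField i (C.vectorField i g) q) C.lebesgue :=
    fun i => (hcont (SmoothAt.mul_of_tsupport (fun p => (hf p).of_le (by norm_num))
      fun p hp => (hXg i p hp).vectorField (by norm_num) i)).integrable_of_hasCompactSupport
        hs.mul_right
  have hI2 : ∀ i, Integrable (fun q => C.vectorField i (C.vectorField i f) q * g q) C.lebesgue :=
    fun i => (hcont (SmoothAt.mul_of_tsupport (fun p => (hXf i p).vectorField (by norm_num) i)
      fun p hp => (hg p (hsXX i hp)).of_le (by norm_num))).integrable_of_hasCompactSupport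
        (hcs (hsXX i)).mul_right
  simp only [subLaplacian, Finset.mul_sum, Finset.sum_mul]
  rw [integral_finsetSum _ fun i _ => hI1 i, integral_finsetSum _ fun i _ => hI2 i]
  refine Finset.sum_congr rfl fun i _ => ?_
  rw [← sub_eq_zero, ← integral_sub (hI1 i) (hI2 i)]
  have h1 : ∀ p, C.SmoothAt 1 (fun q => f q * C.vectorField i g q) p :=
    SmoothAt.mul_of_tsupport (fun p => (hf p).of_le (by norm_num)) (hXg i)
  have h2 : ∀ p, C.SmoothAt 1 (fun q => C.vectorField i f q * g q) p :=
    SmoothAt.mul_of_tsupport (hXf i) fun p hp => (hg p (hsX i hp)).of_le (by norm_num)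
  -- The product rule turns `X̃ (f X̃g - X̃f g)` into `f X̃X̃g - X̃X̃f g`. Multiplication by `f` or
  -- `X̃f` hides the points where `g` is not smooth.
  have h0 := integral_vectorField_eq_zero (C := C)
    (f := fun q => f q * C.vectorField i g q - C.vectorField i f q * g q)
    (fun p => (h1 p).sub (h2 p)) (hs.mul_right.sub (hcs (hsX i)).mul_right) i
  rw [← h0]
  refine integral_congr_ae (Eventually.of_forall fun p => ?_)
  simp only
  rw [vectorField_sub (h1 p) (h2 p)]
  by_cases hp : p ∈ tsupport f
  · have hf1 : C.SmoothAt 1 f p := (hf p).of_le (by norm_num)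
    have hg1 : C.SmoothAt 1 g p := (hg p hp).of_le (by norm_num)
    rw [vectorField_mul hf1 (hXg i p hp), vectorField_mul (hXf i p) hg1]
    ring
  · have hz : ∀ {u v : G → ℝ}, tsupport u ⊆ tsupport f →
        C.vectorField i (fun q => u q * v q) p = 0 := by
      intro u v hu
      have : (fun q => u q * v q) =ᶠ[𝓝 p] fun _ => 0 := by
        filter_upwards [notMem_tsupport_iff_eventuallyEq.1 fun h => hp (hu h)] with x hx
        simp [hx]
      rw [vectorField_congr this, vectorField_const]
    rw [hz subset_rfl, hz (hsX i), image_eq_zero_of_notMem_tsupport hp,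
      image_eq_zero_of_notMem_tsupport fun h => hp (hsXX i h)]
    ring

end Integral

end CarnotGroup

/-! ### Maximum principle, test functions and convolution. -/

namespace CarnotGroup

variable {G 𝔤 ι : Type*} [Group G] [TopologicalSpace G] [LieRing 𝔤] [LieAlgebra ℝ 𝔤] [Fintype ι]
  {C : CarnotGroup G 𝔤 ι} {f g φ h F : G → ℝ} {p : G}

theorem continuous_of_smoothAt {n : WithTop ℕ∞} (hf : ∀ p, C.SmoothAt n f p) : Continuous f :=
  continuous_iff_continuousAt.2 fun p => (hf p).continuousAt

theorem vectorField_toCoord_sq {i j : ι} (hi : C.weight i = 1) :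
    C.vectorField j (fun q => C.toCoord q i ^ 2) =
      fun q => 2 * Finsupp.single j (1 : ℝ) i * C.toCoord q i := by
  funext q
  have h : HasDerivAt (fun t : ℝ => (C.toCoord q i + t * Finsupp.single j (1 : ℝ) i) ^ 2)
      (2 * Finsupp.single j (1 : ℝ) i * C.toCoord q i) 0 := by
    have h1 : HasDerivAt (fun t : ℝ => C.toCoord q i + t * Finsupp.single j (1 : ℝ) i)
        (Finsupp.single j (1 : ℝ) i) 0 := by
      simpa using ((hasDerivAt_id (0 : ℝ)).mul_const (Finsupp.single j (1 : ℝ) i)).const_add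
        (C.toCoord q i)
    have h2 := h1.pow 2
    have e : (2 : ℕ) * (C.toCoord q i + 0 * Finsupp.single j (1 : ℝ) i) ^ (2 - 1) *
        Finsupp.single j (1 : ℝ) i = 2 * Finsupp.single j (1 : ℝ) i * C.toCoord q i := by
      norm_num; ring
    rw [e] at h2
    exact h2
  rw [vectorField, ← h.deriv]
  congr 1
  funext t
  rw [C.toCoord_mul_of_weight_eq_one _ _ hi, toCoord_exp_smul_basis]

/-- Horizontal coordinates are additive under the product, so `X̃ⱼ xᵢ = δᵢⱼ` and `𝓛 (xᵢ²) = 2`. This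
strictly subharmonic function is the perturbation in the maximum principle. -/
theorem subLaplacian_toCoord_sq_pos {i : ι} (hi : C.weight i = 1) (p : G) :
    0 < C.subLaplacian (fun q => C.toCoord q i ^ 2) p := by
  classical
  have hX : ∀ j, C.vectorField j (C.vectorField j fun q => C.toCoord q i ^ 2) p =
      2 * Finsupp.single j (1 : ℝ) i ^ 2 := by
    intro j
    rw [vectorField_toCoord_sq hi, vectorField_const_mul]
    have : C.vectorField j (fun q => C.toCoord q i) p = Finsupp.single j (1 : ℝ) i := by
      have h1 : HasDerivAt (fun t : ℝ => C.toCoord p i + t * Finsupp.single j (1 : ℝ) i)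
          (Finsupp.single j (1 : ℝ) i) 0 := by
        simpa using ((hasDerivAt_id (0 : ℝ)).mul_const (Finsupp.single j (1 : ℝ) i)).const_add
          (C.toCoord p i)
      rw [vectorField, ← h1.deriv]
      congr 1
      funext t
      rw [C.toCoord_mul_of_weight_eq_one _ _ hi, toCoord_exp_smul_basis]
    rw [this]
    ring
  refine Finset.sum_pos' (fun j _ => ?_) ⟨i, by simpa using hi, ?_⟩
  · rw [hX]; positivity
  · rw [hX]; simp

/-- The weak maximum principle for functions that vanish at infinity. -/
theorem nonpos_of_subLaplacian_nonneg (hQ : 0 < C.homDim) (hf : ∀ p, C.SmoothAt 2 f p)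
    (hL : ∀ p, 0 ≤ C.subLaplacian f p) (h0 : Tendsto f (cocompact G) (𝓝 0)) (p : G) : f p ≤ 0 := by
  obtain ⟨i, hi⟩ := C.exists_weight_eq_one hQ
  by_contra! hM
  have hfc : Continuous f := continuous_of_smoothAt hf
  set M := f p
  set b : G → ℝ := fun q => C.toCoord q i ^ 2 with hb
  have hbc : Continuous b := ((continuous_apply i).comp C.continuous_toCoord).pow 2
  have hbs : ∀ p, C.SmoothAt 2 b p := fun p => by
    have : b = fun q => C.toCoord q i * C.toCoord q i := by funext q; simp [hb, sq]
    rw [this]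
    exact (smoothAt_toCoord i).mul (smoothAt_toCoord i)
  have hK : IsCompact {q | M / 2 ≤ f q} := by
    have : ∀ᶠ q in cocompact G, f q < M / 2 := h0.eventually (gt_mem_nhds (by linarith))
    obtain ⟨K, hK, hsub⟩ := mem_cocompact.1 this
    refine hK.of_isClosed_subset (isClosed_le continuous_const hfc) fun q hq => ?_
    by_contra hqK
    have h1 : f q < M / 2 := hsub hqK
    exact absurd h1 (not_lt.2 hq)
  obtain ⟨B, hB⟩ := hK.bddAbove_image hbc.continuousOn
  have hpK : p ∈ {q | M / 2 ≤ f q} := by change M / 2 ≤ M; linarith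
  have hB0 : 0 ≤ B := (sq_nonneg _).trans (hB ⟨p, hpK, rfl⟩)
  -- So small that `ε b < M / 2` on the compact set `{f ≥ M / 2}`. A maximum point of `f + ε b` over
  -- that set then has `f > M / 2`, hence is an interior local maximum, where `𝓛 (f + ε b) > 0` is
  -- impossible.
  set ε := M / (4 * (B + 1)) with hε
  have hεpos : 0 < ε := by positivity
  have hεB : ε * B < M / 2 := by
    have : ε * (B + 1) = M / 4 := by rw [hε]; field_simp
    nlinarith
  obtain ⟨q, hqK, hq⟩ := hK.exists_isMaxOn ⟨p, hpK⟩
    (f := fun q => f q + ε * b q) (hfc.add (continuous_const.mul hbc)).continuousOn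
  have h1 : M ≤ f q + ε * b q := by
    refine le_trans ?_ (hq hpK)
    change M ≤ M + ε * b p
    have : 0 ≤ b p := sq_nonneg _
    nlinarith
  have h2 : b q ≤ B := hB ⟨q, hqK, rfl⟩
  have h3 : M / 2 < f q := by nlinarith
  have hloc : IsLocalMax (fun q => f q + ε * b q) q := by
    filter_upwards [hfc.continuousAt.eventually (lt_mem_nhds h3)] with q' hq'
    exact hq hq'.le
  have h4 := subLaplacian_nonpos_of_isLocalMax (C := C) hloc
    (hfc.add (continuous_const.mul hbc)).continuousAt
  rw [subLaplacian_add (hf q) ((smoothAt_const ε).mul (hbs q)), subLaplacian_const_mul] at h4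
  have h5 := subLaplacian_toCoord_sq_pos hi q
  have := hL q
  have := mul_pos hεpos h5
  linarith

variable (C) in
/-- Smooth functions with compact support. -/
structure IsTestFunction (φ : G → ℝ) : Prop where
  smooth : ∀ p, C.SmoothAt ((⊤ : ℕ∞) : WithTop ℕ∞) φ p
  compact : HasCompactSupport φ

theorem IsTestFunction.smoothAt {n : ℕ∞} (hφ : C.IsTestFunction φ) (p : G) : C.SmoothAt n φ p :=
  (hφ.smooth p).of_top n

theorem IsTestFunction.continuous (hφ : C.IsTestFunction φ) : Continuous φ :=
  continuous_of_smoothAt hφ.smooth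

variable (C) in
theorem exists_isTestFunction {s : Set G} (hs : s ∈ 𝓝 p) :
    ∃ φ, C.IsTestFunction φ ∧ tsupport φ ⊆ s ∧ (∀ q, 0 ≤ φ q) ∧ φ p = 1 := by
  have hs' : C.coord ⁻¹' s ∈ 𝓝 (C.toCoord p) :=
    C.continuous_coord.continuousAt.preimage_mem_nhds (by simpa using hs)
  obtain ⟨ψ, h1, h2, h3, h4, h5⟩ := exists_contDiff_tsupport_subset (n := (⊤ : ℕ∞)) hs'
  refine ⟨fun q => ψ (C.toCoord q), ⟨fun q => ?_, ?_⟩, ?_, fun q => (h4 ⟨_, rfl⟩).1, h5⟩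
  · simpa [SmoothAt] using h3.contDiffAt
  · exact h2.comp_homeomorph C.homeo.symm
  · have : tsupport (fun q => ψ (C.toCoord q)) = C.toCoord ⁻¹' tsupport ψ := by
      exact tsupport_comp_eq_preimage ψ C.homeo.symm
    rw [this]
    intro q hq
    simpa using h1 hq

theorem continuous_mul_of_tsupport_subset {X : Type*} [TopologicalSpace X] {φ F : X → ℝ} {U : Set X}
    (hF : ∀ q ∈ U, ContinuousAt F q)
    (hφ : Continuous φ) (h : tsupport φ ⊆ U) : Continuous fun q => φ q * F q := by
  refine continuous_iff_continuousAt.2 fun q => ?_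
  by_cases hq : q ∈ U
  · exact hφ.continuousAt.mul (hF q hq)
  · have : (fun q => φ q * F q) =ᶠ[𝓝 q] fun _ => 0 := by
      filter_upwards [notMem_tsupport_iff_eventuallyEq.1 fun hq' => hq (h hq')] with x hx
      simp [hx]
    exact this.continuousAt

section Integral

variable [MeasurableSpace G] [BorelSpace G] [C.lebesgue.IsHaarMeasure]

theorem nonpos_of_integral_test_nonpos {U : Set G} (hU : IsOpen U)
    (hF : ∀ q ∈ U, ContinuousAt F q)
    (h : ∀ φ, C.IsTestFunction φ → tsupport φ ⊆ U → (∀ q, 0 ≤ φ q) →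
      ∫ q, φ q * F q ∂C.lebesgue ≤ 0) (hp : p ∈ U) : F p ≤ 0 := by
  by_contra! hpos
  have hs : {q | 0 < F q} ∩ U ∈ 𝓝 p :=
    inter_mem ((hF p hp).eventually (lt_mem_nhds hpos)) (hU.mem_nhds hp)
  obtain ⟨φ, hφ, hsub, h0, h1⟩ := C.exists_isTestFunction hs
  refine absurd (h φ hφ (hsub.trans Set.inter_subset_right) h0) (not_le.2 ?_)
  refine (continuous_mul_of_tsupport_subset hF hφ.continuous
    (hsub.trans Set.inter_subset_right)).integral_pos_of_hasCompactSupport_nonneg_nonzero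
    hφ.compact.mul_right (x := p) (fun q => ?_) (by rw [h1]; simpa using hpos.ne')
  by_cases hq : q ∈ tsupport φ
  · exact mul_nonneg (h0 q) (le_of_lt (hsub hq).1)
  · simp [image_eq_zero_of_notMem_tsupport hq]

theorem eq_zero_of_integral_test_eq_zero {U : Set G} (hU : IsOpen U)
    (hF : ∀ q ∈ U, ContinuousAt F q)
    (h : ∀ φ, C.IsTestFunction φ → tsupport φ ⊆ U → ∫ q, φ q * F q ∂C.lebesgue = 0)
    (hp : p ∈ U) : F p = 0 := by
  refine le_antisymm (nonpos_of_integral_test_nonpos (C := C) hU hF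
    (fun φ h1 h2 _ => (h φ h1 h2).le) hp) ?_
  have := nonpos_of_integral_test_nonpos (C := C) (F := fun q => -F q) hU
    (fun q hq => (hF q hq).neg) (fun φ h1 h2 _ => by
      simp only [mul_neg, integral_neg, h φ h1 h2, neg_zero, le_refl]) hp
  linarith

variable [IsTopologicalGroup G]

variable (C) in
/-- The convolution of two functions on the group. -/
noncomputable def conv (φ h : G → ℝ) (p : G) : ℝ := ∫ q, φ q * h (q⁻¹ * p) ∂C.lebesgue

/-- The substitution `q ↦ p q⁻¹` moves the dependence on `p` to the smooth factor. -/
theorem conv_eq [C.lebesgue.IsInvInvariant] (φ h : G → ℝ) (p : G) :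
    C.conv φ h p = ∫ q, h q * φ (p * q⁻¹) ∂C.lebesgue := by
  rw [conv, ← integral_div_left_eq_self _ _ p]
  refine integral_congr_ae (Eventually.of_forall fun q => ?_)
  simp only [div_eq_mul_inv, mul_inv_rev, inv_inv]
  rw [mul_assoc, inv_mul_cancel, mul_one, mul_comm]

/-- Inversion is negation in coordinates, so by `conv_eq` this is a Euclidean convolution with
parameter, `g x y = φ (x y)`, evaluated at the fixed point `0`. -/
theorem IsTestFunction.smoothAt_conv [C.lebesgue.IsInvInvariant] (hφ : C.IsTestFunction φ)
    (hh : LocallyIntegrable h C.lebesgue) (p : G) :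
    C.SmoothAt ((⊤ : ℕ∞) : WithTop ℕ∞) (C.conv φ h) p := by
  have hT : T2Space G := C.t2Space
  have hloc : LocallyIntegrable (fun x => h (C.coord x)) volume :=
    (locallyIntegrable_map_homeomorph C.homeo).1 hh
  have heq : ∀ x, C.conv φ h (C.coord x) = convolution (fun x => h (C.coord x))
      (fun y => φ (C.coord x * C.coord y)) (ContinuousLinearMap.mul ℝ ℝ) volume 0 := by
    intro x
    rw [conv_eq, integral_lebesgue, convolution]
    refine integral_congr_ae (Eventually.of_forall fun y => ?_)
    have : C.coord (0 - y) = (C.coord y)⁻¹ := by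
      apply C.toCoord_injective
      rw [toCoord_coord, toCoord_inv, toCoord_coord, zero_sub]
    simp only [this, ContinuousLinearMap.mul_apply']
  let x₀ := C.toCoord p
  let K : Set (ι → ℝ) := (fun z : (ι → ℝ) × G => C.toCoord ((C.coord z.1)⁻¹ * z.2)) ''
    (Metric.closedBall x₀ 1 ×ˢ tsupport φ)
  have hK : IsCompact K := by
    refine ((isCompact_closedBall x₀ 1).prod hφ.compact).image ?_
    exact C.continuous_toCoord.comp
      ((C.continuous_coord.comp continuous_fst).inv.mul continuous_snd)
  have key := contDiffOn_convolution_right_with_param_comp (n := (⊤ : ℕ∞)) (𝕜 := ℝ)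
    (μ := (volume : Measure (ι → ℝ)))
    (ContinuousLinearMap.mul ℝ ℝ) (s := Metric.ball x₀ 1) (v := fun _ => (0 : ι → ℝ))
    contDiffOn_const (f := fun x => h (C.coord x)) (g := fun x y => φ (C.coord x * C.coord y))
    (k := K) Metric.isOpen_ball hK ?_ hloc ?_
  · have h1 := key.contDiffAt (Metric.isOpen_ball.mem_nhds (Metric.mem_ball_self one_pos))
    rw [SmoothAt]
    simpa only [heq] using h1
  · intro x y hx hy
    by_contra hne
    refine hy ⟨(x, C.coord x * C.coord y), ⟨Metric.ball_subset_closedBall hx,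
      subset_tsupport _ hne⟩, ?_⟩
    simp
  · refine ContDiff.contDiffOn (contDiff_iff_contDiffAt.2 fun z => ?_)
    exact (hφ.smooth _).comp_contDiffAt
      (φ := fun z : (ι → ℝ) × (ι → ℝ) => C.coord z.1 * C.coord z.2)
      (C.contDiff_toCoord_mul (C.contDiff_toCoord_coord contDiff_fst)
        (C.contDiff_toCoord_coord contDiff_snd)).contDiffAt

theorem integral_conv_mul (hφ : Continuous φ) (hφs : HasCompactSupport φ)
    (hh : LocallyIntegrable h C.lebesgue) (hg : Continuous g) (hgs : HasCompactSupport g) :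
    ∫ p, C.conv φ h p * g p ∂C.lebesgue =
      ∫ q, φ q * ∫ p, h p * g (q * p) ∂C.lebesgue ∂C.lebesgue := by
  have hT : T2Space G := C.t2Space
  have hsc : SecondCountableTopology G := C.secondCountableTopology
  have hlc : LocallyCompactSpace G := C.locallyCompactSpace
  -- Only the values of `h` on this compact set contribute, so local integrability of `h` suffices
  -- for Fubini's theorem.
  let K : Set G := (fun z : G × G => z.1⁻¹ * z.2) '' (tsupport φ ×ˢ tsupport g)
  have hK : IsCompact K := (IsCompact.prod hφs hgs).image (continuous_fst.inv.mul continuous_snd)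
  obtain ⟨M, hM⟩ := hg.bounded_above_of_compact_support hgs
  have hA : Integrable (fun z : G × G => φ z.1 * (h z.2 * g (z.1 * z.2)))
      (C.lebesgue.prod C.lebesgue) := by
    have h1 : Integrable (fun z : G × G => φ z.1 * K.indicator h z.2)
        (C.lebesgue.prod C.lebesgue) :=
      (hφ.integrable_of_hasCompactSupport hφs).mul_prod
        ((hh.integrableOn_isCompact hK).integrable_indicator hK.measurableSet)
    have h2 := h1.mul_bdd (f := fun z : G × G => φ z.1 * K.indicator h z.2)
      (g := fun z : G × G => g (z.1 * z.2)) (c := M)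
      (hg.comp continuous_mul).measurable.aestronglyMeasurable (Eventually.of_forall fun z => hM _)
    refine h2.congr (Eventually.of_forall fun z => ?_)
    simp only
    by_cases hz : z.2 ∈ K
    · rw [Set.indicator_of_mem hz, mul_assoc]
    · rw [Set.indicator_of_notMem hz]
      by_cases h1 : z.1 ∈ tsupport φ
      · have : g (z.1 * z.2) = 0 := by
          by_contra hne
          exact hz ⟨(z.1, z.1 * z.2), ⟨h1, subset_tsupport _ hne⟩, by simp⟩
        simp [this]
      · simp [image_eq_zero_of_notMem_tsupport h1]
  have hB := ((measurePreserving_prod_inv_mul C.lebesgue C.lebesgue).integrable_comp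
    hA.aestronglyMeasurable).2 hA
  calc ∫ p, C.conv φ h p * g p ∂C.lebesgue
      = ∫ p, ∫ q, φ q * (h (q⁻¹ * p) * g (q * (q⁻¹ * p))) ∂C.lebesgue ∂C.lebesgue := by
        refine integral_congr_ae (Eventually.of_forall fun p => ?_)
        simp only [conv, mul_inv_cancel_left]
        rw [← integral_mul_const]
        simp only [mul_assoc]
    _ = ∫ q, ∫ p, φ q * (h (q⁻¹ * p) * g (q * (q⁻¹ * p))) ∂C.lebesgue ∂C.lebesgue :=
        (integral_integral_swap
          (f := fun q p => φ q * (h (q⁻¹ * p) * g (q * (q⁻¹ * p)))) hB).symm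
    _ = ∫ q, φ q * ∫ p, h p * g (q * p) ∂C.lebesgue ∂C.lebesgue := by
        refine integral_congr_ae (Eventually.of_forall fun q => ?_)
        simp only
        rw [integral_mul_left_eq_self (fun p => φ q * (h p * g (q * p))) q⁻¹,
          integral_const_mul]

theorem tendsto_conv (hφ : Continuous φ) (hφs : HasCompactSupport φ)
    (h0 : Tendsto h (cocompact G) (𝓝 0)) : Tendsto (C.conv φ h) (cocompact G) (𝓝 0) := by
  have hT : T2Space G := C.t2Space
  have hI : Integrable φ C.lebesgue := hφ.integrable_of_hasCompactSupport hφs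
  set A := ∫ q, ‖φ q‖ ∂C.lebesgue with hA
  have hA0 : 0 ≤ A := integral_nonneg fun _ => norm_nonneg _
  rw [Metric.tendsto_nhds]
  intro ε hε
  have hev : ∀ᶠ q in cocompact G, dist (h q) 0 < ε / (A + 1) :=
    Metric.tendsto_nhds.1 h0 _ (by positivity)
  obtain ⟨K, hK, hsub⟩ := mem_cocompact.1 hev
  -- For `p` outside `tsupport φ * K`, the point `q⁻¹ p` avoids `K` for all `q` in the support of
  -- `φ`.
  refine mem_cocompact.2 ⟨_, (IsCompact.prod hφs hK).image continuous_mul, fun p hp => ?_⟩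
  have hb : ‖C.conv φ h p‖ ≤ ∫ q, ‖φ q‖ * (ε / (A + 1)) ∂C.lebesgue := by
    refine norm_integral_le_of_norm_le (hI.norm.mul_const _) (Eventually.of_forall fun q => ?_)
    rw [norm_mul]
    by_cases hq : q ∈ tsupport φ
    · have : q⁻¹ * p ∈ Kᶜ := fun hmem => hp ⟨(q, q⁻¹ * p), ⟨hq, hmem⟩, by simp⟩
      have := hsub this
      change dist (h (q⁻¹ * p)) 0 < ε / (A + 1) at this
      rw [dist_zero_right] at this
      gcongr
    · simp [image_eq_zero_of_notMem_tsupport hq]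
  rw [integral_mul_const, ← hA] at hb
  change dist (C.conv φ h p) 0 < ε
  rw [dist_zero_right]
  refine hb.trans_lt ?_
  rw [mul_div_assoc', div_lt_iff₀ (by positivity)]
  nlinarith

end Integral

end CarnotGroup

/-! ### Fundamental solutions: uniqueness, homogeneity, sign and pole. -/

namespace CarnotGroup

variable {G 𝔤 ι : Type*} [Group G] [TopologicalSpace G] [LieRing 𝔤] [LieAlgebra ℝ 𝔤] [Fintype ι]
  {C : CarnotGroup G 𝔤 ι} {φ Γ Γ' : G → ℝ} {p : G}

theorem IsTestFunction.comp_inv [IsTopologicalGroup G] (hφ : C.IsTestFunction φ) :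
    C.IsTestFunction fun q => φ q⁻¹ where
  smooth q := (hφ.smooth q⁻¹).comp_map
    (C.contDiff_toCoord_inv (C.contDiff_toCoord_coord contDiff_id))
  compact := hφ.compact.comp_homeomorph (Homeomorph.inv G)

theorem IsTestFunction.comp_mul_left [IsTopologicalGroup G] (hφ : C.IsTestFunction φ) (p : G) :
    C.IsTestFunction fun q => φ (p * q) where
  smooth q := (hφ.smooth (p * q)).comp_mul_left
  compact := hφ.compact.comp_homeomorph (Homeomorph.mulLeft p)

theorem IsTestFunction.comp_dilation (hφ : C.IsTestFunction φ) {l : ℝ} (hl : l ≠ 0) :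
    C.IsTestFunction fun q => φ (C.dilation l q) where
  smooth q := (hφ.smooth (C.dilation l q)).comp_dilation
  compact := hφ.compact.comp_homeomorph (C.dilationHomeo l hl)

theorem IsTestFunction.continuous_subLaplacian (hφ : C.IsTestFunction φ) :
    Continuous (C.subLaplacian φ) :=
  continuous_finsetSum _ fun i _ => continuous_of_smoothAt fun p =>
    ((hφ.smoothAt (n := 2) p).vectorField (m := 1) (by norm_num) i).vectorField
      (m := 0) (by norm_num) i

theorem IsTestFunction.hasCompactSupport_subLaplacian [T2Space G] (hφ : C.IsTestFunction φ) :
    HasCompactSupport (C.subLaplacian φ) :=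
  hφ.compact.of_isClosed_subset (isClosed_tsupport _)
    (closure_minimal support_subLaplacian_subset (isClosed_tsupport φ))

variable [MeasurableSpace G]

theorem IsFundamentalSolution.smoothAt (hΓ : C.IsFundamentalSolution Γ) {n : ℕ∞} (hp : p ≠ 1) :
    C.SmoothAt n Γ p := by
  have hT : T2Space G := C.t2Space
  exact (hΓ.smooth.smoothAt isOpen_compl_singleton hp).of_top _

theorem IsFundamentalSolution.continuousAt (hΓ : C.IsFundamentalSolution Γ) (hp : p ≠ 1) :
    ContinuousAt Γ p := (hΓ.smoothAt (n := 0) hp).continuousAt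

theorem IsFundamentalSolution.integral_mul_subLaplacian (hΓ : C.IsFundamentalSolution Γ)
    (hφ : C.IsTestFunction φ) : ∫ q, Γ q * C.subLaplacian φ q ∂C.lebesgue = φ 1 :=
  hΓ.integral_eq φ (isCn_univ_of_smoothAt hφ.smooth) hφ.compact

variable [BorelSpace G]

/-- The measure scales by `l ^ Q` and `𝓛` by `l ^ 2`. Together with uniqueness this gives the
homogeneity of `Γ`. -/
theorem IsFundamentalSolution.comp_dilation (hQ : 2 ≤ C.homDim) (hΓ : C.IsFundamentalSolution Γ)
    {l : ℝ} (hl : 0 < l) :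
    C.IsFundamentalSolution fun p => l ^ (C.homDim - 2) * Γ (C.dilation l p) where
  smooth := by
    intro x hx
    have h1 : C.coord x ≠ 1 := hx
    have h2 : C.dilation l (C.coord x) ≠ 1 := fun h => h1 (by
      rw [← C.dilation_one l] at h
      exact (C.dilationHomeo l hl.ne').injective h)
    have h3 : C.SmoothAt ((⊤ : ℕ∞) : WithTop ℕ∞) (fun p => l ^ (C.homDim - 2) * Γ (C.dilation l p))
      (C.coord x) := (smoothAt_const _).mul (hΓ.smoothAt h2).comp_dilation
    rw [SmoothAt, toCoord_coord] at h3
    exact h3.contDiffWithinAt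
  locallyIntegrable := by
    refine LocallyIntegrable.smul (𝕜 := ℝ) ?_ (l ^ (C.homDim - 2))
    refine (locallyIntegrable_map_homeomorph (C.dilationHomeo l hl.ne')).1 fun p => ?_
    obtain ⟨s, hs, hI⟩ := hΓ.locallyIntegrable p
    refine ⟨s, hs, ?_⟩
    have hc : ENNReal.ofReal (l ^ C.homDim) ≠ 0 := by
      simpa using pow_pos hl _
    rw [C.lebesgue_eq_smul_map_dilation hl, IntegrableOn, Measure.restrict_smul,
      integrable_smul_measure hc ENNReal.ofReal_ne_top] at hI
    exact hI
  tendsto_zero := by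
    have h1 : Tendsto (C.dilation l) (cocompact G) (cocompact G) :=
      (C.dilationHomeo l hl.ne').isClosedEmbedding.tendsto_cocompact
    simpa using (hΓ.tendsto_zero.comp h1).const_mul (l ^ (C.homDim - 2))
  integral_eq φ hφ hφs := by
    have hφt : C.IsTestFunction φ := ⟨fun p => hφ.smoothAt isOpen_univ (Set.mem_univ p), hφs⟩
    have hψ := hφt.comp_dilation (l := l⁻¹) (inv_ne_zero hl.ne')
    have h1 := hΓ.integral_mul_subLaplacian hψ
    rw [dilation_one, C.integral_comp_dilation hl] at h1
    rw [← h1, ← integral_const_mul]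
    refine integral_congr_ae (Eventually.of_forall fun p => ?_)
    simp only [subLaplacian_comp_dilation, dilation_dilation, inv_mul_cancel₀ hl.ne',
      dilation_one_left]
    obtain ⟨k, hk⟩ := Nat.exists_eq_add_of_le hQ
    rw [hk, Nat.add_sub_cancel_left, pow_add]
    field_simp

variable [IsTopologicalGroup G] [C.lebesgue.IsHaarMeasure]

/-- Pairing with a test function becomes a point value of a convolution, to which the maximum
principle applies even though `h` itself may be singular. -/
theorem conv_comp_inv_one [C.lebesgue.IsInvInvariant] (φ h : G → ℝ) :
    C.conv (fun q => φ q⁻¹) h 1 = ∫ q, φ q * h q ∂C.lebesgue := by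
  rw [conv_eq]
  simp [mul_comm]

variable [C.lebesgue.IsMulRightInvariant]

theorem IsFundamentalSolution.subLaplacian_eq_zero (hΓ : C.IsFundamentalSolution Γ) (hp : p ≠ 1) :
    C.subLaplacian Γ p = 0 := by
  have hT : T2Space G := C.t2Space
  refine eq_zero_of_integral_test_eq_zero (C := C) (U := {1}ᶜ) isOpen_compl_singleton
    (fun q hq => ?_) (fun φ hφ hs => ?_) hp
  · exact tendsto_finsetSum _ fun i _ => ((((hΓ.smoothAt (n := 2) hq).vectorField (m := 1)
      (by norm_num) i).vectorField (m := 0) (by norm_num) i).continuousAt)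
  · rw [integral_mul_subLaplacian_comm (fun p => hφ.smoothAt (n := 2) p)
      (fun q hq => hΓ.smoothAt (n := 2) (hs hq)) hφ.compact]
    have := hΓ.integral_mul_subLaplacian hφ
    rw [image_eq_zero_of_notMem_tsupport (fun h => hs h rfl)] at this
    simpa only [mul_comm] using this

variable [C.lebesgue.IsInvInvariant]

/-- Tested against `g`, the left side is `∫ φ(q) ∫ Γ(p) (𝓛g)(q p) dp dq`. As `𝓛` commutes with left
translations, the inner integral is `g(q)`. -/
theorem IsFundamentalSolution.subLaplacian_conv (hΓ : C.IsFundamentalSolution Γ)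
    (hφ : C.IsTestFunction φ) (p : G) : C.subLaplacian (C.conv φ Γ) p = φ p := by
  have hT : T2Space G := C.t2Space
  have hs : ∀ p, C.SmoothAt ((2 : ℕ∞) : WithTop ℕ∞) (C.conv φ Γ) p := fun p =>
    (hφ.smoothAt_conv hΓ.locallyIntegrable p).of_top _
  have hLc : Continuous (C.subLaplacian (C.conv φ Γ)) :=
    continuous_finsetSum _ fun i _ => continuous_of_smoothAt fun p =>
      ((hs p).vectorField (m := 1) (by norm_num) i).vectorField (m := 0) (by norm_num) i
  rw [← sub_eq_zero]
  refine eq_zero_of_integral_test_eq_zero (C := C) (U := Set.univ)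
    (F := fun p => C.subLaplacian (C.conv φ Γ) p - φ p) isOpen_univ
    (fun q _ => (hLc.sub hφ.continuous).continuousAt) (fun g hg _ => ?_) (Set.mem_univ p)
  simp only [mul_sub]
  rw [integral_sub
    (f := fun q => g q * C.subLaplacian (C.conv φ Γ) q) (g := fun q => g q * φ q)
    ((hg.continuous.mul hLc).integrable_of_hasCompactSupport hg.compact.mul_right)
    ((hg.continuous.mul hφ.continuous).integrable_of_hasCompactSupport hg.compact.mul_right),
    integral_mul_subLaplacian_comm (fun p => hg.smoothAt (n := 2) p) (fun p _ => hs p) hg.compact,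
    sub_eq_zero]
  simp only [mul_comm (C.subLaplacian g _)]
  rw [integral_conv_mul hφ.continuous hφ.compact hΓ.locallyIntegrable hg.continuous_subLaplacian
    hg.hasCompactSupport_subLaplacian]
  refine integral_congr_ae (Eventually.of_forall fun q => ?_)
  have := hΓ.integral_mul_subLaplacian (hg.comp_mul_left q)
  simp only [subLaplacian_comp_mul_left, mul_one] at this
  simp only [this, mul_comm]

/-- For `φ ≥ 0` the convolution of the reflected `φ` with `Γ` is subharmonic and vanishes at
infinity, hence is nonpositive; its value at the identity is `∫ φ Γ`. -/
theorem IsFundamentalSolution.nonpos (hQ : 0 < C.homDim) (hΓ : C.IsFundamentalSolution Γ)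
    (hp : p ≠ 1) : Γ p ≤ 0 := by
  have hT : T2Space G := C.t2Space
  refine nonpos_of_integral_test_nonpos (C := C) (U := {1}ᶜ) isOpen_compl_singleton
    (fun q hq => hΓ.continuousAt hq) (fun φ hφ _ h0 => ?_) hp
  rw [← conv_comp_inv_one]
  have hφ' := hφ.comp_inv
  exact nonpos_of_subLaplacian_nonneg hQ
    (fun p => (hφ'.smoothAt_conv hΓ.locallyIntegrable p).of_top 2)
    (fun p => by rw [hΓ.subLaplacian_conv hφ']; exact h0 _)
    (tendsto_conv hφ'.continuous hφ'.compact hΓ.tendsto_zero) 1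

/-- A fundamental solution is unique. -/
theorem IsFundamentalSolution.eq (hQ : 0 < C.homDim) (hΓ : C.IsFundamentalSolution Γ)
    (hΓ' : C.IsFundamentalSolution Γ') (hp : p ≠ 1) : Γ p = Γ' p := by
  have hT : T2Space G := C.t2Space
  -- The two convolutions with a reflected test function differ by a harmonic function that vanishes
  -- at infinity.
  have key : ∀ {Γ Γ' : G → ℝ}, C.IsFundamentalSolution Γ → C.IsFundamentalSolution Γ' →
      Γ p - Γ' p ≤ 0 := by
    intro Γ Γ' hΓ hΓ'
    refine nonpos_of_integral_test_nonpos (C := C) (U := {1}ᶜ) (F := fun p => Γ p - Γ' p)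
      isOpen_compl_singleton (fun q hq => (hΓ.continuousAt hq).sub (hΓ'.continuousAt hq))
      (fun φ hφ _ h0 => ?_) hp
    have hφ' := hφ.comp_inv
    have hI : ∀ {Γ : G → ℝ}, C.IsFundamentalSolution Γ →
        Integrable (fun q => φ q * Γ q) C.lebesgue := fun hΓ =>
      hΓ.locallyIntegrable.integrable_smul_left_of_hasCompactSupport hφ.continuous hφ.compact
    have hs : ∀ {Γ : G → ℝ}, C.IsFundamentalSolution Γ → ∀ p,
        C.SmoothAt 2 (C.conv (fun q => φ q⁻¹) Γ) p := fun hΓ p =>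
      (hφ'.smoothAt_conv hΓ.locallyIntegrable p).of_top 2
    simp only [mul_sub]
    rw [integral_sub (hI hΓ) (hI hΓ'), ← conv_comp_inv_one, ← conv_comp_inv_one]
    refine nonpos_of_subLaplacian_nonneg hQ
      (f := fun p => C.conv (fun q => φ q⁻¹) Γ p - C.conv (fun q => φ q⁻¹) Γ' p)
      (fun p => (hs hΓ p).sub (hs hΓ' p)) (fun p => ?_) ?_ 1
    · rw [subLaplacian_sub (hs hΓ p) (hs hΓ' p), hΓ.subLaplacian_conv hφ',
        hΓ'.subLaplacian_conv hφ', sub_self]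
    · simpa using (tendsto_conv hφ'.continuous hφ'.compact hΓ.tendsto_zero).sub
        (tendsto_conv hφ'.continuous hφ'.compact hΓ'.tendsto_zero)
  have h1 := key hΓ hΓ'
  have h2 := key hΓ' hΓ
  linarith

theorem IsFundamentalSolution.apply_dilation (hQ : 2 ≤ C.homDim) (hΓ : C.IsFundamentalSolution Γ)
    {l : ℝ} (hl : 0 < l) (hp : p ≠ 1) : l ^ (C.homDim - 2) * Γ (C.dilation l p) = Γ p :=
  (hΓ.comp_dilation hQ hl).eq (by omega) hΓ hp

/-- Relative compactness of the ball replaces a strong maximum principle: by homogeneity a zero of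
`Γ` propagates along its dilation orbit, which is unbounded and would lie in the ball. -/
theorem IsFundamentalSolution.neg_of_isCompact_closure_pseudoBall (hQ : 2 < C.homDim)
    (hΓ : C.IsFundamentalSolution Γ) {r : ℝ} (hr : 0 < r)
    (hB : IsCompact (closure (pseudoBall (C.gauge Γ) p r))) {q : G} (hq : q ≠ 1) : Γ q < 0 := by
  refine lt_of_le_of_ne (hΓ.nonpos (by omega) hq) fun h0 => ?_
  have hmem : ∀ l : ℝ, 0 < l → p * C.dilation l q ∈ closure (pseudoBall (C.gauge Γ) p r) := by
    intro l hl
    refine subset_closure ?_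
    have h1 := hΓ.apply_dilation hQ.le hl hq
    rw [h0, mul_eq_zero] at h1
    have h2 := h1.resolve_left (pow_pos hl _).ne'
    have h3 : (2 : ℝ) - C.homDim ≠ 0 := by
      have : (2 : ℝ) < C.homDim := by exact_mod_cast hQ
      linarith
    rw [pseudoBall, Set.mem_ofPred_eq, inv_mul_cancel_left, gauge]
    split_ifs
    · exact hr.le
    -- `Real.rpow` gives `0` the value `0` at a negative exponent, so a zero of `Γ` has gauge `0`
    -- and belongs to the ball.
    · rw [h2, neg_zero, Real.zero_rpow (by simpa [sub_eq_zero] using h3)]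
      exact hr.le
  obtain ⟨j, hj⟩ : ∃ j, C.toCoord q j ≠ 0 := by
    by_contra! h
    exact hq (C.toCoord_injective (by rw [toCoord_one]; exact funext h))
  obtain ⟨B, hB⟩ := hB.bddAbove_image (f := fun g => |C.toCoord (p⁻¹ * g) j|)
    (((continuous_apply j).comp (C.continuous_toCoord.comp (continuous_const_mul _))).abs).continuousOn
  have hBl : ∀ l : ℝ, 1 ≤ l → l * |C.toCoord q j| ≤ B := by
    intro l hl
    have h1 := hB ⟨_, hmem l (by linarith), rfl⟩
    simp only [inv_mul_cancel_left, toCoord_dilation, abs_mul, abs_pow] at h1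
    rw [abs_of_pos (by linarith)] at h1
    refine le_trans ?_ h1
    gcongr
    exact le_self_pow₀ hl (C.weight_pos j).ne'
  have hx : 0 < |C.toCoord q j| := abs_pos.2 hj
  have hB0 : 0 ≤ B := le_trans (by positivity) (hBl 1 le_rfl)
  have := hBl (1 + (B + 1) / |C.toCoord q j|) (by
    have : 0 ≤ (B + 1) / |C.toCoord q j| := by positivity
    linarith)
  rw [add_mul, div_mul_cancel₀ _ hx.ne'] at this
  linarith

/-- By compactness `Γ ≤ -c` on the unit sphere of the coordinates. A point near the identity reaches
that sphere under a dilation by some large `l`, and `Γ(q) = l^(Q-2) Γ(δ_l q) ≤ -c l^(Q-2)`. -/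
theorem IsFundamentalSolution.tendsto_atBot (hQ : 2 < C.homDim)
    (hΓ : C.IsFundamentalSolution Γ) (hneg : ∀ q, q ≠ 1 → Γ q < 0) :
    Tendsto Γ (𝓝[≠] 1) atBot := by
  have hne1 : ∀ q : G, C.toCoord q ≠ 0 → q ≠ 1 := by
    rintro q hq rfl
    exact hq C.toCoord_one
  obtain ⟨c, hc, hcS⟩ : ∃ c > 0, ∀ q, ‖C.toCoord q‖ = 1 → Γ q ≤ -c := by
    have hS : IsCompact {q : G | ‖C.toCoord q‖ = 1} := by
      have : {q : G | ‖C.toCoord q‖ = 1} = C.homeo.symm ⁻¹' Metric.sphere 0 1 := by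
        ext q; simp [toCoord]
      rw [this]
      exact C.homeo.symm.isCompact_preimage.2 (isCompact_sphere _ _)
    rcases Set.eq_empty_or_nonempty {q : G | ‖C.toCoord q‖ = 1} with h | h
    · exact ⟨1, one_pos, fun q hq => absurd hq (Set.eq_empty_iff_forall_notMem.1 h q)⟩
    · have hS1 : ∀ q, ‖C.toCoord q‖ = 1 → q ≠ 1 := fun q hq => hne1 q fun h => by
        simp [h] at hq
      obtain ⟨q, hq, hmax⟩ := hS.exists_isMaxOn h
        (fun q hq => (hΓ.continuousAt (hS1 q hq)).continuousWithinAt)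
      exact ⟨-Γ q, by linarith [hneg q (hS1 q hq)], fun q' hq' => by simpa using hmax hq'⟩
  rw [Filter.tendsto_atBot]
  intro A
  set Λ : ℝ := max 1 (-A / c) with hΛ
  have hΛ1 : 1 ≤ Λ := le_max_left _ _
  have hΛA : -A ≤ c * Λ := by
    have : -A / c ≤ Λ := le_max_right _ _
    rw [div_le_iff₀ hc] at this
    linarith
  -- A dilation by `l` with `1 ≤ l < Λ` enlarges the norm at most by `Λ ^ step`, so from below this
  -- radius it cannot reach the unit sphere.
  have hδ : 0 < (Λ ^ C.step)⁻¹ := by positivity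
  have hnhds : ∀ᶠ q in 𝓝[≠] (1 : G), ‖C.toCoord q‖ < (Λ ^ C.step)⁻¹ := by
    refine nhdsWithin_le_nhds ?_
    refine C.continuous_toCoord.norm.continuousAt.eventually (gt_mem_nhds ?_)
    simpa [toCoord_one] using hδ
  filter_upwards [hnhds, self_mem_nhdsWithin] with q hq hq1
  have hq1 : q ≠ 1 := hq1
  have hx0 : 0 < ‖C.toCoord q‖ := norm_pos_iff.2 fun h => hq1
    (C.toCoord_injective (by rw [h, toCoord_one]))
  have hx1 : ‖C.toCoord q‖ ≤ 1 := hq.le.trans (inv_le_one_of_one_le₀ (one_le_pow₀ hΛ1))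
  obtain ⟨l, hl1, hl⟩ : ∃ l : ℝ, 1 ≤ l ∧ ‖C.toCoord (C.dilation l q)‖ = 1 := by
    have hcont : Continuous fun l : ℝ => ‖C.toCoord (C.dilation l q)‖ := by
      refine Continuous.norm (continuous_pi fun j => ?_)
      simp only [toCoord_dilation]
      exact (continuous_pow _).mul continuous_const
    have hM : 1 ≤ ‖C.toCoord q‖⁻¹ := (one_le_inv₀ hx0).2 hx1
    have hne : Nonempty ι := by
      obtain ⟨i, -⟩ := C.exists_weight_eq_one (by omega)
      exact ⟨i⟩
    -- Weights are at least one and the factor is at least one, so the largest coordinate grows at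
    -- least linearly in the factor.
    have hend : 1 ≤ ‖C.toCoord (C.dilation ‖C.toCoord q‖⁻¹ q)‖ := by
      obtain ⟨j, hj⟩ : ∃ j, ‖C.toCoord q‖ = ‖C.toCoord q j‖ := by
        obtain ⟨j, -, hj⟩ := Finset.exists_mem_eq_sup (Finset.univ : Finset ι)
          Finset.univ_nonempty fun j => ‖C.toCoord q j‖₊
        exact ⟨j, by rw [Pi.norm_def, hj]; rfl⟩
      refine le_trans ?_ (norm_le_pi_norm _ j)
      rw [toCoord_dilation, norm_mul, ← hj, norm_pow, norm_inv, norm_norm]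
      calc (1 : ℝ) = ‖C.toCoord q‖⁻¹ * ‖C.toCoord q‖ := (inv_mul_cancel₀ hx0.ne').symm
        _ ≤ _ := by
          gcongr
          exact le_self_pow₀ hM (C.weight_pos j).ne'
    obtain ⟨l, hl, hl'⟩ := intermediate_value_Icc hM hcont.continuousOn
      ⟨by simpa [dilation_one_left] using hx1, hend⟩
    exact ⟨l, hl.1, hl'⟩
  have hl0 : 0 < l := by linarith
  have hlΛ : Λ ≤ l := by
    by_contra! hlt
    have h1 : ‖C.toCoord (C.dilation l q)‖ ≤ l ^ C.step * ‖C.toCoord q‖ := by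
      refine (pi_norm_le_iff_of_nonneg (by positivity)).2 fun j => ?_
      rw [toCoord_dilation, norm_mul, norm_pow, Real.norm_of_nonneg hl0.le]
      gcongr
      · exact C.weight_le_step j
      · exact norm_le_pi_norm _ j
    rw [hl] at h1
    have h2 : l ^ C.step * ‖C.toCoord q‖ < 1 :=
      calc l ^ C.step * ‖C.toCoord q‖ < l ^ C.step * (Λ ^ C.step)⁻¹ := by gcongr
        _ ≤ Λ ^ C.step * (Λ ^ C.step)⁻¹ := by gcongr
        _ = 1 := mul_inv_cancel₀ (by positivity)
    linarith
  rw [← hΓ.apply_dilation hQ.le hl0 hq1]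
  have h1 := hcS _ hl
  have h2 : Λ ≤ l ^ (C.homDim - 2) := hlΛ.trans (le_self_pow₀ hl1 (by omega))
  nlinarith

end CarnotGroup

/-! ### Auxiliary functions of one real variable. -/

section RealLine

theorem exists_primitive_of_vanishing {k : ℝ → ℝ} {d : ℝ} (hk : Continuous k)
    (hd : ∀ t, d ≤ t → k t = 0) :
    ∃ g : ℝ → ℝ, (∀ t, HasDerivAt g (k t) t) ∧ (∀ t, d ≤ t → g t = 0) ∧
      ∀ b, (∀ t ≤ b, k t = 0) → ∀ t ≤ b, g t = -∫ s, k s := by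
  refine ⟨fun t => ∫ s in d..t, k s, fun t => ?_, fun t ht => ?_, fun b hb t ht => ?_⟩
  · exact intervalIntegral.integral_hasDerivAt_right (hk.intervalIntegrable _ _)
      (hk.stronglyMeasurableAtFilter _ _) hk.continuousAt
  · have : ∫ s in d..t, k s = ∫ s in d..t, (0 : ℝ) :=
      intervalIntegral.integral_congr fun s hs => hd s (by
        rw [Set.uIcc_of_le ht] at hs; exact hs.1)
    simp only [this, intervalIntegral.integral_zero]
  · simp only
    rw [intervalIntegral.integral_symm, intervalIntegral.integral_eq_integral_of_support_subset]
    intro s hs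
    constructor
    · by_contra! h
      exact hs (hb s (h.trans ht))
    · by_contra! h
      exact hs (hd s h.le)

/-- Mean zero makes the first primitive vanish on both sides of the support, so the second is
constant on the left and zero on the right. The constant is arbitrary, since the first moment of `k`
is not prescribed. -/
theorem exists_second_primitive {k : ℝ → ℝ} {b d : ℝ} (hk : Continuous k)
    (hd : ∀ t, d ≤ t → k t = 0) (hb : ∀ t ≤ b, k t = 0) (h0 : ∫ t, k t = 0) :
    ∃ (F : ℝ → ℝ) (c : ℝ), ContDiff ℝ 2 F ∧ deriv (deriv F) = k ∧ (∀ t ≤ b, F t = c) ∧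
      ∀ t, d ≤ t → F t = 0 := by
  obtain ⟨g, hg, hgd, hgb⟩ := exists_primitive_of_vanishing hk hd
  have hgc : Continuous g := continuous_iff_continuousAt.2 fun t => (hg t).continuousAt
  obtain ⟨F, hF, hFd, hFb⟩ := exists_primitive_of_vanishing hgc hgd
  have e1 : deriv F = g := funext fun t => (hF t).deriv
  have e2 : deriv g = k := funext fun t => (hg t).deriv
  refine ⟨F, _, ?_, by rw [e1, e2], hFb b fun t ht => by rw [hgb b hb t ht, h0, neg_zero], hFd⟩
  rw [show (2 : WithTop ℕ∞) = 1 + 1 by norm_num, contDiff_succ_iff_deriv]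
  refine ⟨fun t => (hF t).differentiableAt, by simp, ?_⟩
  rw [e1, contDiff_one_iff_deriv, e2]
  exact ⟨fun t => (hg t).differentiableAt, hk⟩

/-- The last integral is the increment of the primitive `t F' - F` from `b` to `d`. It supplies the
normalization in `exists_integral_level_eq_one`. -/
theorem exists_cutoff {b d : ℝ} (h : b < d) :
    ∃ F : ℝ → ℝ, ContDiff ℝ ((⊤ : ℕ∞) : WithTop ℕ∞) F ∧ (∀ t ≤ b, F t = 1) ∧
      (∀ t, d ≤ t → F t = 0) ∧ (∀ t ≤ b, deriv (deriv F) t = 0) ∧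
      (∀ t, d ≤ t → deriv (deriv F) t = 0) ∧ ∫ t, t * deriv (deriv F) t = 1 := by
  -- The transition occupies the middle third, so `F` is locally constant at both endpoints and its
  -- derivatives vanish there too.
  set δ := (d - b) / 3 with hδ
  have hδ0 : 0 < δ := by rw [hδ]; linarith
  set F : ℝ → ℝ := fun t => Real.smoothTransition ((d - δ - t) / δ) with hF
  have hFs : ContDiff ℝ ((⊤ : ℕ∞) : WithTop ℕ∞) F :=
    Real.smoothTransition.contDiff.comp ((contDiff_const.sub contDiff_id).div_const δ)
  have hF1 : ∀ t, t < b + δ → F t = 1 := fun t ht =>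
    Real.smoothTransition.one_of_one_le (by rw [le_div_iff₀ hδ0]; linarith)
  have hF0 : ∀ t, d - δ < t → F t = 0 := fun t ht =>
    Real.smoothTransition.zero_of_nonpos (div_nonpos_of_nonpos_of_nonneg (by linarith) hδ0.le)
  have hb : ∀ t, t < b + δ → deriv F t = 0 := fun t ht => by
    have : F =ᶠ[𝓝 t] fun _ => 1 := by
      filter_upwards [gt_mem_nhds ht] with s hs using hF1 s hs
    rw [this.deriv_eq, deriv_const]
  have hd : ∀ t, d - δ < t → deriv F t = 0 := fun t ht => by
    have : F =ᶠ[𝓝 t] fun _ => 0 := by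
      filter_upwards [lt_mem_nhds ht] with s hs using hF0 s hs
    rw [this.deriv_eq, deriv_const]
  have hb' : ∀ t, t < b + δ → deriv (deriv F) t = 0 := fun t ht => by
    have : deriv F =ᶠ[𝓝 t] fun _ => 0 := by
      filter_upwards [gt_mem_nhds ht] with s hs using hb s hs
    rw [this.deriv_eq, deriv_const]
  have hd' : ∀ t, d - δ < t → deriv (deriv F) t = 0 := fun t ht => by
    have : deriv F =ᶠ[𝓝 t] fun _ => 0 := by
      filter_upwards [lt_mem_nhds ht] with s hs using hd s hs
    rw [this.deriv_eq, deriv_const]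
  have hF' : ContDiff ℝ ((⊤ : ℕ∞) : WithTop ℕ∞) (deriv F) :=
    (contDiff_infty_iff_deriv.1 hFs).2
  have hF'' : Continuous (deriv (deriv F)) :=
    (contDiff_infty_iff_deriv.1 hF').2.continuous
  refine ⟨F, hFs, fun t ht => hF1 t (by linarith), fun t ht => hF0 t (by linarith),
    fun t ht => hb' t (by linarith), fun t ht => hd' t (by linarith), ?_⟩
  have hsupp : Function.support (fun t => t * deriv (deriv F) t) ⊆ Set.Ioc b d := by
    intro t ht
    constructor
    · by_contra! hle
      exact ht (by simp [hb' t (by linarith)])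
    · by_contra! hle
      exact ht (by simp [hd' t (by linarith)])
  rw [← intervalIntegral.integral_eq_integral_of_support_subset hsupp,
    intervalIntegral.integral_eq_sub_of_hasDerivAt (f := fun t => t * deriv F t - F t)
      (f' := fun t => t * deriv (deriv F) t)
      (fun t _ => ?_) ((continuous_id.mul hF'').intervalIntegrable _ _)]
  · rw [hd d (by linarith), hb b (by linarith), hF0 d (by linarith), hF1 b (by linarith)]
    ring
  · have h1 := ((hF'.differentiable (by simp)) t).hasDerivAt
    have h2 := ((hFs.differentiable (by simp)) t).hasDerivAt
    have h3 := ((hasDerivAt_id t).mul h1).sub h2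
    have e : 1 * deriv F t + id t * deriv (deriv F) t - deriv F t = t * deriv (deriv F) t := by
      simp
    rw [e] at h3
    exact h3

theorem hasCompactSupport_of_vanishing {k : ℝ → ℝ} {b d : ℝ} (hb : ∀ t ≤ b, k t = 0)
    (hd : ∀ t, d ≤ t → k t = 0) : HasCompactSupport k := by
  refine HasCompactSupport.intro (isCompact_Icc (a := b) (b := d)) fun t ht => ?_
  rcases not_and_or.1 ht with h | h
  · exact hb t (not_le.1 h).le
  · exact hd t (not_le.1 h).le

theorem exists_normalized_bump {b d : ℝ} (h : b < d) :
    ∃ k : ℝ → ℝ, Continuous k ∧ (∀ t, 0 ≤ k t) ∧ (∀ t ≤ b, k t = 0) ∧ (∀ t, d ≤ t → k t = 0) ∧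
      ∫ t, k t = 1 := by
  set k : ℝ → ℝ := fun t => max 0 ((t - b) * (d - t)) with hk
  have hkc : Continuous k := by fun_prop
  have hk0 : ∀ t, 0 ≤ k t := fun t => le_max_left _ _
  have hb : ∀ t ≤ b, k t = 0 := fun t ht => max_eq_left (by nlinarith)
  have hd : ∀ t, d ≤ t → k t = 0 := fun t ht => max_eq_left (by nlinarith)
  have hpos : 0 < ∫ t, k t :=
    hkc.integral_pos_of_hasCompactSupport_nonneg_nonzero (hasCompactSupport_of_vanishing hb hd) hk0
      (x := (b + d) / 2) (by
        have : 0 < ((b + d) / 2 - b) * (d - (b + d) / 2) := by nlinarith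
        exact (lt_max_of_lt_right this).ne')
  refine ⟨fun t => (∫ s, k s)⁻¹ * k t, continuous_const.mul hkc,
    fun t => mul_nonneg (inv_nonneg.2 hpos.le) (hk0 t), fun t ht => by simp only [hb t ht, mul_zero],
    fun t ht => by simp only [hd t ht, mul_zero], ?_⟩
  rw [integral_const_mul, inv_mul_cancel₀ hpos.ne']

/-- A sequence of trapezoids with compact support in `(-∞, d')` that converges to the indicator
function of `(-∞, d]`. -/
theorem exists_trapezoids {d d' : ℝ} (h : d < d') :
    ∃ χ : ℕ → ℝ → ℝ, (∀ n, Continuous (χ n)) ∧ (∀ n t, 0 ≤ χ n t) ∧ (∀ n t, χ n t ≤ 1) ∧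
      (∀ (n : ℕ) (t : ℝ), t ≤ -(n : ℝ) → χ n t = 0) ∧ (∀ n t, d' ≤ t → χ n t = 0) ∧
      ∀ t, Tendsto (fun n => χ n t) atTop (𝓝 ((Set.Iic d).indicator (fun _ => 1) t)) := by
  let cl : ℝ → ℝ := fun x => max 0 (min 1 x)
  have cl0 : ∀ x, 0 ≤ cl x := fun x => le_max_left _ _
  have cl1 : ∀ x, cl x ≤ 1 := fun x => max_le zero_le_one (min_le_left _ _)
  have clz : ∀ x ≤ 0, cl x = 0 := fun x hx => max_eq_left ((min_le_right _ _).trans hx)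
  have clo : ∀ x, 1 ≤ x → cl x = 1 := fun x hx => by simp [cl, min_eq_left hx]
  have clc : Continuous cl := by fun_prop
  -- The first factor rises from `0` to `1` on `[-n, 1 - n]`; the second falls from `1` to `0` on
  -- `[d, d + (d' - d) / (n + 1)]`, which stays within `[d, d']` also for `n = 0`.
  refine ⟨fun n t => cl (t + n) * cl (1 - ((n : ℝ) + 1) * (t - d) / (d' - d)), fun n => ?_,
    fun n t => mul_nonneg (cl0 _) (cl0 _), fun n t => mul_le_one₀ (cl1 _) (cl0 _) (cl1 _),
    fun n t ht => ?_, fun n t ht => ?_, fun t => ?_⟩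
  · exact (clc.comp (by fun_prop)).mul (clc.comp (by fun_prop))
  · simp only [clz (t + n) (by linarith), zero_mul]
  · simp only
    rw [clz (1 - _), mul_zero]
    rw [sub_nonpos, le_div_iff₀ (by linarith)]
    have : (0 : ℝ) ≤ n := n.cast_nonneg
    nlinarith
  · refine tendsto_const_nhds.congr' ?_
    by_cases ht : t ≤ d
    · filter_upwards [eventually_ge_atTop ⌈1 - t⌉₊] with n hn
      have h1 : 1 - t ≤ n := Nat.ceil_le.1 hn
      rw [Set.indicator_of_mem (Set.mem_Iic.2 ht), clo _ (by linarith), clo, one_mul]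
      have : ((n : ℝ) + 1) * (t - d) / (d' - d) ≤ 0 :=
        div_nonpos_of_nonpos_of_nonneg (mul_nonpos_of_nonneg_of_nonpos (by positivity)
          (by linarith)) (by linarith)
      linarith
    · filter_upwards [eventually_ge_atTop ⌈(d' - d) / (t - d)⌉₊] with n hn
      have h1 : (d' - d) / (t - d) ≤ n := Nat.ceil_le.1 hn
      push Not at ht
      rw [Set.indicator_of_notMem (by simpa using ht), clz (1 - _), mul_zero]
      rw [div_le_iff₀ (by linarith)] at h1
      rw [sub_nonpos, le_div_iff₀ (by linarith)]
      nlinarith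

end RealLine

/-! ### Functions of `Γ` and mean values over layers. -/

namespace CarnotGroup

section Sublevel

variable {G : Type*} [Group G] {Γ : G → ℝ} {p : G} {F : ℝ → ℝ} {c : ℝ}

/-- The set where `Γ ≤ -a`, with the identity added. -/
def sublevel (Γ : G → ℝ) (a : ℝ) : Set G := {q | q = 1 ∨ Γ q ≤ -a}

theorem sublevel_anti {a b : ℝ} (h : a ≤ b) (Γ : G → ℝ) : sublevel Γ b ⊆ sublevel Γ a :=
  fun _ hq => hq.imp_right fun h' => h'.trans (neg_le_neg h)

open Classical in
/-- The function `F ∘ Γ`, with the value `c` at the identity. -/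
noncomputable def compExtend (F : ℝ → ℝ) (c : ℝ) (Γ : G → ℝ) (q : G) : ℝ :=
  if q = 1 then c else F (Γ q)

theorem compExtend_one (F : ℝ → ℝ) (c : ℝ) (Γ : G → ℝ) : compExtend F c Γ 1 = c := if_pos rfl

theorem compExtend_of_ne (hp : p ≠ 1) : compExtend F c Γ p = F (Γ p) := if_neg hp

end Sublevel

variable {G 𝔤 ι : Type*} [Group G] [TopologicalSpace G] [LieRing 𝔤] [LieAlgebra ℝ 𝔤] [Fintype ι]
  {C : CarnotGroup G 𝔤 ι} {Γ w : G → ℝ} {p : G} {F k : ℝ → ℝ} {a A c : ℝ}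

theorem compExtend_eventuallyEq_one (hbot : Tendsto Γ (𝓝[≠] 1) atBot) (hF : ∀ t ≤ -A, F t = c) :
    compExtend F c Γ =ᶠ[𝓝 1] fun _ => c := by
  have := eventually_nhdsWithin_iff.1 (hbot.eventually (eventually_le_atBot (-A)))
  filter_upwards [this] with q hq
  by_cases h : q = 1
  · rw [h, compExtend_one]
  · rw [compExtend_of_ne h, hF _ (hq h)]

theorem compExtend_eventuallyEq [T2Space G] (hp : p ≠ 1) :
    compExtend F c Γ =ᶠ[𝓝 p] fun q => F (Γ q) := by
  filter_upwards [isOpen_compl_singleton.mem_nhds hp] with q hq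
  exact compExtend_of_ne hq

variable [MeasurableSpace G]

theorem IsFundamentalSolution.isCompact_sublevel (hΓ : C.IsFundamentalSolution Γ) (ha : 0 < a) :
    IsCompact (sublevel Γ a) := by
  have hT : T2Space G := C.t2Space
  have hcl : IsClosed (sublevel Γ a) := by
    rw [← isOpen_compl_iff, isOpen_iff_mem_nhds]
    intro q hq
    obtain ⟨h1, h2⟩ := not_or.1 hq
    filter_upwards [isOpen_compl_singleton.mem_nhds h1,
      (hΓ.continuousAt h1).eventually (lt_mem_nhds (not_le.1 h2))] with x hx1 hx2
    exact not_or.2 ⟨hx1, not_le.2 hx2⟩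
  obtain ⟨K, hK, hsub⟩ := mem_cocompact.1
    (hΓ.tendsto_zero.eventually (lt_mem_nhds (neg_lt_zero.2 ha)))
  refine (hK.union (isCompact_singleton (x := (1 : G)))).of_isClosed_subset hcl fun q hq => ?_
  rcases hq with rfl | hq
  · exact Or.inr rfl
  · refine Or.inl ?_
    by_contra hqK
    have : -a < Γ q := hsub hqK
    exact absurd this (not_lt.2 hq)

/-- Near the pole `Γ` lies below `-A`, where `F` is constant, so the singularity disappears. -/
theorem IsFundamentalSolution.smoothAt_compExtend (hΓ : C.IsFundamentalSolution Γ)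
    (hbot : Tendsto Γ (𝓝[≠] 1) atBot) {n : ℕ∞} (hF : ContDiff ℝ n F) (hA : ∀ t ≤ -A, F t = c)
    (p : G) : C.SmoothAt n (compExtend F c Γ) p := by
  have hT : T2Space G := C.t2Space
  by_cases hp : p = 1
  · rw [hp]
    exact (smoothAt_const c).congr (compExtend_eventuallyEq_one hbot hA)
  · exact (SmoothAt.comp hF.contDiffAt (hΓ.smoothAt hp)).congr (compExtend_eventuallyEq hp)

theorem IsFundamentalSolution.tsupport_compExtend_subset (hΓ : C.IsFundamentalSolution Γ)
    (ha : 0 < a) (hF : ∀ t, -a ≤ t → F t = 0) : tsupport (compExtend F c Γ) ⊆ sublevel Γ a := by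
  have hT : T2Space G := C.t2Space
  refine closure_minimal (fun q hq => ?_) (hΓ.isCompact_sublevel ha).isClosed
  by_contra h
  obtain ⟨h1, h2⟩ := not_or.1 h
  exact hq (by rw [compExtend_of_ne h1, hF _ (not_le.1 h2).le])

theorem IsFundamentalSolution.hasCompactSupport_compExtend (hΓ : C.IsFundamentalSolution Γ)
    (ha : 0 < a) (hF : ∀ t, -a ≤ t → F t = 0) : HasCompactSupport (compExtend F c Γ) := by
  have hT : T2Space G := C.t2Space
  exact (hΓ.isCompact_sublevel ha).of_isClosed_subset (isClosed_tsupport _)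
    (hΓ.tsupport_compExtend_subset ha hF)

variable [BorelSpace G]

theorem ae_ne_one (C : CarnotGroup G 𝔤 ι) [Nonempty ι] : ∀ᵐ q ∂C.lebesgue, q ≠ 1 := by
  rw [ae_iff]
  simpa using C.lebesgue_singleton 1

variable [C.lebesgue.IsHaarMeasure]

/-- Off the identity the integrand equals a continuous function of compact support: `k(Γ)` vanishes
near the pole and outside the set where `w` is known to be continuous. -/
theorem IsFundamentalSolution.integrable_level [Nonempty ι] (hΓ : C.IsFundamentalSolution Γ)
    (hbot : Tendsto Γ (𝓝[≠] 1) atBot) (ha : 0 < a) (hk : Continuous k) (hA : ∀ t ≤ -A, k t = 0)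
    (hka : ∀ t, -a ≤ t → k t = 0) (hw : ∀ q ∈ sublevel Γ a, ContinuousAt w q) :
    Integrable (fun q => w q * (k (Γ q) * C.gradSq Γ q)) C.lebesgue := by
  have hT : T2Space G := C.t2Space
  have hΦc : Continuous (compExtend k 0 Γ) :=
    continuous_of_smoothAt (hΓ.smoothAt_compExtend (n := 0) hbot (contDiff_zero.2 hk) hA)
  have hcont : Continuous fun q => compExtend k 0 Γ q * (w q * C.gradSq Γ q) := by
    refine continuous_iff_continuousAt.2 fun q => ?_
    by_cases hq1 : q = 1
    · rw [hq1]
      have : (fun q => compExtend k 0 Γ q * (w q * C.gradSq Γ q)) =ᶠ[𝓝 1] fun _ => 0 := by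
        filter_upwards [compExtend_eventuallyEq_one hbot hA] with x hx
        rw [hx, zero_mul]
      exact this.continuousAt
    · by_cases hq : q ∈ sublevel Γ a
      · exact hΦc.continuousAt.mul ((hw q hq).mul
          (hΓ.smoothAt (n := 1) hq1).continuousAt_gradSq)
      · have : (fun q => compExtend k 0 Γ q * (w q * C.gradSq Γ q)) =ᶠ[𝓝 q] fun _ => 0 := by
          filter_upwards [notMem_tsupport_iff_eventuallyEq.1 fun h =>
            hq (hΓ.tsupport_compExtend_subset ha hka h)] with x hx
          rw [hx]
          simp
        exact this.continuousAt
  refine (hcont.integrable_of_hasCompactSupport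
    (hΓ.hasCompactSupport_compExtend ha hka).mul_right).congr ?_
  filter_upwards [ae_ne_one C] with q hq
  rw [compExtend_of_ne hq]
  ring

variable [IsTopologicalGroup G] [C.lebesgue.IsMulRightInvariant]

theorem IsFundamentalSolution.subLaplacian_compExtend (hΓ : C.IsFundamentalSolution Γ)
    (hF : ContDiff ℝ 2 F) (hp : p ≠ 1) : C.subLaplacian (compExtend F c Γ) p =
      deriv (deriv F) (Γ p) * C.gradSq Γ p := by
  have hT : T2Space G := C.t2Space
  have hF' : ContDiff ℝ 1 (deriv F) := by
    have : ContDiff ℝ (1 + 1) F := by norm_num; exact hF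
    exact (contDiff_succ_iff_deriv.1 this).2.2
  rw [subLaplacian_congr (compExtend_eventuallyEq hp),
    subLaplacian_comp (F' := deriv F) (F'' := deriv (deriv F))
      (Eventually.of_forall fun t => (hF.differentiable (by norm_num) t).hasDerivAt)
      ((hF'.differentiable (by norm_num) _).hasDerivAt) hF'.contDiffAt (hΓ.smoothAt (n := 2) hp),
    hΓ.subLaplacian_eq_zero hp, mul_zero, add_zero]

/-- A harmonic function integrates to zero against `k(Γ) |∇₀ Γ|²` if `k` has mean zero. -/
theorem IsFundamentalSolution.integral_level_eq_zero [Nonempty ι]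
    (hΓ : C.IsFundamentalSolution Γ)
    (hbot : Tendsto Γ (𝓝[≠] 1) atBot) (ha : 0 < a) (hk : Continuous k) (hA : ∀ t ≤ -A, k t = 0)
    (hka : ∀ t, -a ≤ t → k t = 0) (h0 : ∫ t, k t = 0)
    (hw : ∀ q ∈ sublevel Γ a, C.SmoothAt 2 w q)
    (hLw : ∀ q ∈ sublevel Γ a, C.subLaplacian w q = 0) :
    ∫ q, w q * (k (Γ q) * C.gradSq Γ q) ∂C.lebesgue = 0 := by
  -- `𝓛 (F ∘ Γ) = k(Γ) |∇₀Γ|²`, and Green's identity moves `𝓛` onto the harmonic `w`.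
  obtain ⟨F, c, hF, hF'', hFA, hFa⟩ := exists_second_primitive hk hka hA h0
  have hsub := hΓ.tsupport_compExtend_subset (c := c) ha hFa
  have h1 := integral_mul_subLaplacian_comm
    (fun p => hΓ.smoothAt_compExtend (n := 2) hbot hF hFA p)
    (fun p hp => hw p (hsub hp)) (hΓ.hasCompactSupport_compExtend ha hFa)
  have h2 : ∫ q, compExtend F c Γ q * C.subLaplacian w q ∂C.lebesgue = 0 := by
    refine integral_eq_zero_of_ae (Eventually.of_forall fun q => ?_)
    by_cases hq : q ∈ sublevel Γ a
    · simp [hLw q hq]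
    · simp [image_eq_zero_of_notMem_tsupport fun h => hq (hsub h)]
  rw [← h2, h1]
  refine integral_congr_ae ?_
  filter_upwards [ae_ne_one C] with q hq
  rw [hΓ.subLaplacian_compExtend hF hq, hF'', mul_comm]

/-- For a cutoff `F` equal to `1` near `-∞`, the identity `∫ Γ 𝓛(F ∘ Γ) = 1` reads `∫ k(Γ) |∇₀Γ|² =
1` with `k(t) = t F''(t)`, and `∫ k = 1` as well. One such `k` fixes the proportionality constant.
-/
theorem IsFundamentalSolution.exists_integral_level_eq_one [Nonempty ι]
    (hΓ : C.IsFundamentalSolution Γ) (hbot : Tendsto Γ (𝓝[≠] 1) atBot) (ha : 0 < a) (haA : a < A) :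
    ∃ k : ℝ → ℝ, Continuous k ∧ (∀ t ≤ -A, k t = 0) ∧ (∀ t, -a ≤ t → k t = 0) ∧ ∫ t, k t = 1 ∧
      ∫ q, k (Γ q) * C.gradSq Γ q ∂C.lebesgue = 1 := by
  obtain ⟨F, hF, hF1, hF0, hFA, hFa, hFi⟩ := exists_cutoff (neg_lt_neg haA)
  have hF2 : ContDiff ℝ 2 F := contDiff_infty.1 hF 2
  have hF'' : Continuous (deriv (deriv F)) := by
    have h1 : ContDiff ℝ (1 + 1) F := by norm_num; exact hF2
    exact (contDiff_one_iff_deriv.1 (contDiff_succ_iff_deriv.1 h1).2.2).2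
  refine ⟨fun t => t * deriv (deriv F) t, continuous_id.mul hF'',
    fun t ht => by simp only [hFA t ht, mul_zero], fun t ht => by simp only [hFa t ht, mul_zero], hFi, ?_⟩
  have hφ : C.IsTestFunction (compExtend F 1 Γ) :=
    ⟨hΓ.smoothAt_compExtend hbot hF hF1, hΓ.hasCompactSupport_compExtend ha hF0⟩
  rw [← compExtend_one F 1 Γ, ← hΓ.integral_mul_subLaplacian hφ]
  refine integral_congr_ae ?_
  filter_upwards [ae_ne_one C] with q hq
  rw [hΓ.subLaplacian_compExtend hF2 hq, mul_assoc]

/-- The mean value property of constants over layers between level sets of `Γ`. -/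
theorem IsFundamentalSolution.integral_level_one [Nonempty ι] (hΓ : C.IsFundamentalSolution Γ)
    (hbot : Tendsto Γ (𝓝[≠] 1) atBot) (ha : 0 < a) (haA : a < A) (hk : Continuous k)
    (hA : ∀ t ≤ -A, k t = 0) (hka : ∀ t, -a ≤ t → k t = 0) :
    ∫ q, k (Γ q) * C.gradSq Γ q ∂C.lebesgue = ∫ t, k t := by
  obtain ⟨k₁, hk₁, hA₁, ha₁, hi₁, hJ₁⟩ := hΓ.exists_integral_level_eq_one hbot ha haA
  set m := ∫ t, k t with hm
  have hI : ∀ {k : ℝ → ℝ}, Continuous k → (∀ t ≤ -A, k t = 0) → (∀ t, -a ≤ t → k t = 0) →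
      Integrable k := fun hk hA ha =>
    hk.integrable_of_hasCompactSupport (hasCompactSupport_of_vanishing hA ha)
  have hJ : ∀ {k : ℝ → ℝ}, Continuous k → (∀ t ≤ -A, k t = 0) → (∀ t, -a ≤ t → k t = 0) →
      Integrable (fun q => k (Γ q) * C.gradSq Γ q) C.lebesgue := fun hk hA hka => by
    simpa using hΓ.integrable_level hbot ha hk hA hka (w := fun _ => 1)
      fun _ _ => continuousAt_const
  have h0 := hΓ.integral_level_eq_zero hbot ha (A := A) (k := fun t => k t - m * k₁ t)
    (hk.sub (continuous_const.mul hk₁)) (fun t ht => by simp [hA t ht, hA₁ t ht])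
    (fun t ht => by simp [hka t ht, ha₁ t ht])
    (by rw [integral_sub (hI hk hA hka) ((hI hk₁ hA₁ ha₁).const_mul m), integral_const_mul, hi₁, hm]
        ring)
    (w := fun _ => 1) (fun _ _ => smoothAt_const 1) (fun _ _ => subLaplacian_const 1)
  simp only [one_mul, sub_mul, mul_assoc] at h0
  rw [integral_sub (hJ hk hA hka) ((hJ hk₁ hA₁ ha₁).const_mul m), integral_const_mul, hJ₁] at h0
  linarith

/-- The mean value property of harmonic functions over layers between level sets of `Γ`. -/
theorem IsFundamentalSolution.integral_level [Nonempty ι] (hΓ : C.IsFundamentalSolution Γ)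
    (hbot : Tendsto Γ (𝓝[≠] 1) atBot) (ha : 0 < a) (hk : Continuous k)
    (hA : ∀ t ≤ -A, k t = 0) (hka : ∀ t, -a ≤ t → k t = 0)
    (hw : ∀ q ∈ sublevel Γ a, C.SmoothAt 2 w q)
    (hLw : ∀ q ∈ sublevel Γ a, C.subLaplacian w q = 0) :
    ∫ q, w q * (k (Γ q) * C.gradSq Γ q) ∂C.lebesgue = w 1 * ∫ t, k t := by
  have hT : T2Space G := C.t2Space
  set m := ∫ t, k t with hm
  have hwc : ∀ q ∈ sublevel Γ a, ContinuousAt w q := fun q hq => (hw q hq).continuousAt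
  suffices h : ∀ ε > 0, |∫ q, w q * (k (Γ q) * C.gradSq Γ q) ∂C.lebesgue - w 1 * m| ≤ |m| * ε by
    have h1 : |∫ q, w q * (k (Γ q) * C.gradSq Γ q) ∂C.lebesgue - w 1 * m| ≤ 0 := by
      refine le_of_forall_pos_le_add fun ε hε => ?_
      refine (h (ε / (|m| + 1)) (by positivity)).trans ?_
      rw [zero_add, mul_div_assoc', div_le_iff₀ (by positivity)]
      nlinarith [abs_nonneg m]
    exact sub_eq_zero.1 (abs_eq_zero.1 (le_antisymm h1 (abs_nonneg _)))
  intro ε hε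
  obtain ⟨V, hV, hVo, hV1⟩ : ∃ V : Set G, (∀ q ∈ V, |w q - w 1| ≤ ε) ∧ IsOpen V ∧ (1 : G) ∈ V := by
    have h1 : ∀ᶠ q in 𝓝 (1 : G), |w q - w 1| ≤ ε := by
      filter_upwards [Metric.tendsto_nhds.1 (hwc 1 (Or.inl rfl)) ε hε] with q hq
      exact (Real.dist_eq _ _ ▸ hq).le
    exact eventually_nhds_iff.1 h1
  obtain ⟨b, hb⟩ : ∃ b, ∀ q ∈ sublevel Γ a \ V, b ≤ Γ q := by
    have hcomp : IsCompact (sublevel Γ a \ V) := (hΓ.isCompact_sublevel ha).diff hVo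
    have hcont : ContinuousOn Γ (sublevel Γ a \ V) := fun q hq =>
      (hΓ.continuousAt fun h => hq.2 (by rw [h]; exact hV1)).continuousWithinAt
    obtain ⟨b, hb⟩ := hcomp.bddBelow_image hcont
    exact ⟨b, fun q hq => hb ⟨q, hq, rfl⟩⟩
  -- On the sublevel set outside `V` one has `Γ > -a₂`. A bump supported below `-a₂` therefore sees
  -- only points of `V`, where `w` is within `ε` of `w 1`.
  set a₂ := max a (-b) + 1 with ha₂
  have ha₂a : a < a₂ := by have := le_max_left a (-b); linarith
  have ha₂b : -a₂ < b := by have := le_max_right a (-b); linarith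
  obtain ⟨k₂, hk₂, hk₂0, hA₂, hka₂, hi₂⟩ := exists_normalized_bump
    (b := -(a₂ + 1)) (d := -a₂) (by linarith)
  have hka₂' : ∀ t, -a ≤ t → k₂ t = 0 := fun t ht => hka₂ t (by linarith)
  set B := max A (a₂ + 1) with hB
  have hAB : A ≤ B := le_max_left _ _
  have haB : a₂ + 1 ≤ B := le_max_right _ _
  have hAB₁ : ∀ t ≤ -B, k t = 0 := fun t ht => hA t (by linarith)
  have hAB₂ : ∀ t ≤ -B, k₂ t = 0 := fun t ht => hA₂ t (by linarith)
  have hI : ∀ {k : ℝ → ℝ}, Continuous k → (∀ t ≤ -B, k t = 0) → (∀ t, -a ≤ t → k t = 0) →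
      Integrable k := fun hk hA ha =>
    hk.integrable_of_hasCompactSupport (hasCompactSupport_of_vanishing hA ha)
  have hJ : ∀ {k : ℝ → ℝ}, Continuous k → (∀ t ≤ -B, k t = 0) → (∀ t, -a ≤ t → k t = 0) →
      Integrable (fun q => w q * (k (Γ q) * C.gradSq Γ q)) C.lebesgue := fun hk hA hka =>
    hΓ.integrable_level hbot ha hk hA hka hwc
  have hJ1 : Integrable (fun q => k₂ (Γ q) * C.gradSq Γ q) C.lebesgue := by
    simpa using hΓ.integrable_level hbot ha hk₂ hAB₂ hka₂' (w := fun _ => 1)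
      fun _ _ => continuousAt_const
  -- Subtracting `m k₂` restores mean zero, so `k` may be replaced by its mass concentrated near the
  -- identity.
  have h0 := hΓ.integral_level_eq_zero hbot ha (A := B) (k := fun t => k t - m * k₂ t)
    (hk.sub (continuous_const.mul hk₂)) (fun t ht => by simp [hAB₁ t ht, hAB₂ t ht])
    (fun t ht => by simp [hka t ht, hka₂' t ht])
    (by rw [integral_sub (hI hk hAB₁ hka) ((hI hk₂ hAB₂ hka₂').const_mul m), integral_const_mul,
          hi₂, hm]
        ring) hw hLw
  have hsplit : ∀ q, w q * ((k (Γ q) - m * k₂ (Γ q)) * C.gradSq Γ q) =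
      w q * (k (Γ q) * C.gradSq Γ q) - m * (w q * (k₂ (Γ q) * C.gradSq Γ q)) := fun q => by ring
  simp only [hsplit] at h0
  rw [integral_sub (hJ hk hAB₁ hka) ((hJ hk₂ hAB₂ hka₂').const_mul m), integral_const_mul,
    sub_eq_zero] at h0
  rw [h0]
  have h1 : ∫ q, k₂ (Γ q) * C.gradSq Γ q ∂C.lebesgue = 1 := by
    rw [hΓ.integral_level_one hbot (A := B) ha (by linarith) hk₂ hAB₂ hka₂', hi₂]
  have h2 : m * ∫ q, w q * (k₂ (Γ q) * C.gradSq Γ q) ∂C.lebesgue - w 1 * m =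
      m * ∫ q, (w q - w 1) * (k₂ (Γ q) * C.gradSq Γ q) ∂C.lebesgue := by
    simp only [sub_mul]
    rw [integral_sub (hJ hk₂ hAB₂ hka₂') (hJ1.const_mul (w 1)), integral_const_mul, h1]
    ring
  rw [h2, abs_mul]
  refine mul_le_mul_of_nonneg_left ?_ (abs_nonneg m)
  have h3 : ‖∫ q, (w q - w 1) * (k₂ (Γ q) * C.gradSq Γ q) ∂C.lebesgue‖ ≤
      ∫ q, ε * (k₂ (Γ q) * C.gradSq Γ q) ∂C.lebesgue := by
    refine norm_integral_le_of_norm_le (hJ1.const_mul ε) (Eventually.of_forall fun q => ?_)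
    have hnn : 0 ≤ k₂ (Γ q) * C.gradSq Γ q := mul_nonneg (hk₂0 _) gradSq_nonneg
    rw [norm_mul, Real.norm_of_nonneg hnn]
    by_cases hq : q ∈ V
    · exact mul_le_mul_of_nonneg_right (hV q hq) hnn
    · have : k₂ (Γ q) = 0 := by
        by_cases hqa : Γ q ≤ -a
        · exact hka₂ _ (by have := hb q ⟨Or.inr hqa, hq⟩; linarith)
        · exact hka₂' _ (not_le.1 hqa).le
      simp [this]
  rwa [integral_const_mul, h1, mul_one] at h3

end CarnotGroup

/-! ### From layers to full sublevel sets. -/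

namespace CarnotGroup

theorem indicator_sublevel_of_ne {G : Type*} [Group G] {Γ : G → ℝ} {q : G} {a : ℝ} (hq : q ≠ 1) (f : G → ℝ) : (sublevel Γ a).indicator f q =
    (Set.Iic (-a)).indicator (fun _ => 1) (Γ q) * f q := by
  by_cases h : Γ q ≤ -a
  · rw [Set.indicator_of_mem (show q ∈ sublevel Γ a from Or.inr h),
      Set.indicator_of_mem (show Γ q ∈ Set.Iic (-a) from h), one_mul]
  · rw [Set.indicator_of_notMem (show q ∉ sublevel Γ a from not_or.2 ⟨hq, h⟩),
      Set.indicator_of_notMem (show Γ q ∉ Set.Iic (-a) from h), zero_mul]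

variable {G 𝔤 ι : Type*} [Group G] [TopologicalSpace G] [LieRing 𝔤] [LieAlgebra ℝ 𝔤] [Fintype ι]
  {C : CarnotGroup G 𝔤 ι} {Γ w : G → ℝ} {p q : G} {κ : ℝ → ℝ} {a b b' : ℝ}

variable [MeasurableSpace G] [BorelSpace G] [IsTopologicalGroup G] [C.lebesgue.IsHaarMeasure]
  [C.lebesgue.IsMulRightInvariant]

/-- The layer formula for constants bounds the truncated integrals by `∫ κ`, uniformly in the
truncation; Fatou's lemma passes this to the limit. The gap `b < a` leaves room for the trapezoids.
-/
theorem IsFundamentalSolution.integrableOn_sublevel [Nonempty ι] (hΓ : C.IsFundamentalSolution Γ)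
    (hbot : Tendsto Γ (𝓝[≠] 1) atBot) (hb : 0 < b) (hba : b < a) (hκ : Continuous κ)
    (hκ0 : ∀ t, 0 ≤ κ t) (hκi : IntegrableOn κ (Set.Iic (-b))) :
    IntegrableOn (fun q => κ (Γ q) * C.gradSq Γ q) (sublevel Γ a) C.lebesgue := by
  have hT : T2Space G := C.t2Space
  obtain ⟨χ, hχ, hχ0, hχ1, hχA, hχb, hχl⟩ := exists_trapezoids (neg_lt_neg hba)
  let f : ℕ → G → ℝ := fun n q => χ n (Γ q) * κ (Γ q) * C.gradSq Γ q
  have hfi : ∀ n, Integrable (f n) C.lebesgue := fun n => by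
    simpa using hΓ.integrable_level hbot hb (k := fun t => χ n t * κ t) (A := n)
      ((hχ n).mul hκ) (fun t ht => by simp [hχA n t ht]) (fun t ht => by simp [hχb n t ht])
      (w := fun _ => 1) fun _ _ => continuousAt_const
  have hf0 : ∀ n q, 0 ≤ f n q := fun n q =>
    mul_nonneg (mul_nonneg (hχ0 _ _) (hκ0 _)) gradSq_nonneg
  have hfb : ∀ n, ∫ q, f n q ∂C.lebesgue ≤ ∫ t in Set.Iic (-b), κ t := fun n => by
    have hz : ∀ t ∉ Set.Iic (-b), χ n t * κ t = 0 := fun t ht => by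
      rw [hχb n t (not_le.1 ht).le, zero_mul]
    have h1 := hΓ.integral_level_one hbot hb (k := fun t => χ n t * κ t) (A := max n (b + 1))
      (by have := le_max_right (n : ℝ) (b + 1); linarith) ((hχ n).mul hκ)
      (fun t ht => by rw [hχA n t (by have := le_max_left (n : ℝ) (b + 1); linarith), zero_mul])
      (fun t ht => by rw [hχb n t ht, zero_mul])
    change ∫ q, χ n (Γ q) * κ (Γ q) * C.gradSq Γ q ∂C.lebesgue ≤ _
    rw [h1, ← setIntegral_eq_integral_of_forall_compl_eq_zero hz]
    refine setIntegral_mono_on (hκi.mono' ((hχ n).mul hκ).aestronglyMeasurable ?_) hκi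
      measurableSet_Iic fun t _ => mul_le_of_le_one_left (hκ0 t) (hχ1 n t)
    refine Eventually.of_forall fun t => ?_
    rw [Real.norm_of_nonneg (mul_nonneg (hχ0 n t) (hκ0 t))]
    exact mul_le_of_le_one_left (hκ0 t) (hχ1 n t)
  have hlim : ∀ᵐ q ∂C.lebesgue, Tendsto (fun n => f n q) atTop
      (𝓝 ((sublevel Γ a).indicator (fun q => κ (Γ q) * C.gradSq Γ q) q)) := by
    filter_upwards [ae_ne_one C] with q hq
    rw [indicator_sublevel_of_ne hq, ← mul_assoc]
    exact ((hχl (Γ q)).mul_const _).mul_const _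
  rw [← integrable_indicator_iff (hΓ.isCompact_sublevel (hb.trans hba)).measurableSet]
  refine ⟨aestronglyMeasurable_of_tendsto_ae atTop (fun n => (hfi n).1) hlim, ?_⟩
  have h1 := lintegral_liminf_le' (μ := C.lebesgue) (u := atTop)
    (fun n => (hfi n).1.aemeasurable.enorm)
  have h2 : ∫⁻ q, ‖(sublevel Γ a).indicator (fun q => κ (Γ q) * C.gradSq Γ q) q‖ₑ ∂C.lebesgue =
      ∫⁻ q, liminf (fun n => ‖f n q‖ₑ) atTop ∂C.lebesgue := by
    refine lintegral_congr_ae ?_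
    filter_upwards [hlim] with q hq using hq.enorm.liminf_eq.symm
  have h3 : ∀ n, ∫⁻ q, ‖f n q‖ₑ ∂C.lebesgue ≤ ENNReal.ofReal (∫ t in Set.Iic (-b), κ t) := by
    intro n
    simp only [Real.enorm_of_nonneg (hf0 n _)]
    rw [← ofReal_integral_eq_lintegral_ofReal (hfi n) (Eventually.of_forall (hf0 n))]
    exact ENNReal.ofReal_le_ofReal (hfb n)
  rw [HasFiniteIntegral, h2]
  refine (h1.trans ?_).trans_lt (ENNReal.ofReal_lt_top (r := ∫ t in Set.Iic (-b), κ t))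
  exact liminf_le_of_le (by isBoundedDefault) fun c hc => by
    obtain ⟨n, hn⟩ := hc.exists
    exact hn.trans (h3 n)

/-- The mean value property of harmonic functions over sublevel sets of `Γ`. -/
theorem IsFundamentalSolution.setIntegral_sublevel [Nonempty ι] (hΓ : C.IsFundamentalSolution Γ)
    (hbot : Tendsto Γ (𝓝[≠] 1) atBot) (hb : 0 < b) (hbb' : b < b') (hba : b' < a)
    (hκ : Continuous κ) (hκ0 : ∀ t, 0 ≤ κ t) (hκi : IntegrableOn κ (Set.Iic (-b)))
    (hw : ∀ q ∈ sublevel Γ b', C.SmoothAt 2 w q)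
    (hLw : ∀ q ∈ sublevel Γ b', C.subLaplacian w q = 0) :
    IntegrableOn (fun q => w q * (κ (Γ q) * C.gradSq Γ q)) (sublevel Γ a) C.lebesgue ∧
      ∫ q in sublevel Γ a, w q * (κ (Γ q) * C.gradSq Γ q) ∂C.lebesgue =
        w 1 * ∫ t in Set.Iic (-a), κ t := by
  have hT : T2Space G := C.t2Space
  have hb' : 0 < b' := hb.trans hbb'
  have hwc : ∀ q ∈ sublevel Γ b', ContinuousAt w q := fun q hq => (hw q hq).continuousAt
  obtain ⟨χ, hχ, hχ0, hχ1, hχA, hχb, hχl⟩ := exists_trapezoids (neg_lt_neg hba)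
  let f : ℕ → G → ℝ := fun n q => w q * (χ n (Γ q) * κ (Γ q) * C.gradSq Γ q)
  have hfi : ∀ n, Integrable (f n) C.lebesgue := fun n =>
    hΓ.integrable_level hbot hb' (k := fun t => χ n t * κ t) (A := n)
      ((hχ n).mul hκ) (fun t ht => by simp [hχA n t ht]) (fun t ht => by simp [hχb n t ht]) hwc
  have hfv : ∀ n, ∫ q, f n q ∂C.lebesgue = w 1 * ∫ t, χ n t * κ t := fun n =>
    hΓ.integral_level hbot hb' (k := fun t => χ n t * κ t) (A := n)
      ((hχ n).mul hκ) (fun t ht => by simp [hχA n t ht]) (fun t ht => by simp [hχb n t ht]) hw hLw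
  have hms : ∀ {c : ℝ}, 0 < c → MeasurableSet (sublevel Γ c) := fun hc =>
    (hΓ.isCompact_sublevel hc).measurableSet
  obtain ⟨M, hM⟩ := (hΓ.isCompact_sublevel hb').exists_bound_of_continuousOn
    (fun q hq => (hwc q hq).continuousWithinAt)
  -- The trapezoids end at `-b'`, so this majorant works for all `n`; its integrability uses the
  -- further gap `b < b'`.
  have hbound : Integrable ((sublevel Γ b').indicator
      fun q => M * (κ (Γ q) * C.gradSq Γ q)) C.lebesgue :=
    (integrable_indicator_iff (hms hb')).2
      ((hΓ.integrableOn_sublevel hbot hb hbb' hκ hκ0 hκi).const_mul M)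
  have hle : ∀ n q, ‖f n q‖ ≤ (sublevel Γ b').indicator
      (fun q => M * (κ (Γ q) * C.gradSq Γ q)) q := by
    intro n q
    have hnn : 0 ≤ κ (Γ q) * C.gradSq Γ q := mul_nonneg (hκ0 _) gradSq_nonneg
    by_cases hq : q ∈ sublevel Γ b'
    · rw [Set.indicator_of_mem hq, norm_mul, mul_assoc, norm_mul, Real.norm_of_nonneg (hχ0 _ _),
        Real.norm_of_nonneg hnn]
      exact mul_le_mul (hM q hq) (mul_le_of_le_one_left hnn (hχ1 _ _))
        (mul_nonneg (hχ0 _ _) hnn) ((norm_nonneg _).trans (hM q hq))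
    · rw [Set.indicator_of_notMem hq]
      simp [f, hχb n (Γ q) (not_le.1 fun h => hq (Or.inr h)).le]
  have hlim : ∀ᵐ q ∂C.lebesgue, Tendsto (fun n => f n q) atTop
      (𝓝 ((sublevel Γ a).indicator (fun q => w q * (κ (Γ q) * C.gradSq Γ q)) q)) := by
    filter_upwards [ae_ne_one C] with q hq
    rw [indicator_sublevel_of_ne hq]
    have := ((hχl (Γ q)).mul_const (w q * (κ (Γ q) * C.gradSq Γ q)))
    refine this.congr fun n => ?_
    simp only [f]
    ring
  have hI : Integrable ((sublevel Γ a).indicator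
      fun q => w q * (κ (Γ q) * C.gradSq Γ q)) C.lebesgue := by
    refine hbound.mono' (aestronglyMeasurable_of_tendsto_ae atTop (fun n => (hfi n).1) hlim) ?_
    filter_upwards [hlim] with q hq
    exact le_of_tendsto' hq.norm fun n => hle n q
  refine ⟨(integrable_indicator_iff (hms (hb'.trans hba))).1 hI, ?_⟩
  rw [← integral_indicator (hms (hb'.trans hba))]
  have h1 := tendsto_integral_of_dominated_convergence _ (fun n => (hfi n).1) hbound
    (fun n => Eventually.of_forall (hle n)) hlim
  simp only [hfv] at h1
  -- The same sequence of integrals is also `w 1` times one-dimensional integrals, whose limit is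
  -- found by dominated convergence with majorant `κ`.
  refine tendsto_nhds_unique h1 (Tendsto.const_mul _ ?_)
  rw [← integral_indicator measurableSet_Iic]
  refine tendsto_integral_of_dominated_convergence ((Set.Iic (-b)).indicator κ)
    (fun n => ((hχ n).mul hκ).aestronglyMeasurable)
    ((integrable_indicator_iff measurableSet_Iic).2 hκi)
    (fun n => Eventually.of_forall fun t => ?_) (Eventually.of_forall fun t => ?_)
  · rw [Real.norm_of_nonneg (mul_nonneg (hχ0 _ _) (hκ0 _))]
    by_cases ht : t ∈ Set.Iic (-b)
    · rw [Set.indicator_of_mem ht]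
      exact mul_le_of_le_one_left (hκ0 t) (hχ1 n t)
    · rw [Set.indicator_of_notMem ht, hχb n t (by
        have : -b < t := not_le.1 ht
        linarith), zero_mul]
  · have h2 : (Set.Iic (-a)).indicator κ t = (Set.Iic (-a)).indicator (fun _ => 1) t * κ t := by
      by_cases ht : t ∈ Set.Iic (-a) <;> simp [ht]
    rw [h2]
    exact (hχl t).mul_const _

end CarnotGroup

/-! ### The gauge: its gradient, weight and balls. -/

/-- The weight that turns `|∇₀ Γ|²` into `|∇₀ N|²` for `N = (-Γ)^β`, cut off near zero. -/
noncomputable def gaugeWeight (β b t : ℝ) : ℝ := (β * (max b (-t)) ^ (β - 1)) ^ 2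

theorem continuous_gaugeWeight {β b : ℝ} (hb : 0 < b) : Continuous (gaugeWeight β b) := by
  refine (continuous_const.mul (Continuous.rpow_const (by fun_prop) fun t => Or.inl ?_)).pow 2
  exact (lt_max_of_lt_left hb).ne'

theorem gaugeWeight_nonneg (β b t : ℝ) : 0 ≤ gaugeWeight β b t := sq_nonneg _

theorem gaugeWeight_of_le {β b t : ℝ} (h : t ≤ -b) :
    gaugeWeight β b t = (β * (-t) ^ (β - 1)) ^ 2 := by
  rw [gaugeWeight, max_eq_right (by linarith)]

/-- On this half-line the weight is `β² (-t)^(2(β-1))`, and `2(β-1) < -1` because `β < 0`. -/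
theorem integrableOn_gaugeWeight {β b : ℝ} (hb : 0 < b) (hβ : β < 0) :
    IntegrableOn (gaugeWeight β b) (Set.Iic (-b)) := by
  have h1 : IntegrableOn (fun x : ℝ => β ^ 2 * x ^ (2 * (β - 1))) (Set.Ici b) :=
    ((integrableOn_Ici_iff_integrableOn_Ioi).2
      (integrableOn_Ioi_rpow_of_lt (by linarith) hb)).const_mul _
  have h2 := ((Measure.measurePreserving_neg (volume : Measure ℝ)).integrableOn_comp_preimage
    (Homeomorph.neg ℝ).measurableEmbedding).2 h1
  have h3 : (Neg.neg ⁻¹' Set.Ici b : Set ℝ) = Set.Iic (-b) := by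
    ext t; simp
  rw [h3] at h2
  refine h2.congr_fun (fun t ht => ?_) measurableSet_Iic
  have ht : t ≤ -b := ht
  simp only [Function.comp]
  rw [gaugeWeight_of_le ht, mul_pow, ← Real.rpow_natCast ((-t) ^ (β - 1)),
    ← Real.rpow_mul (by linarith)]
  congr 2
  push_cast
  ring

theorem setIntegral_gaugeWeight_pos {β a b : ℝ} (hb : 0 < b) (hba : b ≤ a) (hβ : β < 0) :
    0 < ∫ t in Set.Iic (-a), gaugeWeight β b t := by
  rw [setIntegral_pos_iff_support_of_nonneg_ae
    (Eventually.of_forall fun t => gaugeWeight_nonneg β b t)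
    ((integrableOn_gaugeWeight hb hβ).mono_set (Set.Iic_subset_Iic.2 (by linarith)))]
  have : Function.support (gaugeWeight β b) = Set.univ := by
    refine Set.eq_univ_of_forall fun t => ?_
    exact pow_ne_zero _ (mul_ne_zero hβ.ne (Real.rpow_pos_of_pos (lt_max_of_lt_left hb) _).ne')
  rw [this, Set.univ_inter, Real.volume_Iic]
  exact ENNReal.zero_lt_top

namespace CarnotGroup

variable {G 𝔤 ι : Type*} [Group G] [TopologicalSpace G] [LieRing 𝔤] [LieAlgebra ℝ 𝔤] [Fintype ι]
  {C : CarnotGroup G 𝔤 ι} {Γ : G → ℝ} {p : G} {a b r : ℝ}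

/-- Raising to the negative power `2 - Q` reverses the inequality `(-Γ)^(1/(2-Q)) ≤ r`; this needs
`-Γ > 0`. -/
theorem pseudoBall_gauge_one (hQ : 2 < C.homDim) (hneg : ∀ q, q ≠ 1 → Γ q < 0) (hr : 0 < r) :
    pseudoBall (C.gauge Γ) 1 r = sublevel Γ (r ^ (2 - (C.homDim : ℝ))) := by
  have hβ : (2 : ℝ) - C.homDim < 0 := by
    have : (2 : ℝ) < C.homDim := by exact_mod_cast hQ
    linarith
  ext q
  change C.gauge Γ (1⁻¹ * q) ≤ r ↔ q = 1 ∨ _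
  rw [inv_one, one_mul, gauge]
  by_cases hq : q = 1
  · simp [hq, hr.le]
  · rw [if_neg hq, one_div, Real.rpow_inv_le_iff_of_neg (neg_pos.2 (hneg q hq)) hr hβ,
      or_iff_right hq, le_neg]

theorem norm_horizontalGradient_gauge_sq [MeasurableSpace G] (hΓ : C.IsFundamentalSolution Γ)
    (hneg : ∀ q, q ≠ 1 → Γ q < 0) (hp : p ≠ 1) (hpb : Γ p ≤ -b) :
    ‖C.horizontalGradient (C.gauge Γ) p‖ ^ 2 =
      gaugeWeight (1 / (2 - (C.homDim : ℝ))) b (Γ p) * C.gradSq Γ p := by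
  have hT : T2Space G := C.t2Space
  set β := 1 / (2 - (C.homDim : ℝ)) with hβ
  have h1 : C.gauge Γ =ᶠ[𝓝 p] fun q => (fun t : ℝ => (-t) ^ β) (Γ q) := by
    filter_upwards [isOpen_compl_singleton.mem_nhds hp] with q hq
    have hq : q ≠ 1 := hq
    rw [gauge, if_neg hq]
  have h2 : HasDerivAt (fun t : ℝ => (-t) ^ β) (-(β * (-Γ p) ^ (β - 1))) (Γ p) := by
    have h3 := (hasDerivAt_neg (Γ p)).rpow_const (p := β) (Or.inl (neg_pos.2 (hneg p hp)).ne')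
    convert h3 using 1
    ring
  rw [norm_horizontalGradient_sq, gradSq_congr h1, gradSq_comp h2 (hΓ.smoothAt (n := 1) hp),
    gaugeWeight_of_le hpb, neg_sq]

/-- Room around the ball: on the compact remainder of `{Γ ≤ -a/2}` outside `U`, the minimum of `Γ`
is attained and exceeds `-a`. -/
theorem IsFundamentalSolution.exists_sublevel_subset [MeasurableSpace G]
    (hΓ : C.IsFundamentalSolution Γ) (ha : 0 < a) {U : Set G} (hU : IsOpen U)
    (h : sublevel Γ a ⊆ U) : ∃ b, 0 < b ∧ b < a ∧ sublevel Γ b ⊆ U := by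
  have hT : T2Space G := C.t2Space
  rcases Set.eq_empty_or_nonempty (sublevel Γ (a / 2) \ U) with he | hne
  · exact ⟨a / 2, by linarith, by linarith, Set.sdiff_eq_empty.1 he⟩
  · have hq1 : ∀ q ∈ sublevel Γ (a / 2) \ U, q ≠ 1 := fun q hq h1 =>
      hq.2 (h (Or.inl h1))
    obtain ⟨q, hq, hmin⟩ := ((hΓ.isCompact_sublevel (half_pos ha)).diff hU).exists_isMinOn hne
      (fun q hq => (hΓ.continuousAt (hq1 q hq)).continuousWithinAt)
    have hqa : -a < Γ q := by
      by_contra! hle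
      exact hq.2 (h (Or.inr hle))
    have hqa2 : Γ q ≤ -(a / 2) := hq.1.resolve_left (hq1 q hq)
    -- The midpoint of `a` and `-Γ q`, where `a / 2 ≤ -Γ q < a`.
    refine ⟨(a - Γ q) / 2, by linarith, by linarith, fun x hx => ?_⟩
    by_contra hxU
    have hxm : x ∈ sublevel Γ (a / 2) \ U := ⟨sublevel_anti (by linarith) Γ hx, hxU⟩
    have h1 : Γ q ≤ Γ x := hmin hxm
    have h2 := hx.resolve_left (hq1 x hxm)
    linarith

end CarnotGroup

/-! ### The mean value theorem. -/

theorem theorem4p6 {G 𝔤 ι : Type*} [Group G] [TopologicalSpace G] [MeasurableSpace G]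
    [BorelSpace G] [LieRing 𝔤] [LieAlgebra ℝ 𝔤] [Fintype ι]
    (C : CarnotGroup G 𝔤 ι) (hQ : 2 < C.homDim)
    (Γ : G → ℝ) (hΓ : C.IsFundamentalSolution Γ)
    (N : G → ℝ) (hN : N = C.gauge Γ)
    (Ω : Set G) (hΩ : IsOpen Ω) (hΩ' : IsConnected Ω)
    (u : G → ℝ) (hu : C.IsHarmonicOn u Ω)
    (p : G) (r : ℝ) (hr : 0 < r)
    (hB : IsCompact (closure (pseudoBall N p r))) (hBΩ : closure (pseudoBall N p r) ⊆ Ω) :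
    (IntegrableOn (fun q => ‖C.horizontalGradient N (p⁻¹ * q)‖ ^ 2) (pseudoBall N p r)
        C.lebesgue ∧
      IntegrableOn (fun q => u q * ‖C.horizontalGradient N (p⁻¹ * q)‖ ^ 2) (pseudoBall N p r)
        C.lebesgue ∧
      0 < ∫ q in pseudoBall N p r, ‖C.horizontalGradient N (p⁻¹ * q)‖ ^ 2 ∂C.lebesgue ∧
      u p = (∫ q in pseudoBall N p r, u q * ‖C.horizontalGradient N (p⁻¹ * q)‖ ^ 2 ∂C.lebesgue) /
        ∫ q in pseudoBall N p r, ‖C.horizontalGradient N (p⁻¹ * q)‖ ^ 2 ∂C.lebesgue) ∧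
    (IntegrableOn (fun q => ‖C.horizontalGradient N q‖ ^ 2) (pseudoBall N 1 r) C.lebesgue ∧
      IntegrableOn (fun q => u (p * q) * ‖C.horizontalGradient N q‖ ^ 2) (pseudoBall N 1 r)
        C.lebesgue ∧
      0 < ∫ q in pseudoBall N 1 r, ‖C.horizontalGradient N q‖ ^ 2 ∂C.lebesgue ∧
      u p = (∫ q in pseudoBall N 1 r, u (p * q) * ‖C.horizontalGradient N q‖ ^ 2 ∂C.lebesgue) /
        ∫ q in pseudoBall N 1 r, ‖C.horizontalGradient N q‖ ^ 2 ∂C.lebesgue) := by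
  have hT : T2Space G := C.t2Space
  have hTG : IsTopologicalGroup G := C.isTopologicalGroup
  have hHaar : C.lebesgue.IsHaarMeasure := C.isHaarMeasure
  have hRight : C.lebesgue.IsMulRightInvariant := C.isMulRightInvariant
  have hInv : C.lebesgue.IsInvInvariant := C.isInvInvariant
  have hne : Nonempty ι := (C.exists_weight_eq_one (by omega)).nonempty
  subst hN
  have hneg : ∀ q, q ≠ 1 → Γ q < 0 := fun q hq =>
    hΓ.neg_of_isCompact_closure_pseudoBall hQ hr hB hq
  have hbot := hΓ.tendsto_atBot hQ hneg
  set β := 1 / (2 - (C.homDim : ℝ)) with hβ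
  have hβ0 : β < 0 := by
    have : (2 : ℝ) < C.homDim := by exact_mod_cast hQ
    exact one_div_neg.2 (by linarith)
  set a := r ^ (2 - (C.homDim : ℝ)) with ha
  have ha0 : 0 < a := Real.rpow_pos_of_pos hr _
  have hball1 : pseudoBall (C.gauge Γ) 1 r = CarnotGroup.sublevel Γ a := CarnotGroup.pseudoBall_gauge_one hQ hneg hr
  have hpre : pseudoBall (C.gauge Γ) p r =
      (fun q => p⁻¹ * q) ⁻¹' pseudoBall (C.gauge Γ) 1 r := by
    ext q
    simp [pseudoBall]
  have hsub : CarnotGroup.sublevel Γ a ⊆ (fun q => p * q) ⁻¹' Ω := by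
    intro q hq
    refine hBΩ (subset_closure ?_)
    rw [hpre, hball1]
    simpa using hq
  obtain ⟨b', hb'0, hb'a, hb'Ω⟩ := hΓ.exists_sublevel_subset ha0
    (hΩ.preimage (continuous_const_mul p)) hsub
  -- The weight is cut off strictly outside the level `b'` up to which `u(p ·)` is harmonic; on the
  -- ball itself, where `Γ ≤ -a < -b`, the cutoff has no effect.
  set b := b' / 2 with hb
  have hb0 : 0 < b := by linarith
  have hmeas : MeasurableSet (CarnotGroup.sublevel Γ a) := (hΓ.isCompact_sublevel ha0).measurableSet
  have hcongr : ∀ v : G → ℝ, ∀ᵐ q ∂C.lebesgue.restrict (CarnotGroup.sublevel Γ a),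
      v q * (gaugeWeight β b (Γ q) * C.gradSq Γ q) =
        v q * ‖C.horizontalGradient (C.gauge Γ) q‖ ^ 2 := fun v => by
    filter_upwards [ae_restrict_mem hmeas, ae_restrict_of_ae (CarnotGroup.ae_ne_one C)] with q hq hq1
    rw [CarnotGroup.norm_horizontalGradient_gauge_sq hΓ hneg hq1
      ((hq.resolve_left hq1).trans (by linarith) : Γ q ≤ -b)]
  set I := ∫ t in Set.Iic (-a), gaugeWeight β b t with hI
  have hIpos : 0 < I := setIntegral_gaugeWeight_pos hb0 (by linarith) hβ0
  -- Used for `v = 1` and for `v = u(p ·)`; the common factor `I` cancels in the quotient.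
  have key : ∀ v : G → ℝ, (∀ q ∈ CarnotGroup.sublevel Γ b', C.SmoothAt 2 v q) →
      (∀ q ∈ CarnotGroup.sublevel Γ b', C.subLaplacian v q = 0) →
      IntegrableOn (fun q => v q * ‖C.horizontalGradient (C.gauge Γ) q‖ ^ 2) (CarnotGroup.sublevel Γ a)
        C.lebesgue ∧
      ∫ q in CarnotGroup.sublevel Γ a, v q * ‖C.horizontalGradient (C.gauge Γ) q‖ ^ 2 ∂C.lebesgue =
        v 1 * I := by
    intro v hv hLv
    obtain ⟨h1, h2⟩ := hΓ.setIntegral_sublevel hbot hb0 (by linarith) hb'a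
      (continuous_gaugeWeight (β := β) hb0) (gaugeWeight_nonneg β b)
      (integrableOn_gaugeWeight hb0 hβ0) hv hLv
    exact ⟨h1.congr (hcongr v), by rw [← h2, integral_congr_ae (hcongr v)]⟩
  obtain ⟨hi1, he1⟩ := key (fun _ => 1) (fun _ _ => CarnotGroup.smoothAt_const 1)
    (fun _ _ => CarnotGroup.subLaplacian_const 1)
  obtain ⟨hi2, he2⟩ := key (fun q => u (p * q))
    (fun q hq => (hu.1.smoothAt (n := 2) hΩ (hb'Ω hq)).comp_mul_left)
    (fun q hq => by rw [CarnotGroup.subLaplacian_comp_mul_left]; exact hu.2 _ (hb'Ω hq))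
  simp only [one_mul] at hi1 he1
  simp only [mul_one] at he2
  -- The integrals over the ball at `p` are pulled back from the ball at the identity by `q ↦ p⁻¹
  -- q`.
  have hmp := measurePreserving_mul_left C.lebesgue p⁻¹
  have hme := (Homeomorph.mulLeft p⁻¹).measurableEmbedding
  have hi1' := (hmp.integrableOn_comp_preimage hme).2 hi1
  have hi2' := (hmp.integrableOn_comp_preimage hme).2 hi2
  have he1' := (hmp.setIntegral_preimage_emb hme _ _).trans he1
  have he2' := (hmp.setIntegral_preimage_emb hme _ _).trans he2
  simp only [Function.comp_def, mul_inv_cancel_left] at hi1' hi2' he1' he2'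
  rw [hpre, hball1]
  have hdiv : u p = u p * I / I := (mul_div_cancel_right₀ _ hIpos.ne').symm
  refine ⟨⟨hi1', hi2', by rw [he1']; exact hIpos, by rw [he1', he2']; exact hdiv⟩,
    hi1, hi2, by rw [he1]; exact hIpos, by rw [he1, he2]; exact hdiv⟩
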